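/- A weight on $(0,\infty)$ is a measurable function $(0,\infty)\to[0,\infty]$ that is positive almost everywhere. Let $1<p<\infty$, $0<q,r<\infty$, $p'=p/(p-1)$, and let $u,v,w$ be weights on $(0,\infty)$; use the convention $0\cdot\infty=0$. Put $V(t)=\int_t^\infty v^{1-p'}\in[0,\infty]$. Consider the iterated Copson inequality $$\Bigg(\int_0^\infty\Bigg(\int_x^\infty\Bigg(\int_t^\infty h\Bigg)^r u(t)\,dt\Bigg)^{q/r}w(x)\,dx\Bigg)^{1/q}\le C\Bigg(\int_0^\infty h^p v\Bigg)^{1/p}\qquad(\ast)$$ for all non-negative measurable $h$ on $(0,\infty)$. Say that $(\ast)$ holds if it holds with some finite constant $C$, and let $C_*\in[0,\infty]$ be the best constant, i.e. the infimum of all $C\in[0,\infty]$ for which $(\ast)$ holds for all $h$. Define $$E_1=\operatorname*{ess\,sup}_{t>0}\Bigg(\int_0^t w(s)\Bigg(\int_s^t u\Bigg)^{q/r}ds\Bigg)^{1/q}V(t)^{1/p'},$$ and, when $q<p$, $$E_2=\Bigg(\int_0^\infty\Bigg(\int_0^t w\Bigg)^{\frac q{p-q}}w(t)\Bigg(\operatorname*{ess\,sup}_{x>t}\Bigg(\int_t^x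 u\Bigg)^{\frac1r}V(x)^{\frac1{p'}}\Bigg)^{\frac{pq}{p-q}}dt\Bigg)^{\frac{p-q}{pq}},$$ $$E_3=\Bigg(\int_0^\infty\Bigg(\int_0^t w(s)\Bigg(\int_s^t u\Bigg)^{\frac qr}ds\Bigg)^{\frac q{p-q}}w(t)\operatorname*{ess\,sup}_{x>t}\Bigg(\Bigg(\int_t^x u\Bigg)^{\frac qr}V(x)^{\frac{(p-1)q}{p-q}}\Bigg)dt\Bigg)^{\frac{p-q}{pq}},$$ when $r<p$, $$E_4=\operatorname*{ess\,sup}_{t>0}\Bigg(\int_0^t w\Bigg)^{\frac1q}\Bigg(\int_t^\infty\Bigg(\int_t^x u\Bigg)^{\frac r{p-r}}u(x)V(x)^{\frac{(p-1)r}{p-r}}dx\Bigg)^{\frac{p-r}{pr}},$$ and, when $\max\{q,r\}<p$, $$E_5=\Bigg(\int_0^\infty\Bigg(\int_0^t w\Bigg)^{\frac q{p-q}}w(t)\Bigg(\int_t^\infty\Bigg(\int_t^x u\Bigg)^{\frac r{p-r}}u(x)V(x)^{\frac{(p-1)r}{p-r}}dx\Bigg)^{\frac{q(p-r)}{r(p-q)}}dt\Bigg)^{\frac{p-q}{pq}}.$$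 Then, where $A\approx B$ means $A\le KB$ and $B\le KA$ with a constant $0<K<\infty$ depending only on $p,q,r$: (a) If $p\le\min\{q,r\}$, then $(\ast)$ holds if and only if $E_1<\infty$; moreover $C_*\approx E_1$. (b) If $q<p\le r$, then $(\ast)$ holds if and only if $E_2<\infty$ and $E_3<\infty$; moreover $C_*\approx E_2+E_3$. (c) If $r<p\le q$, then $(\ast)$ holds if and only if $E_1<\infty$ and $E_4<\infty$; moreover $C_*\approx E_1+E_4$. (d) If $\max\{q,r\}<p$, then $(\ast)$ holds if and only if $E_3<\infty$ and $E_5<\infty$; moreover $C_*\approx E_3+E_5$. -/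

import Mathlib

open MeasureTheory Set
open scoped ENNReal NNReal

namespace IterCopson

/-- A weight on `(0,∞)`: a (Lebesgue) measurable, almost everywhere positive function.
Only the values on `(0,∞)` matter. -/
def IsWeight (w : ℝ → ℝ≥0∞) : Prop :=
  AEMeasurable w (volume.restrict (Ioi 0)) ∧ ∀ᵐ x ∂(volume.restrict (Ioi (0 : ℝ))), 0 < w x

/-- `∫_a^b f`. -/
noncomputable def intIoo (f : ℝ → ℝ≥0∞) (a b : ℝ) : ℝ≥0∞ := ∫⁻ s in Ioo a b, f s

/-- `∫_a^∞ f`. -/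
noncomputable def intIoi (f : ℝ → ℝ≥0∞) (a : ℝ) : ℝ≥0∞ := ∫⁻ s in Ioi a, f s

/-- `ess sup` of `f` over `(a,∞)`. -/
noncomputable def essSupIoi (f : ℝ → ℝ≥0∞) (a : ℝ) : ℝ≥0∞ := essSup f (volume.restrict (Ioi a))

/-- `∫_t^∞ v^{1-p'}` with `p' = p / (p - 1)`. -/
noncomputable def dualTail (p : ℝ) (v : ℝ → ℝ≥0∞) (t : ℝ) : ℝ≥0∞ :=
  intIoi (fun y => v y ^ (1 - p.conjExponent)) t

/-- `(∫_0^∞ (∫_x^∞ (∫_t^∞ h)^r u(t) dt)^{q/r} w(x) dx)^{1/q}`. -/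
noncomputable def lhs (q r : ℝ) (u w h : ℝ → ℝ≥0∞) : ℝ≥0∞ :=
  (intIoi (fun x => (intIoi (fun t => intIoi h t ^ r * u t) x) ^ (q / r) * w x) 0) ^ (1 / q)

/-- `(∫_0^∞ h^p v)^{1/p}`. -/
noncomputable def rhsNorm (p : ℝ) (v h : ℝ → ℝ≥0∞) : ℝ≥0∞ :=
  (intIoi (fun x => h x ^ p * v x) 0) ^ (1 / p)

/-- The iterated Copson inequality with constant `C`, for all non-negative measurable `h`. -/
def HoldsWith (p q r : ℝ) (u v w : ℝ → ℝ≥0∞) (C : ℝ≥0∞) : Prop :=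
  ∀ h : ℝ → ℝ≥0∞, AEMeasurable h (volume.restrict (Ioi 0)) →
    lhs q r u w h ≤ C * rhsNorm p v h

/-- The iterated Copson inequality holds with some finite constant. -/
def Holds (p q r : ℝ) (u v w : ℝ → ℝ≥0∞) : Prop :=
  ∃ C : ℝ≥0, HoldsWith p q r u v w C

/-- The best constant (it is `∞` if and only if the inequality holds with no finite constant). -/
noncomputable def bestConst (p q r : ℝ) (u v w : ℝ → ℝ≥0∞) : ℝ≥0∞ :=
  sInf {C : ℝ≥0∞ | HoldsWith p q r u v w C}

noncomputable def E₁ (p q r : ℝ) (u v w : ℝ → ℝ≥0∞) : ℝ≥0∞ :=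
  essSupIoi (fun t =>
    (intIoo (fun s => w s * intIoo u s t ^ (q / r)) 0 t) ^ (1 / q) *
      dualTail p v t ^ (1 / p.conjExponent)) 0

noncomputable def E₂ (p q r : ℝ) (u v w : ℝ → ℝ≥0∞) : ℝ≥0∞ :=
  (intIoi (fun t =>
    intIoo w 0 t ^ (q / (p - q)) * w t *
      (essSupIoi (fun x =>
        intIoo u t x ^ (1 / r) * dualTail p v x ^ (1 / p.conjExponent)) t) ^ (p * q / (p - q))) 0)
    ^ ((p - q) / (p * q))

noncomputable def E₃ (p q r : ℝ) (u v w : ℝ → ℝ≥0∞) : ℝ≥0∞ :=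
  (intIoi (fun t =>
    (intIoo (fun s => w s * intIoo u s t ^ (q / r)) 0 t) ^ (q / (p - q)) * w t *
      essSupIoi (fun x =>
        intIoo u t x ^ (q / r) * dualTail p v x ^ ((p - 1) * q / (p - q))) t) 0)
    ^ ((p - q) / (p * q))

noncomputable def E₄ (p q r : ℝ) (u v w : ℝ → ℝ≥0∞) : ℝ≥0∞ :=
  essSupIoi (fun t =>
    intIoo w 0 t ^ (1 / q) *
      (intIoi (fun x =>
        intIoo u t x ^ (r / (p - r)) * u x * dualTail p v x ^ ((p - 1) * r / (p - r))) t)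
        ^ ((p - r) / (p * r))) 0

noncomputable def E₅ (p q r : ℝ) (u v w : ℝ → ℝ≥0∞) : ℝ≥0∞ :=
  (intIoi (fun t =>
    intIoo w 0 t ^ (q / (p - q)) * w t *
      (intIoi (fun x =>
        intIoo u t x ^ (r / (p - r)) * u x * dualTail p v x ^ ((p - 1) * r / (p - r))) t)
        ^ (q * (p - r) / (r * (p - q)))) 0)
    ^ ((p - q) / (p * q))

end IterCopson

/-!
The proof discretizes the iterated Copson inequality with respect to the increasing function
`W(t) = ∫_0^t w` and reduces it to Hardy inequalities.

Write `V(t) = ∫_t^∞ v^{1-p'}`, `H(t) = ∫_t^∞ h`, `G(x) = ∫_x^∞ H^r u` and `N = ∫_0^∞ h^p v`. The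
inner inequality `G(t)^{1/r} ≤ C (∫_t^∞ h^p v)^{1/p}` is a weighted Hardy inequality. Its best
constant on `(t,∞)` is comparable to an explicit decreasing function `S(t)`, which is `supConst`
for `p ≤ r` and `intConst` for `r < p` (`isHardyConst_supConst`, `exists_isHardyConst_intConst`).
The argument uses only this comparability, recorded in `IsHardyConst`; thus the four cases of the
theorem reduce to the two cases `p ≤ q` and `q < p`.

*Sufficiency.* Choose points `x k` decreasing to `0` along which `W` decays geometrically
(`IsGeometric`). A sum of partial sums against a geometric weight is comparable to the plain sum
(`tsum_mul_partialSum_rpow_le`), so the left-hand side is bounded by `∑ W(x_k) G_k^{q/r}` with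
`G_k = ∫_{x_{k+1}}^{x_k} H^r u`. Splitting `H(t)` into `∫_t^{x_k} h + H(x_k)` (`lhsInt_le_add`)
leaves a local part, which the constants `S(x_{k+1})` and Hölder's inequality for sums handle, and
a Hardy inequality for `H` and the atomic measure with masses
`W(x_k) (∫_{x_{k+1}}^{x_k} u)^{q/r}` at `x_k` (`blockMass`). Hardy's inequality for arbitrary
measures, `hardy_of_le` and `hardy_of_lt`, applies to the latter, and its characterizing quantity is
bounded by the integral quantities of the theorem (`atomic_blockMass_Iic_le`, `hardyInt_atomic_le`).

*Necessity.* The bounds on the essential suprema (`E₁`, and `weightSup` for `E₄`) come from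
functions supported on `(t,∞)`. For `q < p`, an `ℓ^p`-sum of near-extremal functions of the inner
inequality at the points `x k`, weighted by the numbers to be estimated, bounds
`∑ W(x_k)^{p/(p-q)} S(x_k)^{pq/(p-q)}` (`IterBound.tsum_weight_le`), hence `E₂` and `E₅`. For `E₃`
the near-extremal function `testFun` of Hardy's inequality for the atomic measure is inserted twice:
once to bound the characterizing quantity of that measure, and once to bound
`∑ W(x_k) B_k^{q/(p-q)} Ψ(x_k)`, where `B_k` is the mass of `(0,x_k]` and `Ψ` (`supPsi`) is the
essential supremum in `E₃` (`exists_tsum_supPsi_le`); the masses `B_k` dominate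
`∫_0^{x_k} w(s) (∫_s^{x_k} u)^{q/r} ds` by the same fact on partial sums (`accum_le_atomic`).

In both directions `w` is first replaced by the bounded weights `cap w n`, and in the first one `h`
by the functions `trunc h n`, which makes every quantity that has to be absorbed or discretized
finite. Monotone convergence removes the truncations.
-/

namespace IterCopson

/-! ### Elementary inequalities in `ℝ≥0∞` -/

lemma add_rpow_le {θ : ℝ} (hθ : 0 ≤ θ) (a b : ℝ≥0∞) :
    (a + b) ^ θ ≤ 2 ^ θ * (a ^ θ + b ^ θ) := by
  have h : a + b ≤ 2 * max a b := by
    rw [two_mul]; exact add_le_add (le_max_left _ _) (le_max_right _ _)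
  calc (a + b) ^ θ ≤ (2 * max a b) ^ θ := ENNReal.rpow_le_rpow h hθ
    _ = 2 ^ θ * (max a b) ^ θ := ENNReal.mul_rpow_of_nonneg _ _ hθ
    _ ≤ 2 ^ θ * (a ^ θ + b ^ θ) := by
        gcongr
        rcases le_total a b with hab | hab
        · rw [max_eq_right hab]; exact le_add_self
        · rw [max_eq_left hab]; exact le_self_add

/-- A finite quantity that is bounded by a constant times a lower power of itself is bounded. -/
lemma rpow_le_of_le_mul_rpow {X C : ℝ≥0∞} {a : ℝ} (hX : X ≠ ∞) (ha : a < 1)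
    (h : X ≤ C * X ^ a) : X ^ (1 - a) ≤ C := by
  rcases eq_or_ne X 0 with h0 | h0
  · rw [h0, ENNReal.zero_rpow_of_pos (by linarith)]; exact zero_le
  · rw [ENNReal.rpow_sub _ _ h0 hX, ENNReal.rpow_one]
    refine ENNReal.div_le_of_le_mul h

/-- Summation against a geometrically decreasing sequence `ρ`: partial sums may be replaced by
their last summand. -/
lemma sum_mul_partialSum_rpow_le {θ : ℝ} (hθ : 0 ≤ θ) (ρ g : ℕ → ℝ≥0∞)
    (hρ : ∀ k, 2 ^ (θ + 1) * ρ (k + 1) ≤ ρ k) (n : ℕ) :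
    (∑ k ∈ Finset.range (n + 1), ρ k * (∑ j ∈ Finset.range (k + 1), g j) ^ θ) +
        ρ n * (∑ j ∈ Finset.range (n + 1), g j) ^ θ ≤
      2 ^ (θ + 1) * ∑ k ∈ Finset.range (n + 1), ρ k * g k ^ θ := by
  have h2 : (2 : ℝ≥0∞) ^ (θ + 1) = 2 * 2 ^ θ := by
    rw [ENNReal.rpow_add_of_nonneg _ _ hθ zero_le_one, ENNReal.rpow_one, mul_comm]
  have h1 : (1 : ℝ≥0∞) ≤ 2 ^ θ := by
    simpa using ENNReal.rpow_le_rpow (show (1 : ℝ≥0∞) ≤ 2 by norm_num) hθ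
  induction n with
  | zero =>
    simp only [zero_add, Finset.range_one, Finset.sum_singleton, h2, ← two_mul]
    rw [mul_assoc]
    exact mul_le_mul_right (le_mul_of_one_le_left zero_le h1) _
  | succ n ih =>
    rw [Finset.sum_range_succ, Finset.sum_range_succ (fun k => ρ k * g k ^ θ) (n + 1), mul_add]
    set S := ∑ j ∈ Finset.range (n + 1), g j with hS
    have hstep : ρ (n + 1) * (S + g (n + 1)) ^ θ + ρ (n + 1) * (S + g (n + 1)) ^ θ ≤
        ρ n * S ^ θ + 2 ^ (θ + 1) * (ρ (n + 1) * g (n + 1) ^ θ) := by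
      calc _ = 2 * ρ (n + 1) * (S + g (n + 1)) ^ θ := by ring
        _ ≤ 2 * ρ (n + 1) * (2 ^ θ * (S ^ θ + g (n + 1) ^ θ)) := by
            gcongr; exact add_rpow_le hθ _ _
        _ = (2 ^ (θ + 1) * ρ (n + 1)) * S ^ θ + 2 ^ (θ + 1) * (ρ (n + 1) * g (n + 1) ^ θ) := by
            rw [h2]; ring
        _ ≤ _ := by gcongr; exact hρ n
    have e : ∑ j ∈ Finset.range (n + 1 + 1), g j = S + g (n + 1) := by
      rw [hS, Finset.sum_range_succ]
    rw [e]
    calc _ = ∑ k ∈ Finset.range (n + 1), ρ k * (∑ j ∈ Finset.range (k + 1), g j) ^ θ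
          + (ρ (n + 1) * (S + g (n + 1)) ^ θ + ρ (n + 1) * (S + g (n + 1)) ^ θ) := by ring
      _ ≤ ∑ k ∈ Finset.range (n + 1), ρ k * (∑ j ∈ Finset.range (k + 1), g j) ^ θ
          + (ρ n * S ^ θ + 2 ^ (θ + 1) * (ρ (n + 1) * g (n + 1) ^ θ)) := by gcongr
      _ = (∑ k ∈ Finset.range (n + 1), ρ k * (∑ j ∈ Finset.range (k + 1), g j) ^ θ
          + ρ n * S ^ θ) + 2 ^ (θ + 1) * (ρ (n + 1) * g (n + 1) ^ θ) := by ring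
      _ ≤ _ := by gcongr

lemma tsum_mul_partialSum_rpow_le {θ : ℝ} (hθ : 0 ≤ θ) (ρ g : ℕ → ℝ≥0∞)
    (hρ : ∀ k, 2 ^ (θ + 1) * ρ (k + 1) ≤ ρ k) :
    ∑' k, ρ k * (∑ j ∈ Finset.range (k + 1), g j) ^ θ ≤
      2 ^ (θ + 1) * ∑' k, ρ k * g k ^ θ := by
  rw [ENNReal.tsum_eq_iSup_nat]
  refine iSup_le fun n => ?_
  calc _ ≤ ∑ k ∈ Finset.range (n + 1), ρ k * (∑ j ∈ Finset.range (k + 1), g j) ^ θ :=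
        Finset.sum_le_sum_of_subset (Finset.range_mono (Nat.le_succ n))
    _ ≤ _ := le_trans le_self_add (sum_mul_partialSum_rpow_le hθ ρ g hρ n)
    _ ≤ _ := by gcongr; exact ENNReal.sum_le_tsum _

lemma tsum_rpow_le {ι : Type*} {s : ℝ} (hs : 1 ≤ s) (a : ι → ℝ≥0∞) :
    ∑' k, a k ^ s ≤ (∑' k, a k) ^ s := by
  have e : ∀ x : ℝ≥0∞, x ^ s = x * x ^ (s - 1) := fun x => by
    conv_lhs => rw [show s = 1 + (s - 1) by ring]
    rw [ENNReal.rpow_add_of_nonneg _ _ zero_le_one (by linarith), ENNReal.rpow_one]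
  calc ∑' k, a k ^ s = ∑' k, a k * a k ^ (s - 1) := by simp_rw [e]
    _ ≤ ∑' k, a k * (∑' j, a j) ^ (s - 1) := by
        refine ENNReal.tsum_le_tsum fun k => ?_
        exact mul_le_mul_right (ENNReal.rpow_le_rpow (ENNReal.le_tsum k) (by linarith)) _
    _ = _ := by rw [ENNReal.tsum_mul_right, ← e]

/-- Hölder's inequality for series, with exponents `p / (p - q)` and `p / q`. -/
lemma tsum_mul_rpow_le {ι : Type*} [Countable ι] {p q : ℝ} (hq : 0 < q) (hqp : q < p)
    (b a : ι → ℝ≥0∞) :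
    ∑' k, b k * a k ^ (q / p) ≤
      (∑' k, b k ^ (p / (p - q))) ^ ((p - q) / p) * (∑' k, a k) ^ (q / p) := by
  have hp : 0 < p := hq.trans hqp
  have hpq : 0 < p - q := sub_pos.2 hqp
  let _ : MeasurableSpace ι := ⊤
  have hc : (p / (p - q)).HolderConjugate (p / q) := by
    rw [Real.holderConjugate_iff]
    constructor
    · rw [lt_div_iff₀ hpq]; linarith
    · field_simp; ring
  have := ENNReal.lintegral_mul_le_Lp_mul_Lq (Measure.count : Measure ι) hc
    (f := b) (g := fun k => a k ^ (q / p)) (measurable_from_top).aemeasurable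
    (measurable_from_top).aemeasurable
  simp only [Pi.mul_apply, lintegral_count, ← ENNReal.rpow_mul] at this
  convert this using 3
  · field_simp
  · simp only [show q / p * (p / q) = 1 by field_simp, ENNReal.rpow_one]
  · field_simp

/-! ### Integrals of powers of a distribution function -/

lemma measure_setOf_measure_Iic_le (ρ : Measure ℝ) {c : ℝ≥0∞} :
    ρ {t | ρ (Iic t) ≤ c} ≤ c := by
  set L := {t | ρ (Iic t) ≤ c} with hL
  have hdown : ∀ {s t}, s ≤ t → t ∈ L → s ∈ L := fun hst ht =>
    (measure_mono (Iic_subset_Iic.2 hst)).trans ht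
  rcases L.eq_empty_or_nonempty with h0 | hne
  · rw [h0]; simp
  obtain ⟨u, hu_mono, hu_mem, hu_cof⟩ : ∃ u : ℕ → ℝ, Monotone u ∧ (∀ n, u n ∈ L) ∧
      ∀ t ∈ L, ∃ n, t ≤ u n := by
    by_cases hb : BddAbove L
    · by_cases hm : sSup L ∈ L
      · exact ⟨fun _ => sSup L, monotone_const, fun _ => hm, fun t ht => ⟨0, le_csSup hb ht⟩⟩
      · obtain ⟨u, h1, h2, h3⟩ := exists_seq_tendsto_sSup hne hb
        refine ⟨u, h1, h3, fun t ht => ?_⟩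
        have : t < sSup L := lt_of_le_of_ne (le_csSup hb ht) (fun e => hm (e ▸ ht))
        obtain ⟨n, hn⟩ := (h2.eventually (lt_mem_nhds this)).exists
        exact ⟨n, hn.le⟩
    · refine ⟨fun n => n, Nat.mono_cast, fun n => ?_, fun t _ => exists_nat_ge t⟩
      rw [not_bddAbove_iff] at hb
      obtain ⟨y, hy, hny⟩ := hb n
      exact hdown hny.le hy
  have : L ⊆ ⋃ n, Iic (u n) := fun t ht => mem_iUnion.2 (hu_cof t ht)
  calc ρ L ≤ ρ (⋃ n, Iic (u n)) := measure_mono this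
    _ = ⨆ n, ρ (Iic (u n)) :=
        Monotone.measure_iUnion (fun m n hmn => Iic_subset_Iic.2 (hu_mono hmn))
    _ ≤ c := iSup_le hu_mem

lemma measurable_measure_Iic (ρ : Measure ℝ) : Measurable fun t => ρ (Iic t) :=
  Monotone.measurable fun _ _ h => measure_mono (Iic_subset_Iic.2 h)

lemma measurable_measure_Iio (ρ : Measure ℝ) : Measurable fun t => ρ (Iio t) :=
  Monotone.measurable fun _ _ h => measure_mono (Iio_subset_Iio h)

/-- The integral of a power of the distribution function of an arbitrary measure, bounded from
below by splitting at a median. -/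
lemma measure_univ_rpow_le (ρ : Measure ℝ) {s : ℝ} (hs : 0 ≤ s) :
    ρ univ ^ (s + 1) ≤ 2 ^ (s + 1) * ∫⁻ t, ρ (Iic t) ^ s ∂ρ := by
  have key : ∀ c : ℝ≥0∞, c ≠ ∞ → c ^ s * (ρ univ - c) ≤ ∫⁻ t, ρ (Iic t) ^ s ∂ρ := by
    intro c hc
    have hm : MeasurableSet {t | ρ (Iic t) ≤ c} := measurable_measure_Iic ρ measurableSet_Iic
    have hL := measure_setOf_measure_Iic_le ρ (c := c)
    calc c ^ s * (ρ univ - c) ≤ c ^ s * ρ {t | ρ (Iic t) ≤ c}ᶜ := by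
          gcongr
          rw [measure_compl hm (ne_top_of_le_ne_top hc hL)]
          exact tsub_le_tsub_left hL _
      _ = ∫⁻ t in {t | ρ (Iic t) ≤ c}ᶜ, c ^ s ∂ρ := by simp
      _ ≤ ∫⁻ t in {t | ρ (Iic t) ≤ c}ᶜ, ρ (Iic t) ^ s ∂ρ := by
          refine setLIntegral_mono' hm.compl fun t ht => ?_
          have : c < ρ (Iic t) := not_le.1 ht
          gcongr
      _ ≤ _ := setLIntegral_le_lintegral _ _
  by_cases h : ρ univ = ∞
  · have := key 1 ENNReal.one_ne_top
    rw [h] at this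
    rw [ENNReal.one_rpow, one_mul, ENNReal.top_sub ENNReal.one_ne_top, top_le_iff] at this
    rw [this, ENNReal.mul_top]
    · exact le_top
    · simp
  · have := key (ρ univ / 2) (ENNReal.div_ne_top h (by norm_num))
    rw [ENNReal.sub_half h] at this
    have e : (ρ univ / 2) ^ s * (ρ univ / 2) = (ρ univ / 2) ^ (s + 1) := by
      rw [ENNReal.rpow_add_of_nonneg _ _ hs zero_le_one, ENNReal.rpow_one]
    calc ρ univ ^ (s + 1) = 2 ^ (s + 1) * (ρ univ / 2) ^ (s + 1) := by
          rw [← ENNReal.mul_rpow_of_nonneg _ _ (by linarith),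
            ENNReal.mul_div_cancel (by norm_num) (by norm_num)]
      _ ≤ _ := by rw [← e]; gcongr

lemma measure_rpow_le_setLIntegral (ρ : Measure ℝ) {s : ℝ} (hs : 0 ≤ s) (J : Set ℝ) :
    ρ J ^ (s + 1) ≤ 2 ^ (s + 1) * ∫⁻ t in J, ρ (Iic t) ^ s ∂ρ := by
  have := measure_univ_rpow_le (ρ.restrict J) hs
  rw [Measure.restrict_apply_univ] at this
  refine this.trans ?_
  gcongr
  exact Measure.restrict_le_self

/-! ### Continuity of distribution functions of measures without atoms -/

lemma continuous_measure_Ioi (μ : Measure ℝ) [NullSingletonClass μ] (h : μ univ ≠ ∞) :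
    Continuous fun t => μ (Ioi t) := by
  rw [continuous_iff_continuousAt]
  intro t₀
  have e : ∀ t, μ (Ioi t) = ∫⁻ y, (Ioi t).indicator 1 y ∂μ := fun t => by
    rw [lintegral_indicator_one measurableSet_Ioi]
  unfold ContinuousAt
  simp_rw [e]
  refine tendsto_lintegral_filter_of_dominated_convergence 1
    (.of_forall fun t => measurable_one.indicator measurableSet_Ioi)
    (.of_forall fun t => .of_forall fun y => indicator_le_self _ _ _) (by simpa using h) ?_
  have : ∀ᵐ y ∂μ, y ≠ t₀ := by simp [ae_iff]
  filter_upwards [this] with y hy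
  refine tendsto_const_nhds.congr' ?_
  rcases lt_or_gt_of_ne hy with hy | hy
  · filter_upwards [lt_mem_nhds hy] with t ht
    simp [indicator, ht.not_gt, hy.not_gt]
  · filter_upwards [gt_mem_nhds hy] with t ht
    simp [indicator, ht, hy]

lemma continuous_measure_Iio (μ : Measure ℝ) [NullSingletonClass μ] (h : μ univ ≠ ∞) :
    Continuous fun t => μ (Iio t) := by
  rw [continuous_iff_continuousAt]
  intro t₀
  have e : ∀ t, μ (Iio t) = ∫⁻ y, (Iio t).indicator 1 y ∂μ := fun t => by
    rw [lintegral_indicator_one measurableSet_Iio]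
  unfold ContinuousAt
  simp_rw [e]
  refine tendsto_lintegral_filter_of_dominated_convergence 1
    (.of_forall fun t => measurable_one.indicator measurableSet_Iio)
    (.of_forall fun t => .of_forall fun y => indicator_le_self _ _ _) (by simpa using h) ?_
  have : ∀ᵐ y ∂μ, y ≠ t₀ := by simp [ae_iff]
  filter_upwards [this] with y hy
  refine tendsto_const_nhds.congr' ?_
  rcases lt_or_gt_of_ne hy with hy | hy
  · filter_upwards [lt_mem_nhds hy] with t ht
    simp [indicator, ht, hy]
  · filter_upwards [gt_mem_nhds hy] with t ht
    simp [indicator, ht.not_gt, hy.not_gt]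

lemma exists_measure_Ioi_lt (μ : Measure ℝ) (h : μ univ ≠ ∞) {c : ℝ≥0∞} (hc : 0 < c) :
    ∃ a, μ (Ioi a) < c := by
  have hlim := tendsto_measure_iInter_atTop (μ := μ) (s := fun n : ℕ => Ioi (n : ℝ))
    (fun n => measurableSet_Ioi.nullMeasurableSet)
    (fun m n hmn => Ioi_subset_Ioi (Nat.cast_le.2 hmn))
    ⟨0, ne_top_of_le_ne_top h (measure_mono (subset_univ _))⟩
  have hempty : ⋂ n : ℕ, Ioi (n : ℝ) = ∅ := by
    ext y
    simp only [mem_iInter, mem_Ioi, mem_empty_iff_false, iff_false, not_forall, not_lt]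
    exact exists_nat_ge y
  rw [hempty, measure_empty] at hlim
  obtain ⟨n, hn⟩ := (hlim.eventually (gt_mem_nhds hc)).exists
  exact ⟨n, hn⟩

/-! ### Hardy's inequality for the Copson operator and an arbitrary measure: sufficiency -/

lemma intIoi_anti (f : ℝ → ℝ≥0∞) : Antitone (intIoi f) := fun _ _ h =>
  lintegral_mono_set (Ioi_subset_Ioi h)

lemma measurable_intIoi (f : ℝ → ℝ≥0∞) : Measurable (intIoi f) := (intIoi_anti f).measurable

lemma dualTail_anti (p : ℝ) (v : ℝ → ℝ≥0∞) : Antitone (dualTail p v) := intIoi_anti _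

lemma measurable_dualTail (p : ℝ) (v : ℝ → ℝ≥0∞) : Measurable (dualTail p v) :=
  measurable_intIoi _

lemma conjExponent_pos {p : ℝ} (hp : 1 < p) : 0 < p.conjExponent :=
  div_pos (by linarith) (by linarith)

/-- Hölder's inequality in the form that bounds `∫ h` by the weighted norm of `h`. -/
lemma setLIntegral_le_rpow_mul_rpow {p : ℝ} (hp : 1 < p) {v h : ℝ → ℝ≥0∞} (hv : Measurable v)
    (hv0 : ∀ x, 0 < v x) (hh : Measurable h) {S : Set ℝ}
    (hfin : ∫⁻ x in S, h x ^ p * v x ≠ ∞) :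
    ∫⁻ x in S, h x ≤ (∫⁻ x in S, h x ^ p * v x) ^ (1 / p) *
      (∫⁻ x in S, v x ^ (1 - p.conjExponent)) ^ (1 / p.conjExponent) := by
  have hp0 : 0 < p := by linarith
  have hp1 : p - 1 ≠ 0 := by linarith
  have hae := ae_lt_top (by fun_prop) hfin
  have := ENNReal.lintegral_mul_le_Lp_mul_Lq (volume.restrict S)
    (Real.HolderConjugate.conjExponent hp)
    (f := fun x => h x * v x ^ (1 / p)) (g := fun x => v x ^ (-(1 / p))) (by fun_prop)
    (by fun_prop)
  have e1 : ∀ x, (h x * v x ^ (1 / p)) ^ p = h x ^ p * v x := fun x => by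
    rw [ENNReal.mul_rpow_of_nonneg _ _ hp0.le, ← ENNReal.rpow_mul,
      one_div_mul_cancel hp0.ne', ENNReal.rpow_one]
  have e2 : ∀ x, (v x ^ (-(1 / p))) ^ p.conjExponent = v x ^ (1 - p.conjExponent) := fun x => by
    rw [← ENNReal.rpow_mul]
    congr 1
    rw [Real.conjExponent]
    field_simp
    ring
  simp only [e1, e2] at this
  refine le_trans (lintegral_mono_ae ?_) this
  filter_upwards [hae] with x hx
  simp only [Pi.mul_apply]
  by_cases hvt : v x = ∞
  · have : h x = 0 := by
      by_contra h0
      rw [hvt, ENNReal.mul_top] at hx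
      · exact lt_irrefl _ hx
      · simp [h0, hp0.le]
    rw [this]; exact zero_le
  · rw [mul_assoc, ← ENNReal.rpow_add _ _ (hv0 x).ne' hvt]
    simp

/-- The part of `(0,∞)` where the tail integral of `h` lies between `2 ^ n` and `2 ^ (n + 1)`. -/
def tailLevel (h : ℝ → ℝ≥0∞) (n : ℤ) : Set ℝ :=
  {t | 0 < t ∧ intIoi h t ∈ Ioc ((2 : ℝ≥0∞) ^ n) (2 ^ (n + 1))}

lemma measurableSet_tailLevel (h : ℝ → ℝ≥0∞) (n : ℤ) : MeasurableSet (tailLevel h n) :=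
  measurableSet_Ioi.inter (measurable_intIoi h measurableSet_Ioc)

lemma pairwise_disjoint_tailLevel (h : ℝ → ℝ≥0∞) :
    Pairwise (Function.onFun Disjoint (tailLevel h)) := by
  intro m n hmn
  rw [Function.onFun, Set.disjoint_left]
  rintro t ⟨-, h1, h2⟩ ⟨-, h3, h4⟩
  have h12 : (1 : ℝ≥0∞) ≤ 2 := by norm_num
  rcases lt_or_gt_of_ne hmn with h | h
  · exact absurd (h3.trans_le h2) (not_lt.2 (ENNReal.zpow_le_of_le h12 (by omega)))
  · exact absurd (h1.trans_le h4) (not_lt.2 (ENNReal.zpow_le_of_le h12 (by omega)))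

lemma tailLevel_sub_one_subset_Ioi {h : ℝ → ℝ≥0∞} {n : ℤ} {t : ℝ} (ht : t ∈ tailLevel h n) :
    tailLevel h (n - 1) ⊆ Ioi t := by
  rintro y ⟨-, -, hy⟩
  rw [sub_add_cancel] at hy
  by_contra hyt
  exact absurd (ht.2.1.trans_le (intIoi_anti h (not_lt.1 hyt))) (not_lt.2 hy)

/-- If the tail integral of `h` reaches level `n`, then the level below carries a fixed
proportion of its size. -/
lemma zpow_le_setLIntegral_tailLevel {h : ℝ → ℝ≥0∞} (hfin : intIoi h 0 ≠ ∞)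
    {n : ℤ} (hne : (tailLevel h n).Nonempty) :
    (2 : ℝ≥0∞) ^ (n + 1) ≤ 8 * ∫⁻ x in tailLevel h (n - 1), h x := by
  obtain ⟨t, ht0, ht, -⟩ := hne
  set η : Measure ℝ := (volume.restrict (Ioi 0)).withDensity h with hη
  have hηS : ∀ S : Set ℝ, MeasurableSet S → S ⊆ Ioi 0 → η S = ∫⁻ x in S, h x := by
    intro S hS hS0
    rw [hη, withDensity_apply _ hS, Measure.restrict_restrict hS, inter_eq_left.2 hS0]
  have hηfin : η univ ≠ ∞ := by
    rw [hη, withDensity_apply _ MeasurableSet.univ, Measure.restrict_univ]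
    exact hfin
  have : IsFiniteMeasure η := ⟨lt_top_iff_ne_top.2 hηfin⟩
  have hcont := continuous_measure_Ioi η hηfin
  have hH : ∀ y, 0 ≤ y → η (Ioi y) = intIoi h y := fun y hy =>
    hηS _ measurableSet_Ioi (Ioi_subset_Ioi hy)
  set X : ℝ≥0∞ := 2 ^ n with hX
  have hX0 : X ≠ 0 := (ENNReal.zpow_pos (by norm_num) (by norm_num) n).ne'
  have hXt : X ≠ ∞ := ENNReal.zpow_ne_top (by norm_num) (by norm_num) n
  have hX1 : (2 : ℝ≥0∞) ^ (n + 1) = 2 * X := by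
    rw [ENNReal.zpow_add (by norm_num) (by norm_num), zpow_one, mul_comm]
  have hX2 : (2 : ℝ≥0∞) ^ (n - 1) = X / 2 := by
    rw [sub_eq_add_neg, ENNReal.zpow_add (by norm_num) (by norm_num), zpow_neg_one,
      ENNReal.div_eq_inv_mul, mul_comm]
  have h4 : X / 4 ≠ 0 := by simp [hX0]
  have h4t : X / 4 ≠ ∞ := ENNReal.div_ne_top hXt (by norm_num)
  have h2t : X / 2 ≠ ∞ := ENNReal.div_ne_top hXt (by norm_num)
  have hsum : X / 2 + X / 4 + X / 4 = X := by
    have : X / 4 + X / 4 = X / 2 := by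
      rw [← two_mul, ← mul_div_assoc]
      rw [show (4 : ℝ≥0∞) = 2 * 2 by norm_num, ENNReal.mul_div_mul_left] <;> norm_num
    rw [add_assoc, this, ENNReal.add_halves]
  have hrange : ∀ c, 0 < c → c ≤ X → ∃ y, η (Ioi y) = c := by
    intro c hc0 hc
    refine mem_range_of_exists_le_of_exists_ge hcont ?_ ⟨t, ?_⟩
    · obtain ⟨a, ha⟩ := exists_measure_Ioi_lt η hηfin hc0
      exact ⟨a, ha.le⟩
    · rw [hH t ht0.le]; exact hc.trans ht.le
  obtain ⟨y₁, h1⟩ := hrange X (pos_iff_ne_zero.2 hX0) le_rfl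
  obtain ⟨y₂, h2⟩ := hrange (X / 2 + X / 4) (by simp [hX0]) (le_self_add.trans hsum.le)
  have hlt : X / 2 + X / 4 < X := by
    conv_rhs => rw [← hsum]
    exact ENNReal.lt_add_right (by simp [h2t, h4t]) h4
  have hy12 : y₁ < y₂ := by
    by_contra hcon
    have := measure_mono (μ := η) (Ioi_subset_Ioi (not_lt.1 hcon))
    rw [h1, h2] at this
    exact absurd hlt (not_lt.2 this)
  have hty : t < y₁ := by
    by_contra hcon
    have := measure_mono (μ := η) (Ioi_subset_Ioi (not_lt.1 hcon))
    rw [h1, hH t ht0.le] at this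
    exact absurd ht (not_lt.2 this)
  have hy0 : 0 < y₁ := ht0.trans hty
  have hIoc : η (Ioc y₁ y₂) = X / 4 := by
    have : η (Ioi y₁) = η (Ioc y₁ y₂) + η (Ioi y₂) := by
      rw [← measure_union (Ioc_disjoint_Ioi le_rfl) measurableSet_Ioi,
        Ioc_union_Ioi_eq_Ioi hy12.le]
    rw [h1, h2] at this
    conv_lhs at this => rw [← hsum, add_comm]
    exact ((ENNReal.add_left_inj (by simp [h2t, h4t])).1 this).symm
  have hsub : Ioc y₁ y₂ ⊆ tailLevel h (n - 1) := by
    rintro y ⟨hy1, hy2⟩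
    refine ⟨hy0.trans hy1, ?_, ?_⟩
    · rw [hX2, ← hH y (hy0.trans hy1).le]
      calc X / 2 < X / 2 + X / 4 := ENNReal.lt_add_right h2t h4
        _ = η (Ioi y₂) := h2.symm
        _ ≤ _ := measure_mono (Ioi_subset_Ioi hy2)
    · rw [sub_add_cancel, ← hX, ← h1, ← hH y (hy0.trans hy1).le]
      exact measure_mono (Ioi_subset_Ioi hy1.le)
  have h8 : 2 * X = 8 * (X / 4) := by
    rw [show (8 : ℝ≥0∞) = 2 * 4 by norm_num, mul_assoc,
      ENNReal.mul_div_cancel (by norm_num) (by norm_num)]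
  rw [hX1, h8, ← hIoc, hηS _ measurableSet_Ioc (fun y hy => hy0.trans hy.1)]
  gcongr

lemma lintegral_intIoi_rpow_le_tsum {q : ℝ} (hq : 0 < q) {h : ℝ → ℝ≥0∞}
    (hfin : intIoi h 0 ≠ ∞) (μ : Measure ℝ) :
    ∫⁻ t in Ioi 0, intIoi h t ^ q ∂μ ≤
      8 ^ q * ∑' n : ℤ, μ (tailLevel h n) * (∫⁻ x in tailLevel h (n - 1), h x) ^ q := by
  have h1 : ∫⁻ t in Ioi 0, intIoi h t ^ q ∂μ ≤
      ∫⁻ t in ⋃ n, tailLevel h n, intIoi h t ^ q ∂μ := by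
    rw [← lintegral_indicator measurableSet_Ioi,
      ← lintegral_indicator (.iUnion (measurableSet_tailLevel h))]
    refine lintegral_mono fun t => ?_
    by_cases ht : t ∈ Ioi 0
    · rw [indicator_of_mem ht]
      by_cases h0 : intIoi h t = 0
      · rw [h0, ENNReal.zero_rpow_of_pos hq]; exact zero_le
      · obtain ⟨n, hn⟩ := ENNReal.exists_mem_Ioc_zpow (y := 2) h0
          (ne_top_of_le_ne_top hfin (intIoi_anti h (le_of_lt ht))) (by norm_num) (by norm_num)
        have hmem : t ∈ ⋃ n, tailLevel h n := mem_iUnion.2 ⟨n, ht, hn⟩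
        rw [indicator_of_mem hmem]
    · rw [indicator_of_notMem ht]; exact zero_le
  refine h1.trans ((lintegral_iUnion_le _ _).trans ?_)
  rw [← ENNReal.tsum_mul_left]
  refine ENNReal.tsum_le_tsum fun n => ?_
  by_cases hne : (tailLevel h n).Nonempty
  · have h8 := zpow_le_setLIntegral_tailLevel hfin hne
    calc ∫⁻ t in tailLevel h n, intIoi h t ^ q ∂μ
        ≤ ∫⁻ t in tailLevel h n, (8 * ∫⁻ x in tailLevel h (n - 1), h x) ^ q ∂μ := by
          refine setLIntegral_mono' (measurableSet_tailLevel h n) fun t ht => ?_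
          exact ENNReal.rpow_le_rpow (ht.2.2.trans h8) hq.le
      _ = _ := by
          rw [lintegral_const, Measure.restrict_apply_univ, ENNReal.mul_rpow_of_nonneg _ _ hq.le]
          ring
  · rw [not_nonempty_iff_eq_empty.1 hne]; simp

/-- The level sums of the weighted norm. -/
lemma tsum_setLIntegral_tailLevel_le (h f : ℝ → ℝ≥0∞) :
    ∑' n : ℤ, ∫⁻ x in tailLevel h (n - 1), f x ≤ intIoi f 0 := by
  have e := (Equiv.subRight (1 : ℤ)).tsum_eq (fun n => ∫⁻ x in tailLevel h n, f x)
  simp only [Equiv.subRight_apply] at e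
  rw [e, ← lintegral_iUnion (measurableSet_tailLevel h) (pairwise_disjoint_tailLevel h)]
  exact lintegral_mono_set (iUnion_subset fun n t ht => ht.1)

lemma setLIntegral_rpow_le {p q : ℝ} (hp : 1 < p) (hq : 0 < q) {v h : ℝ → ℝ≥0∞}
    (hv : Measurable v) (hv0 : ∀ x, 0 < v x) (hh : Measurable h) {S : Set ℝ}
    (hfin : ∫⁻ x in S, h x ^ p * v x ≠ ∞) :
    (∫⁻ x in S, h x) ^ q ≤ (∫⁻ x in S, v x ^ (1 - p.conjExponent)) ^ (q / p.conjExponent) *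
      (∫⁻ x in S, h x ^ p * v x) ^ (q / p) := by
  refine (ENNReal.rpow_le_rpow (setLIntegral_le_rpow_mul_rpow hp hv hv0 hh hfin) hq.le).trans ?_
  rw [ENNReal.mul_rpow_of_nonneg _ _ hq.le, ← ENNReal.rpow_mul, ← ENNReal.rpow_mul, mul_comm,
    one_div_mul_eq_div, one_div_mul_eq_div]

/-- Hardy's inequality for `p ≤ q`: the condition is a supremum. -/
lemma hardy_of_le {p q : ℝ} (hp : 1 < p) (hpq : p ≤ q) {v h : ℝ → ℝ≥0∞}
    (hv : Measurable v) (hv0 : ∀ x, 0 < v x) (hh : Measurable h) (hfin : intIoi h 0 ≠ ∞)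
    (hN : intIoi (fun x => h x ^ p * v x) 0 ≠ ∞) (μ : Measure ℝ) {E : ℝ≥0∞}
    (hE : ∀ x, 0 < x → μ (Iic x) * dualTail p v x ^ (q / p.conjExponent) ≤ E) :
    ∫⁻ t in Ioi 0, intIoi h t ^ q ∂μ ≤
      8 ^ q * (E * intIoi (fun x => h x ^ p * v x) 0 ^ (q / p)) := by
  have hp0 : 0 < p := by linarith
  have hq : 0 < q := by linarith
  have hp' := conjExponent_pos hp
  refine (lintegral_intIoi_rpow_le_tsum hq hfin μ).trans ?_
  gcongr
  set a : ℤ → ℝ≥0∞ := fun n => ∫⁻ x in tailLevel h (n - 1), h x ^ p * v x with ha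
  have hterm : ∀ n : ℤ, μ (tailLevel h n) * (∫⁻ x in tailLevel h (n - 1), h x) ^ q ≤
      E * a n ^ (q / p) := by
    intro n
    have hafin : a n ≠ ∞ := ne_top_of_le_ne_top hN (lintegral_mono_set fun t ht => ht.1)
    set κ := (∫⁻ x in tailLevel h (n - 1), v x ^ (1 - p.conjExponent)) ^ (q / p.conjExponent)
      with hκ
    have hκE : μ (tailLevel h n) * κ ≤ E := by
      rcases eq_or_ne E ∞ with hEt | hEt
      · rw [hEt]; exact le_top
      rcases eq_or_ne κ 0 with hk0 | hk0
      · rw [hk0, mul_zero]; exact zero_le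
      have hsub : tailLevel h n ⊆ {t | μ.restrict (tailLevel h n) (Iic t) ≤ E / κ} := by
        intro t ht
        rw [mem_ofPred_eq, ENNReal.le_div_iff_mul_le (.inl hk0) (.inr hEt)]
        refine le_trans ?_ (hE t ht.1)
        refine mul_le_mul' (Measure.restrict_le_self _) (ENNReal.rpow_le_rpow ?_ (by positivity))
        exact lintegral_mono_set (tailLevel_sub_one_subset_Ioi ht)
      rw [← ENNReal.le_div_iff_mul_le (.inl hk0) (.inr hEt)]
      calc μ (tailLevel h n) = μ.restrict (tailLevel h n) (tailLevel h n) := by simp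
        _ ≤ _ := (measure_mono hsub).trans (measure_setOf_measure_Iic_le _)
    calc _ ≤ μ (tailLevel h n) * (κ * a n ^ (q / p)) := by
          gcongr; exact setLIntegral_rpow_le hp hq hv hv0 hh hafin
      _ ≤ E * a n ^ (q / p) := by rw [← mul_assoc]; gcongr
  calc _ ≤ ∑' n, E * a n ^ (q / p) := ENNReal.tsum_le_tsum hterm
    _ = E * ∑' n, a n ^ (q / p) := ENNReal.tsum_mul_left
    _ ≤ E * (∑' n, a n) ^ (q / p) := by
        gcongr; exact tsum_rpow_le ((one_le_div hp0).2 hpq) a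
    _ ≤ _ := by
        gcongr; exact tsum_setLIntegral_tailLevel_le h _

/-- Hardy's inequality for `q < p`: the condition is an integral. -/
lemma hardy_of_lt {p q : ℝ} (hp : 1 < p) (hq : 0 < q) (hqp : q < p) {v h : ℝ → ℝ≥0∞}
    (hv : Measurable v) (hv0 : ∀ x, 0 < v x) (hh : Measurable h) (hfin : intIoi h 0 ≠ ∞)
    (hN : intIoi (fun x => h x ^ p * v x) 0 ≠ ∞) (μ : Measure ℝ) :
    ∫⁻ t in Ioi 0, intIoi h t ^ q ∂μ ≤
      8 ^ q * (2 * (∫⁻ t in Ioi 0, μ (Iic t) ^ (q / (p - q)) *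
        dualTail p v t ^ ((p - 1) * q / (p - q)) ∂μ) ^ ((p - q) / p) *
          intIoi (fun x => h x ^ p * v x) 0 ^ (q / p)) := by
  have hp0 : 0 < p := by linarith
  have hpq : 0 < p - q := sub_pos.2 hqp
  have hp1 : 0 < p - 1 := by linarith
  refine (lintegral_intIoi_rpow_le_tsum hq hfin μ).trans ?_
  gcongr
  set a : ℤ → ℝ≥0∞ := fun n => ∫⁻ x in tailLevel h (n - 1), h x ^ p * v x with ha
  set κ : ℤ → ℝ≥0∞ := fun n =>
    (∫⁻ x in tailLevel h (n - 1), v x ^ (1 - p.conjExponent)) ^ (q / p.conjExponent) with hκ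
  set I : Set ℝ → ℝ≥0∞ := fun S => ∫⁻ t in S, μ (Iic t) ^ (q / (p - q)) *
        dualTail p v t ^ ((p - 1) * q / (p - q)) ∂μ with hI
  have hterm : ∀ n : ℤ, μ (tailLevel h n) * (∫⁻ x in tailLevel h (n - 1), h x) ^ q ≤
      (μ (tailLevel h n) * κ n) * a n ^ (q / p) := by
    intro n
    rw [mul_assoc]
    gcongr
    exact setLIntegral_rpow_le hp hq hv hv0 hh
      (ne_top_of_le_ne_top hN (lintegral_mono_set fun t ht => ht.1))
  have hb : ∀ n : ℤ, (μ (tailLevel h n) * κ n) ^ (p / (p - q)) ≤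
      2 ^ (p / (p - q)) * I (tailLevel h n) := by
    intro n
    have hs : q / (p - q) + 1 = p / (p - q) := by field_simp; ring
    have hsn : 0 ≤ q / (p - q) := by positivity
    rw [ENNReal.mul_rpow_of_nonneg _ _ (by positivity)]
    calc μ (tailLevel h n) ^ (p / (p - q)) * κ n ^ (p / (p - q))
        ≤ (2 ^ (p / (p - q)) * ∫⁻ t in tailLevel h n, μ (Iic t) ^ (q / (p - q)) ∂μ) *
            κ n ^ (p / (p - q)) := by
          gcongr
          rw [← hs]
          exact measure_rpow_le_setLIntegral μ hsn _
      _ = 2 ^ (p / (p - q)) * ∫⁻ t in tailLevel h n, μ (Iic t) ^ (q / (p - q)) *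
            κ n ^ (p / (p - q)) ∂μ := by
          rw [mul_assoc, lintegral_mul_const _ ((measurable_measure_Iic μ).pow_const _)]
      _ ≤ _ := by
          gcongr
          refine setLIntegral_mono' (measurableSet_tailLevel h n) fun t ht => ?_
          gcongr
          rw [hκ, ← ENNReal.rpow_mul, Real.conjExponent]
          have : q / (p / (p - 1)) * (p / (p - q)) = (p - 1) * q / (p - q) := by
            field_simp
          rw [this]
          refine ENNReal.rpow_le_rpow ?_ (by positivity)
          exact lintegral_mono_set (tailLevel_sub_one_subset_Ioi ht)
  calc _ ≤ ∑' n, (μ (tailLevel h n) * κ n) * a n ^ (q / p) := ENNReal.tsum_le_tsum hterm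
    _ ≤ _ := tsum_mul_rpow_le hq hqp _ _
    _ ≤ (2 ^ (p / (p - q)) * I (Ioi 0)) ^ ((p - q) / p) *
          intIoi (fun x => h x ^ p * v x) 0 ^ (q / p) := by
        gcongr
        · calc _ ≤ ∑' n, 2 ^ (p / (p - q)) * I (tailLevel h n) := ENNReal.tsum_le_tsum hb
            _ = 2 ^ (p / (p - q)) * ∑' n, I (tailLevel h n) := ENNReal.tsum_mul_left
            _ ≤ _ := by
                gcongr
                rw [hI, ← lintegral_iUnion (measurableSet_tailLevel h)
                  (pairwise_disjoint_tailLevel h)]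
                exact lintegral_mono_set (iUnion_subset fun n t ht => ht.1)
        · exact tsum_setLIntegral_tailLevel_le h _
    _ = _ := by
        rw [ENNReal.mul_rpow_of_nonneg _ _ (by positivity), ← ENNReal.rpow_mul,
          show p / (p - q) * ((p - q) / p) = 1 by field_simp, ENNReal.rpow_one]

/-! ### Truncation -/

/-- The function `min f n` cut off to `(-∞, n)`: a bounded function that increases to `f`. -/
noncomputable def trunc (f : ℝ → ℝ≥0∞) (n : ℕ) : ℝ → ℝ≥0∞ :=
  (Iio (n : ℝ)).indicator fun t => min (f t) n

lemma measurable_trunc {f : ℝ → ℝ≥0∞} (hf : Measurable f) (n : ℕ) : Measurable (trunc f n) :=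
  (hf.min measurable_const).indicator measurableSet_Iio

lemma trunc_le (f : ℝ → ℝ≥0∞) (n : ℕ) (t : ℝ) : trunc f n t ≤ f t :=
  indicator_apply_le' (fun _ => min_le_left _ _) (fun _ => zero_le)

lemma trunc_mono (f : ℝ → ℝ≥0∞) : Monotone (trunc f) := by
  intro m n hmn t
  have hc : (m : ℝ≥0∞) ≤ n := Nat.cast_le.2 hmn
  unfold trunc
  by_cases ht : t ∈ Iio (m : ℝ)
  · have ht' : t ∈ Iio (n : ℝ) := (mem_Iio.1 ht).trans_le (Nat.cast_le.2 hmn)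
    rw [indicator_of_mem ht, indicator_of_mem ht']
    exact min_le_min_left _ hc
  · rw [indicator_of_notMem ht]; exact zero_le

lemma iSup_trunc (f : ℝ → ℝ≥0∞) (t : ℝ) : ⨆ n, trunc f n t = f t := by
  refine le_antisymm (iSup_le fun n => trunc_le f n t) ?_
  obtain ⟨N, hN⟩ := exists_nat_gt t
  have e : f t = ⨆ n : ℕ, min (f t) n := by
    rw [← inf_iSup_eq, ENNReal.iSup_natCast, inf_top_eq]
  conv_lhs => rw [e]
  refine iSup_le fun n => ?_
  refine le_trans ?_ (le_iSup _ (max n N))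
  have : t ∈ Iio ((max n N : ℕ) : ℝ) := hN.trans_le (Nat.cast_le.2 (le_max_right _ _))
  unfold trunc
  rw [indicator_of_mem this]
  exact min_le_min_left _ (Nat.cast_le.2 (le_max_left _ _))

lemma intIoi_trunc_ne_top (f : ℝ → ℝ≥0∞) (n : ℕ) (a : ℝ) : intIoi (trunc f n) a ≠ ∞ := by
  have : intIoi (trunc f n) a ≤ (n : ℝ≥0∞) * volume (Ioo a n) := by
    rw [intIoi, trunc, setLIntegral_indicator measurableSet_Iio, inter_comm, Ioi_inter_Iio,
      ← setLIntegral_const]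
    exact lintegral_mono fun t => min_le_right _ _
  refine ne_top_of_le_ne_top ?_ this
  rw [Real.volume_Ioo]
  exact ENNReal.mul_ne_top (ENNReal.natCast_ne_top n) ENNReal.ofReal_ne_top

lemma iSup_setLIntegral_trunc {f : ℝ → ℝ≥0∞} (hf : Measurable f) (S : Set ℝ) :
    ⨆ n, ∫⁻ t in S, trunc f n t = ∫⁻ t in S, f t := by
  rw [← lintegral_iSup (measurable_trunc hf) (trunc_mono f)]
  simp_rw [iSup_trunc]

/-! ### Hardy's inequality for the Copson operator and an arbitrary measure: necessity -/

lemma rpow_conjExponent_identity {p : ℝ} (hp : 1 < p) (y : ℝ≥0∞) (hy : 0 < y) :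
    (y ^ (1 - p.conjExponent)) ^ p * y = y ^ (1 - p.conjExponent) := by
  have hp1 : 0 < p - 1 := by linarith
  have hneg : 1 - p.conjExponent < 0 := by
    rw [Real.conjExponent, sub_neg, lt_div_iff₀ hp1]; linarith
  rcases eq_or_ne y ∞ with rfl | hyt
  · rw [ENNReal.top_rpow_of_neg hneg, ENNReal.zero_rpow_of_pos (by linarith), zero_mul]
  · rw [← ENNReal.rpow_mul]
    conv_lhs => rw [← ENNReal.rpow_one y, ← ENNReal.rpow_mul, one_mul,
      ← ENNReal.rpow_add _ _ hy.ne' hyt]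
    congr 1
    rw [Real.conjExponent]
    field_simp
    ring

lemma one_sub_inv_eq_inv_conjExponent {p : ℝ} (hp : 1 < p) :
    1 - 1 / p = 1 / p.conjExponent := by
  rw [Real.conjExponent]; field_simp

/-- Duality: `V(x) ^ (1 / p')` is the norm of the functional `h ↦ ∫_x^∞ h`. -/
lemma dualTail_rpow_le {p : ℝ} (hp : 1 < p) {v : ℝ → ℝ≥0∞} (hv : Measurable v)
    {x : ℝ} {K : ℝ≥0∞}
    (hK : ∀ h : ℝ → ℝ≥0∞, Measurable h → intIoi h x ≠ ∞ →
      intIoi (fun y => h y ^ p * v y) x ≠ ∞ →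
      intIoi h x ≤ K * intIoi (fun y => h y ^ p * v y) x ^ (1 / p)) :
    dualTail p v x ^ (1 / p.conjExponent) ≤ K := by
  have hp' := conjExponent_pos hp
  have hp1 : 0 < p - 1 := by linarith
  set g : ℝ → ℝ≥0∞ := fun y => v y ^ (1 - p.conjExponent) with hg
  have hgm : Measurable g := hv.pow_const _
  rw [one_div, ENNReal.rpow_inv_le_iff hp']
  have e : dualTail p v x = ⨆ n, intIoi (trunc g n) x := (iSup_setLIntegral_trunc hgm _).symm
  rw [e]
  refine iSup_le fun n => ?_
  have hle : ∀ y, trunc g n y ^ p * v y ≤ trunc g n y := by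
    intro y
    have h1 : ∀ z : ℝ≥0∞, z ^ p = z * z ^ (p - 1) := fun z => by
      conv_lhs => rw [show p = 1 + (p - 1) by ring]
      rw [ENNReal.rpow_add_of_nonneg _ _ zero_le_one hp1.le, ENNReal.rpow_one]
    have h2 : g y ^ (p - 1) * v y ≤ 1 := by
      rw [hg, ← ENNReal.rpow_mul, show (1 - p.conjExponent) * (p - 1) = -1 by
        rw [Real.conjExponent]; field_simp; ring, ENNReal.rpow_neg_one]
      exact ENNReal.inv_mul_le_one _
    calc trunc g n y ^ p * v y = trunc g n y * (trunc g n y ^ (p - 1) * v y) := by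
          rw [h1, mul_assoc]
      _ ≤ trunc g n y * (g y ^ (p - 1) * v y) := by
          gcongr; exact trunc_le g n y
      _ ≤ trunc g n y * 1 := by gcongr
      _ = _ := mul_one _
  have hX : intIoi (trunc g n) x ≤ K * intIoi (trunc g n) x ^ (1 / p) := by
    have hfin := intIoi_trunc_ne_top g n x
    refine (hK _ (measurable_trunc hgm n) hfin
      (ne_top_of_le_ne_top hfin (lintegral_mono hle))).trans ?_
    gcongr
    exact lintegral_mono hle
  have := rpow_le_of_le_mul_rpow (intIoi_trunc_ne_top g n x) ((div_lt_one (by linarith)).2 hp) hX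
  rwa [one_sub_inv_eq_inv_conjExponent hp, one_div, ENNReal.rpow_inv_le_iff hp'] at this

lemma measure_setOf_measure_Ioi_le (ρ : Measure ℝ) [NullSingletonClass ρ] {c : ℝ≥0∞} :
    ρ {t | ρ (Ioi t) ≤ c} ≤ c := by
  have h := measure_setOf_measure_Iic_le (ρ.map Neg.neg) (c := c)
  have hI : ∀ t, (ρ.map Neg.neg) (Iic t) = ρ (Ioi (-t)) := fun t => by
    rw [Measure.map_apply measurable_neg measurableSet_Iic, measure_congr Ioi_ae_eq_Ici]
    congr 1
    ext y; simp
  simp_rw [hI] at h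
  rw [Measure.map_apply measurable_neg] at h
  · convert h using 2
    ext y; simp
  · have : Measurable fun t : ℝ => ρ (Ioi (-t)) :=
      Monotone.measurable fun a b hab => measure_mono (Ioi_subset_Ioi (by linarith))
    exact this measurableSet_Iic

/-- A finite measure without atoms is transported to Lebesgue measure by its tail function. -/
lemma map_measure_Ioi_toReal (η : Measure ℝ) [IsFiniteMeasure η] [NullSingletonClass η] :
    η.map (fun y => (η (Ioi y)).toReal) = volume.restrict (Ioc 0 (η univ).toReal) := by
  have hmeas : Measurable fun y => (η (Ioi y)).toReal :=
    (Antitone.measurable fun _ _ h => measure_mono (Ioi_subset_Ioi h)).ennreal_toReal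
  refine Measure.ext_of_Iic _ _ fun c => ?_
  rw [Measure.map_apply hmeas measurableSet_Iic, Measure.restrict_apply measurableSet_Iic,
    inter_comm, Ioc_inter_Iic, Real.volume_Ioc, sub_zero]
  rcases lt_or_ge c 0 with hc | hc
  · have : (fun y => (η (Ioi y)).toReal) ⁻¹' Iic c = ∅ := by
      ext y
      simp only [mem_preimage, mem_Iic, mem_empty_iff_false, iff_false, not_le]
      exact hc.trans_le ENNReal.toReal_nonneg
    rw [this, measure_empty, ENNReal.ofReal_of_nonpos]
    exact (min_le_right _ _).trans hc.le
  have hset : (fun y => (η (Ioi y)).toReal) ⁻¹' Iic c = {y | η (Ioi y) ≤ ENNReal.ofReal c} := by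
    ext y
    simp only [mem_preimage, mem_Iic, mem_ofPred_eq]
    rw [ENNReal.le_ofReal_iff_toReal_le (measure_ne_top _ _) hc]
  rw [hset, ENNReal.ofReal_min, ENNReal.ofReal_toReal (measure_ne_top _ _)]
  refine le_antisymm (le_min (measure_mono (subset_univ _)) (measure_setOf_measure_Ioi_le η)) ?_
  have hcompl : {y | η (Ioi y) ≤ ENNReal.ofReal c}ᶜ ⊆
      {y | η (Iic y) ≤ η univ - ENNReal.ofReal c} := by
    intro y hy
    have hy' : ENNReal.ofReal c < η (Ioi y) := not_le.1 hy
    rw [mem_ofPred_eq]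
    refine ENNReal.le_sub_of_add_le_right ENNReal.ofReal_ne_top ?_
    calc _ ≤ η (Iic y) + η (Ioi y) := by gcongr
      _ = η univ := by
        rw [← measure_union (Iic_disjoint_Ioi le_rfl) measurableSet_Ioi, Iic_union_Ioi]
  have hle := (measure_mono hcompl).trans (measure_setOf_measure_Iic_le η)
  have htot : η univ ≤ η {y | η (Ioi y) ≤ ENNReal.ofReal c} +
      (η univ - ENNReal.ofReal c) := by
    calc η univ ≤ _ := measure_univ_le_add_compl _
      _ ≤ _ := by gcongr
  rcases le_total (η univ) (ENNReal.ofReal c) with h | h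
  · rw [min_eq_left h]
    rwa [tsub_eq_zero_of_le h, add_zero] at htot
  · rw [min_eq_right h]
    have hfin : η univ - ENNReal.ofReal c ≠ ∞ :=
      ne_top_of_le_ne_top (measure_ne_top η univ) tsub_le_self
    rw [← ENNReal.add_le_add_iff_right hfin, add_tsub_cancel_of_le h]
    exact htot

/-- `∫_x^∞ V^{s-1} g = V(x)^s / s` for `V(x) = ∫_x^∞ g` finite and `s > 0`. -/
lemma lintegral_mul_intIoi_rpow {g : ℝ → ℝ≥0∞} (hg : Measurable g) {x s : ℝ} (hs : 0 < s)
    (hfin : intIoi g x ≠ ∞) :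
    ∫⁻ y in Ioi x, g y * intIoi g y ^ (s - 1) = ENNReal.ofReal s⁻¹ * intIoi g x ^ s := by
  set η : Measure ℝ := (volume.restrict (Ioi x)).withDensity g with hη
  have hηuniv : η univ = intIoi g x := by
    rw [hη, withDensity_apply _ MeasurableSet.univ, Measure.restrict_univ]; rfl
  have : IsFiniteMeasure η := ⟨lt_top_iff_ne_top.2 (hηuniv ▸ hfin)⟩
  have hηIoi : ∀ y, x < y → η (Ioi y) = intIoi g y := fun y hy => by
    rw [hη, withDensity_apply _ measurableSet_Ioi, Measure.restrict_restrict measurableSet_Ioi,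
      inter_eq_left.2 (Ioi_subset_Ioi hy.le)]; rfl
  have hmeas : Measurable fun y => (η (Ioi y)).toReal :=
    (Antitone.measurable fun _ _ h => measure_mono (Ioi_subset_Ioi h)).ennreal_toReal
  have hm : Measurable fun c : ℝ => ENNReal.ofReal c ^ (s - 1) := by fun_prop
  calc ∫⁻ y in Ioi x, g y * intIoi g y ^ (s - 1)
      = ∫⁻ y in Ioi x, g y * ENNReal.ofReal (η (Ioi y)).toReal ^ (s - 1) := by
        refine setLIntegral_congr_fun measurableSet_Ioi fun y hy => ?_
        rw [ENNReal.ofReal_toReal (measure_ne_top _ _), hηIoi y hy]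
    _ = ∫⁻ y, ENNReal.ofReal (η (Ioi y)).toReal ^ (s - 1) ∂η := by
        conv_rhs => rw [hη]
        exact (lintegral_withDensity_eq_lintegral_mul _ hg (hm.comp hmeas)).symm
    _ = ∫⁻ c in Ioc 0 (η univ).toReal, ENNReal.ofReal c ^ (s - 1) := by
        rw [← map_measure_Ioi_toReal η, lintegral_map hm hmeas]
    _ = ∫⁻ c in Ioc 0 (η univ).toReal, ENNReal.ofReal (c ^ (s - 1)) := by
        refine setLIntegral_congr_fun measurableSet_Ioc fun c hc => ?_
        exact ENNReal.ofReal_rpow_of_pos hc.1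
    _ = ENNReal.ofReal (∫ c in (0 : ℝ)..(η univ).toReal, c ^ (s - 1)) := by
        rw [intervalIntegral.integral_of_le ENNReal.toReal_nonneg,
          ofReal_integral_eq_lintegral_ofReal]
        · exact (intervalIntegral.intervalIntegrable_rpow' (by linarith)).1
        · filter_upwards [ae_restrict_mem measurableSet_Ioc] with c hc
          exact Real.rpow_nonneg hc.1.le _
    _ = _ := by
        rw [integral_rpow (.inl (by linarith)), sub_add_cancel, Real.zero_rpow hs.ne', sub_zero,
          div_eq_inv_mul, ENNReal.ofReal_mul (by positivity),
          ← ENNReal.ofReal_rpow_of_nonneg ENNReal.toReal_nonneg hs.le,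
          ENNReal.ofReal_toReal (measure_ne_top _ _), hηuniv]

/-- The near-extremal function of Hardy's inequality with respect to the measure `ρ` in the
case `q < p`. -/
noncomputable def testFun (p q : ℝ) (v : ℝ → ℝ≥0∞) (ρ : Measure ℝ) (y : ℝ) : ℝ≥0∞ :=
  v y ^ (1 - p.conjExponent) * dualTail p v y ^ ((q - 1) / (p - q)) * ρ (Iio y) ^ (1 / (p - q))

lemma measurable_testFun {p q : ℝ} {v : ℝ → ℝ≥0∞} (hv : Measurable v) (ρ : Measure ℝ) :
    Measurable (testFun p q v ρ) :=
  ((hv.pow_const _).mul ((measurable_dualTail p v).pow_const _)).mul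
    ((measurable_measure_Iio ρ).pow_const _)

lemma le_intIoi_testFun {p q : ℝ} (hp : 1 < p) (hqp : q < p) {v : ℝ → ℝ≥0∞}
    (hv : Measurable v) (ρ : Measure ℝ) {x : ℝ} (hx : dualTail p v x ≠ ∞) :
    ρ (Iic x) ^ (1 / (p - q)) * dualTail p v x ^ ((p - 1) / (p - q)) ≤
      ENNReal.ofReal ((p - 1) / (p - q)) * intIoi (testFun p q v ρ) x := by
  have hpq : 0 < p - q := sub_pos.2 hqp
  have hp1 : 0 < p - 1 := by linarith
  have hs : 0 < (p - 1) / (p - q) := by positivity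
  have hg : Measurable fun y => v y ^ (1 - p.conjExponent) := hv.pow_const _
  have key := lintegral_mul_intIoi_rpow hg hs hx
  rw [show (p - 1) / (p - q) - 1 = (q - 1) / (p - q) by field_simp; ring] at key
  have hge : ρ (Iic x) ^ (1 / (p - q)) *
      (ENNReal.ofReal ((p - 1) / (p - q))⁻¹ * dualTail p v x ^ ((p - 1) / (p - q))) ≤
      intIoi (testFun p q v ρ) x := by
    have hmm : Measurable fun y => v y ^ (1 - p.conjExponent) *
        intIoi (fun y => v y ^ (1 - p.conjExponent)) y ^ ((q - 1) / (p - q)) :=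
      hg.mul ((measurable_intIoi _).pow_const _)
    rw [dualTail, ← key, ← lintegral_const_mul _ hmm]
    refine setLIntegral_mono' measurableSet_Ioi fun y hy => ?_
    exact (mul_comm _ _).trans_le (mul_le_mul_right (ENNReal.rpow_le_rpow
      (measure_mono (Iic_subset_Iio.2 hy)) (by positivity)) _)
  calc _ = ENNReal.ofReal ((p - 1) / (p - q)) * (ρ (Iic x) ^ (1 / (p - q)) *
      (ENNReal.ofReal ((p - 1) / (p - q))⁻¹ * dualTail p v x ^ ((p - 1) / (p - q)))) := by
        have : ENNReal.ofReal ((p - 1) / (p - q)) * ENNReal.ofReal ((p - 1) / (p - q))⁻¹ = 1 := by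
          rw [← ENNReal.ofReal_mul hs.le, mul_inv_cancel₀ hs.ne', ENNReal.ofReal_one]
        rw [show ∀ a b c d : ℝ≥0∞, a * (b * (c * d)) = (a * c) * (b * d) by intros; ring, this,
          one_mul]
    _ ≤ _ := by gcongr

/-- `∫ ρ((-∞,t])^{q/(p-q)} V(t)^{(p-1)q/(p-q)} dρ(t)` over `(a,∞)`, the quantity that
characterizes Hardy's inequality for `q < p`. -/
noncomputable def hardyInt (p q : ℝ) (v : ℝ → ℝ≥0∞) (ρ : Measure ℝ) (a : ℝ) : ℝ≥0∞ :=
  ∫⁻ t in Ioi a, ρ (Iic t) ^ (q / (p - q)) * dualTail p v t ^ ((p - 1) * q / (p - q)) ∂ρ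

lemma intIoi_testFun_rpow_le {p q : ℝ} (hp : 1 < p) (hq : 0 < q) (hqp : q < p)
    {v : ℝ → ℝ≥0∞} (hv : Measurable v) (hv0 : ∀ x, 0 < v x) (ρ : Measure ℝ) [SFinite ρ] {a : ℝ}
    (hρ : ρ (Iic a) = 0) (hV : ∀ x, a < x → dualTail p v x ≠ ∞) :
    intIoi (fun y => testFun p q v ρ y ^ p * v y) a ≤
      2 ^ (p / (p - q)) * ENNReal.ofReal ((p - 1) * q / (p - q))⁻¹ * hardyInt p q v ρ a := by
  have hp0 : 0 < p := by linarith
  have hpq : 0 < p - q := sub_pos.2 hqp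
  have hp1 : 0 < p - 1 := by linarith
  set σ := (p - 1) * q / (p - q) with hσdef
  have hσ : 0 < σ := by positivity
  set g : ℝ → ℝ≥0∞ := fun y => v y ^ (1 - p.conjExponent) with hgdef
  have hg : Measurable g := hv.pow_const _
  set Φ : ℝ → ℝ≥0∞ := fun y => g y * dualTail p v y ^ (σ - 1) with hΦ
  have hΦm : Measurable Φ := hg.mul ((measurable_dualTail p v).pow_const _)
  set F : ℝ → ℝ≥0∞ := fun t => ρ (Iic t) ^ (q / (p - q)) with hF
  have hFm : Measurable F := (measurable_measure_Iic ρ).pow_const _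
  have hpt : ∀ y, testFun p q v ρ y ^ p * v y = Φ y * ρ (Iio y) ^ (p / (p - q)) := by
    intro y
    rw [testFun, ENNReal.mul_rpow_of_nonneg _ _ hp0.le, ENNReal.mul_rpow_of_nonneg _ _ hp0.le,
      ← ENNReal.rpow_mul (ρ _), ← ENNReal.rpow_mul (dualTail _ _ _), one_div_mul_eq_div, hΦ]
    conv_rhs => rw [hgdef]; simp only []; rw [← rpow_conjExponent_identity hp _ (hv0 y)]
    rw [show (q - 1) / (p - q) * p = σ - 1 by rw [hσdef]; field_simp; ring]
    ring
  have hs : q / (p - q) + 1 = p / (p - q) := by field_simp; ring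
  have hIio : ∀ y, ρ (Iio y) ^ (p / (p - q)) ≤
      2 ^ (p / (p - q)) * ∫⁻ t in Ioi a, (Iio y).indicator F t ∂ρ := by
    intro y
    rw [← hs]
    refine (measure_rpow_le_setLIntegral ρ (by positivity) _).trans ?_
    refine mul_le_mul_right ?_ _
    have hnull : ρ.restrict (Ioi a) = ρ := by
      refine Measure.restrict_eq_self_of_ae_mem ?_
      rw [ae_iff]
      convert hρ using 2
      ext; simp
    rw [hnull, lintegral_indicator measurableSet_Iio]
  have huncurry : Measurable (Function.uncurry fun y t : ℝ => Φ y * (Iio y).indicator F t) := by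
    have : (Function.uncurry fun y t : ℝ => Φ y * (Iio y).indicator F t) =
        fun z : ℝ × ℝ => Φ z.1 * {z : ℝ × ℝ | z.2 < z.1}.indicator (fun z => F z.2) z := by
      ext ⟨y, t⟩
      simp [Function.uncurry, indicator]
    rw [this]
    exact (hΦm.comp measurable_fst).mul
      ((hFm.comp measurable_snd).indicator (measurableSet_lt measurable_snd measurable_fst))
  calc intIoi (fun y => testFun p q v ρ y ^ p * v y) a
      = ∫⁻ y in Ioi a, Φ y * ρ (Iio y) ^ (p / (p - q)) := by simp_rw [intIoi, hpt]
    _ ≤ ∫⁻ y in Ioi a, 2 ^ (p / (p - q)) *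
          ∫⁻ t in Ioi a, Φ y * (Iio y).indicator F t ∂ρ := by
        refine lintegral_mono fun y => ?_
        beta_reduce
        rw [lintegral_const_mul _ (hFm.indicator measurableSet_Iio),
          show ∀ a b c : ℝ≥0∞, a * (b * c) = b * (a * c) by intros; ring]
        exact mul_le_mul_right (hIio y) _
    _ = 2 ^ (p / (p - q)) * ∫⁻ y in Ioi a, ∫⁻ t in Ioi a, Φ y * (Iio y).indicator F t ∂ρ := by
        rw [lintegral_const_mul _ huncurry.lintegral_prod_right]
    _ = 2 ^ (p / (p - q)) * ∫⁻ t in Ioi a, (∫⁻ y in Ioi a, Φ y * (Iio y).indicator F t) ∂ρ := by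
        rw [lintegral_lintegral_swap huncurry.aemeasurable]
    _ = 2 ^ (p / (p - q)) * ∫⁻ t in Ioi a, ENNReal.ofReal σ⁻¹ *
          (F t * dualTail p v t ^ σ) ∂ρ := by
        congr 1
        refine setLIntegral_congr_fun measurableSet_Ioi fun t ht => ?_
        have e : ∀ y, Φ y * (Iio y).indicator F t = (Ioi t).indicator (fun y => F t * Φ y) y := by
          intro y
          by_cases h : t < y
          · simp [indicator, h, mul_comm]
          · simp [indicator, h]
        simp_rw [e]
        rw [setLIntegral_indicator measurableSet_Ioi, inter_eq_left.2
          (Ioi_subset_Ioi (le_of_lt ht)), lintegral_const_mul _ hΦm]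
        have := lintegral_mul_intIoi_rpow hg hσ (hV t ht)
        rw [hΦ]
        change F t * ∫⁻ y in Ioi t, g y * intIoi g y ^ (σ - 1) = _
        rw [this]
        change F t * (_ * dualTail p v t ^ σ) = _
        ring
    _ = _ := by
        have hmm : Measurable fun t => F t * dualTail p v t ^ σ :=
          hFm.mul ((measurable_dualTail p v).pow_const _)
        rw [lintegral_const_mul _ hmm, mul_assoc]
        rfl

/-- If the test function of the measure `ρ` obeys Hardy's inequality with constant `c`, then the
characterizing quantity of `ρ` is bounded in terms of `c`. -/
lemma hardyInt_rpow_le (p q : ℝ) (hp : 1 < p) (hq : 0 < q) (hqp : q < p) :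
    ∃ K : ℝ≥0, ∀ (v : ℝ → ℝ≥0∞) (_ : Measurable v) (_ : ∀ x, 0 < v x) (ρ : Measure ℝ)
      (_ : SFinite ρ) (a : ℝ) (c : ℝ≥0∞), ρ (Iic a) = 0 → (∀ x, a < x → dualTail p v x ≠ ∞) →
      hardyInt p q v ρ a ≠ ∞ →
      ∫⁻ t in Ioi a, intIoi (testFun p q v ρ) t ^ q ∂ρ ≤
        c * intIoi (fun y => testFun p q v ρ y ^ p * v y) a ^ (q / p) →
      hardyInt p q v ρ a ^ ((p - q) / p) ≤ K * c := by
  have hp0 : 0 < p := by linarith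
  have hpq : 0 < p - q := sub_pos.2 hqp
  have hp1 : 0 < p - 1 := by linarith
  set K₁ : ℝ≥0∞ := ENNReal.ofReal ((p - 1) / (p - q)) ^ q with hK₁
  set K₂ : ℝ≥0∞ := (2 ^ (p / (p - q)) * ENNReal.ofReal ((p - 1) * q / (p - q))⁻¹) ^ (q / p)
    with hK₂
  have hK₁t : K₁ ≠ ∞ := ENNReal.rpow_ne_top_of_nonneg hq.le ENNReal.ofReal_ne_top
  have hK₂t : K₂ ≠ ∞ := ENNReal.rpow_ne_top_of_nonneg (by positivity) (ENNReal.mul_ne_top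
    (ENNReal.rpow_ne_top_of_nonneg (by positivity) (by norm_num)) ENNReal.ofReal_ne_top)
  refine ⟨(K₁ * K₂).toNNReal, fun v hv hv0 ρ _ a c hρ hV hD hc => ?_⟩
  rw [ENNReal.coe_toNNReal (ENNReal.mul_ne_top hK₁t hK₂t)]
  set D := hardyInt p q v ρ a with hDdef
  have h1 : D ≤ K₁ * ∫⁻ t in Ioi a, intIoi (testFun p q v ρ) t ^ q ∂ρ := by
    rw [← lintegral_const_mul _ ((measurable_intIoi _).pow_const _), hDdef, hardyInt]
    refine setLIntegral_mono' measurableSet_Ioi fun t ht => ?_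
    have := ENNReal.rpow_le_rpow (le_intIoi_testFun hp hqp hv ρ (hV t ht)) hq.le
    rw [ENNReal.mul_rpow_of_nonneg _ _ hq.le, ENNReal.mul_rpow_of_nonneg _ _ hq.le,
      ← ENNReal.rpow_mul, ← ENNReal.rpow_mul, one_div_mul_eq_div, div_mul_eq_mul_div] at this
    exact this
  have h2 : D ≤ (K₁ * K₂ * c) * D ^ (q / p) := by
    calc D ≤ K₁ * (c * intIoi (fun y => testFun p q v ρ y ^ p * v y) a ^ (q / p)) :=
          h1.trans (mul_le_mul_right hc _)
      _ ≤ K₁ * (c * (2 ^ (p / (p - q)) * ENNReal.ofReal ((p - 1) * q / (p - q))⁻¹ * D)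
            ^ (q / p)) := by
          gcongr
          exact intIoi_testFun_rpow_le hp hq hqp hv hv0 ρ hρ hV
      _ = _ := by
          rw [ENNReal.mul_rpow_of_nonneg _ _ (by positivity : 0 ≤ q / p)]
          ring
  have := rpow_le_of_le_mul_rpow hD ((div_lt_one hp0).2 hqp) h2
  rwa [show 1 - q / p = (p - q) / p by field_simp] at this

/-! ### Monotone limits and essential bounds -/

lemma iSup_rpow {ι : Sort*} (f : ι → ℝ≥0∞) {s : ℝ} (hs : 0 < s) :
    (⨆ i, f i) ^ s = ⨆ i, f i ^ s :=
  (ENNReal.orderIsoRpow s hs).map_iSup f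

lemma iSup_mul_iSup_of_monotone {f g : ℕ → ℝ≥0∞} (hf : Monotone f) (hg : Monotone g) :
    (⨆ n, f n) * (⨆ n, g n) = ⨆ n, f n * g n := by
  refine le_antisymm (ENNReal.mul_le_of_forall_lt fun a ha b hb => ?_)
    (iSup_le fun n => mul_le_mul' (le_iSup f n) (le_iSup g n))
  obtain ⟨m, hm⟩ := lt_iSup_iff.1 ha
  obtain ⟨k, hk⟩ := lt_iSup_iff.1 hb
  refine le_trans ?_ (le_iSup _ (max m k))
  exact mul_le_mul' (hm.le.trans (hf (le_max_left _ _))) (hk.le.trans (hg (le_max_right _ _)))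

lemma setLIntegral_iSup_rpow_mul {S : Set ℝ} {F f : ℕ → ℝ → ℝ≥0∞} {Φ : ℝ → ℝ≥0∞}
    {s : ℝ} (hs : 0 < s) (hF : ∀ n, Measurable (F n)) (hFm : Monotone F)
    (hf : ∀ n, Measurable (f n)) (hfm : Monotone f) (hΦ : Measurable Φ) :
    ∫⁻ t in S, (⨆ n, F n t) ^ s * (⨆ n, f n t) * Φ t =
      ⨆ n, ∫⁻ t in S, F n t ^ s * f n t * Φ t := by
  have hF' : ∀ t, Monotone fun n => F n t ^ s := fun t m n hmn =>
    ENNReal.rpow_le_rpow (hFm hmn t) hs.le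
  rw [← lintegral_iSup]
  · refine lintegral_congr fun t => ?_
    rw [iSup_rpow _ hs, iSup_mul_iSup_of_monotone (hF' t) (fun m n hmn => hfm hmn t),
      ENNReal.iSup_mul]
  · exact fun n => (((hF n).pow_const _).mul (hf n)).mul hΦ
  · exact fun m n hmn t => mul_le_mul_left (mul_le_mul' (hF' t hmn) (hfm hmn t)) _

lemma exists_mem_Ioo_of_ae {P : ℝ → Prop} {a y x : ℝ} (h : ∀ᵐ z ∂(volume.restrict (Ioi a)), P z)
    (hay : a ≤ y) (hyx : y < x) : ∃ z ∈ Ioo y x, P z := by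
  by_contra hcon
  push Not at hcon
  have h0 : volume (Ioo y x) = 0 := by
    have h' : ∀ᵐ z ∂(volume.restrict (Ioo y x)), P z :=
      ae_restrict_of_ae_restrict_of_subset (fun z hz => lt_of_le_of_lt hay hz.1) h
    rw [ae_restrict_iff' measurableSet_Ioo, ae_iff] at h'
    refine measure_mono_null (fun z hz => ?_) h'
    simp only [mem_ofPred_eq, Classical.not_imp]
    exact ⟨hz, hcon z hz⟩
  rw [Real.volume_Ioo, ENNReal.ofReal_eq_zero] at h0
  linarith

lemma intIoo_mono_right (f : ℝ → ℝ≥0∞) (a : ℝ) : Monotone (intIoo f a) := fun _ _ h =>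
  lintegral_mono_set (Ioo_subset_Ioo_right h)

lemma intIoo_anti_left (f : ℝ → ℝ≥0∞) (b : ℝ) : Antitone fun a => intIoo f a b := fun _ _ h =>
  lintegral_mono_set (Ioo_subset_Ioo_left h)

lemma measurable_intIoo_right (f : ℝ → ℝ≥0∞) (a : ℝ) : Measurable (intIoo f a) :=
  (intIoo_mono_right f a).measurable

lemma measurable_intIoo_left (f : ℝ → ℝ≥0∞) (b : ℝ) : Measurable fun a => intIoo f a b :=
  (intIoo_anti_left f b).measurable

lemma intIoo_eq_zero (f : ℝ → ℝ≥0∞) {a b : ℝ} (h : b ≤ a) : intIoo f a b = 0 := by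
  rw [intIoo, Ioo_eq_empty (not_lt.2 h)]; simp

lemma intIoo_pos {f : ℝ → ℝ≥0∞} (hf : Measurable f) (hf0 : ∀ x, 0 < f x) {a b : ℝ} (h : a < b) :
    0 < intIoo f a b := by
  rw [intIoo, setLIntegral_pos_iff hf]
  have : Function.support f = univ := by
    ext x; simp [(hf0 x).ne']
  rw [this, univ_inter, Real.volume_Ioo]
  simpa using h

/-- The primitive `x ↦ ∫_a^x f` is the limit of its values from the left. -/
lemma intIoo_eq_iSup (f : ℝ → ℝ≥0∞) (a x : ℝ) :
    intIoo f a x = ⨆ n : ℕ, intIoo f a (x - 1 / ((n : ℝ) + 1)) := by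
  refine le_antisymm ?_ (iSup_le fun n => intIoo_mono_right f a (by
    have : (0 : ℝ) < 1 / ((n : ℝ) + 1) := by positivity
    linarith))
  have hmono : Monotone fun n : ℕ => Ioo a (x - 1 / ((n : ℝ) + 1)) := fun m n hmn =>
    Ioo_subset_Ioo_right (by gcongr)
  have hU : Ioo a x ⊆ ⋃ n : ℕ, Ioo a (x - 1 / ((n : ℝ) + 1)) := by
    intro y hy
    obtain ⟨n, hn⟩ := exists_nat_one_div_lt (sub_pos.2 hy.2)
    exact mem_iUnion.2 ⟨n, hy.1, by linarith⟩
  calc intIoo f a x ≤ ∫⁻ s in ⋃ n : ℕ, Ioo a (x - 1 / ((n : ℝ) + 1)), f s := lintegral_mono_set hU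
    _ = _ := by
      exact setLIntegral_iUnion_of_directed f hmono.directed_le

lemma exists_lt_intIoo {f : ℝ → ℝ≥0∞} {a x : ℝ} {c : ℝ≥0∞} (hc : c < intIoo f a x) :
    ∃ y, a ≤ y ∧ y < x ∧ c < intIoo f a y := by
  rw [intIoo_eq_iSup, lt_iSup_iff] at hc
  obtain ⟨n, hn⟩ := hc
  refine ⟨_, ?_, ?_, hn⟩
  · by_contra hcon
    rw [intIoo_eq_zero f (not_le.1 hcon).le] at hn
    exact not_lt_zero hn
  · have : (0 : ℝ) < 1 / ((n : ℝ) + 1) := by positivity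
    linarith

/-- An almost everywhere bound on the product of a left-continuous increasing function and a
decreasing function holds everywhere. -/
lemma rpow_mul_rpow_le_of_ae_le {F V : ℝ → ℝ≥0∞} {a α β : ℝ} (hα : 0 < α) (hβ : 0 ≤ β)
    {E : ℝ≥0∞} (hF : Monotone F)
    (hlc : ∀ x c, c < F x → ∃ y, a ≤ y ∧ y < x ∧ c < F y) (hV : Antitone V)
    (h : ∀ᵐ y ∂(volume.restrict (Ioi a)), F y ^ α * V y ^ β ≤ E) (x : ℝ) :
    F x ^ α * V x ^ β ≤ E := by
  refine ENNReal.mul_le_of_forall_lt fun c hc d hd => ?_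
  have hc' : c ^ α⁻¹ < F x := by rwa [ENNReal.rpow_inv_lt_iff hα]
  obtain ⟨y, hay, hyx, hy⟩ := hlc x _ hc'
  obtain ⟨z, hz, hzE⟩ := exists_mem_Ioo_of_ae h hay hyx
  rw [ENNReal.rpow_inv_lt_iff hα] at hy
  refine le_trans (mul_le_mul' ?_ ?_) hzE
  · exact hy.le.trans (ENNReal.rpow_le_rpow (hF hz.1.le) hα.le)
  · exact hd.le.trans (ENNReal.rpow_le_rpow (hV hz.2.le) hβ)

/-! ### The constant in Hardy's inequality on `(t,∞)` -/

/-- The measure `u(x) dx` on `(t,∞)`. -/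
noncomputable def tailMeasure (u : ℝ → ℝ≥0∞) (t : ℝ) : Measure ℝ :=
  (volume.restrict (Ioi t)).withDensity u

lemma tailMeasure_Iic (u : ℝ → ℝ≥0∞) (t x : ℝ) : tailMeasure u t (Iic x) = intIoo u t x := by
  rw [tailMeasure, withDensity_apply _ measurableSet_Iic,
    Measure.restrict_restrict measurableSet_Iic, inter_comm, Ioi_inter_Iic, intIoo,
    setLIntegral_congr Ioo_ae_eq_Ioc]

lemma setLIntegral_tailMeasure {u f : ℝ → ℝ≥0∞} (hu : Measurable u) (hf : Measurable f)
    {a t : ℝ} (hat : a ≤ t) :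
    ∫⁻ x in Ioi a, f x ∂(tailMeasure u t) = intIoi (fun x => f x * u x) t := by
  rw [tailMeasure, restrict_withDensity measurableSet_Ioi,
    lintegral_withDensity_eq_lintegral_mul _ hu hf, Measure.restrict_restrict measurableSet_Ioi,
    inter_eq_right.2 (Ioi_subset_Ioi hat), intIoi]
  simp_rw [Pi.mul_apply, mul_comm]

lemma intIoi_indicator (f : ℝ → ℝ≥0∞) {t x : ℝ} (h : t ≤ x) :
    intIoi ((Ioi t).indicator f) x = intIoi f x := by
  rw [intIoi, setLIntegral_indicator measurableSet_Ioi, inter_eq_right.2 (Ioi_subset_Ioi h)]; rfl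

lemma intIoi_indicator' (f : ℝ → ℝ≥0∞) {t x : ℝ} (h : x ≤ t) :
    intIoi ((Ioi t).indicator f) x = intIoi f t := by
  rw [intIoi, setLIntegral_indicator measurableSet_Ioi, inter_eq_left.2 (Ioi_subset_Ioi h)]; rfl

lemma indicator_rpow_mul {p : ℝ} (hp : 0 < p) (s : Set ℝ) (h v : ℝ → ℝ≥0∞) :
    (fun y => s.indicator h y ^ p * v y) = s.indicator fun y => h y ^ p * v y := by
  ext y
  by_cases hy : y ∈ s
  · simp [hy]
  · simp [hy, ENNReal.zero_rpow_of_pos hp]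

/-- The function `S` is, up to the factor `K`, the best constant in Hardy's inequality
`(∫_t^∞ (∫_x^∞ h)^r u(x) dx)^{1/r} ≤ C (∫_t^∞ h^p v)^{1/p}`. -/
structure IsHardyConst (p r : ℝ) (u v S : ℝ → ℝ≥0∞) (K : ℝ≥0) : Prop where
  anti : Antitone S
  upper : ∀ t, 0 < t → ∀ h : ℝ → ℝ≥0∞, Measurable h → intIoi h t ≠ ∞ →
    intIoi (fun x => h x ^ p * v x) t ≠ ∞ →
    intIoi (fun x => intIoi h x ^ r * u x) t ≤
      (K * S t) ^ r * intIoi (fun x => h x ^ p * v x) t ^ (r / p)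
  lower : ∀ t, 0 < t → ∀ c : ℝ≥0∞, (∀ h : ℝ → ℝ≥0∞, Measurable h →
    intIoi (fun x => intIoi h x ^ r * u x) t ^ (1 / r) ≤
      c * intIoi (fun x => h x ^ p * v x) t ^ (1 / p)) → S t ≤ K * c

/-- `ess sup_{x > t} (∫_t^x u)^{1/r} V(x)^{1/p'}`. -/
noncomputable def supConst (p r : ℝ) (u v : ℝ → ℝ≥0∞) (t : ℝ) : ℝ≥0∞ :=
  essSupIoi (fun x => intIoo u t x ^ (1 / r) * dualTail p v x ^ (1 / p.conjExponent)) t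

/-- `(∫_t^∞ (∫_t^x u)^{r/(p-r)} u(x) V(x)^{(p-1)r/(p-r)} dx)^{(p-r)/(pr)}`. -/
noncomputable def intConst (p r : ℝ) (u v : ℝ → ℝ≥0∞) (t : ℝ) : ℝ≥0∞ :=
  intIoi (fun x => intIoo u t x ^ (r / (p - r)) * u x *
    dualTail p v x ^ ((p - 1) * r / (p - r))) t ^ ((p - r) / (p * r))

lemma essSupIoi_mono_set (f : ℝ → ℝ≥0∞) : Antitone (essSupIoi f) := fun _ _ h =>
  essSup_mono_measure (Measure.absolutelyContinuous_of_le
    (Measure.restrict_mono (Ioi_subset_Ioi h) le_rfl))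

lemma essSupIoi_mono {f g : ℝ → ℝ≥0∞} (h : ∀ x, f x ≤ g x) (a : ℝ) :
    essSupIoi f a ≤ essSupIoi g a :=
  essSup_mono_ae (.of_forall h)

lemma supConst_anti {p r : ℝ} (hr : 0 < r) (u v : ℝ → ℝ≥0∞) : Antitone (supConst p r u v) := by
  intro s t hst
  refine le_trans (essSupIoi_mono (fun x => ?_) t) (essSupIoi_mono_set _ hst)
  exact mul_le_mul_left (ENNReal.rpow_le_rpow (intIoo_anti_left u x hst) (by positivity)) _

lemma rpow_mul_rpow_le_supConst {p r : ℝ} (hp : 1 < p) (hr : 0 < r) (u v : ℝ → ℝ≥0∞) (t x : ℝ) :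
    intIoo u t x ^ (1 / r) * dualTail p v x ^ (1 / p.conjExponent) ≤ supConst p r u v t := by
  have hp' := conjExponent_pos hp
  exact rpow_mul_rpow_le_of_ae_le (by positivity) (by positivity) (intIoo_mono_right u t)
    (fun x c hc => exists_lt_intIoo hc) (dualTail_anti p v) (ENNReal.ae_le_essSup _) x

lemma measurable_rpow_mul {p : ℝ} {h v : ℝ → ℝ≥0∞} (hh : Measurable h) (hv : Measurable v) :
    Measurable fun x => h x ^ p * v x := (hh.pow_const _).mul hv

/-- Functions supported on `(x,∞)` show that a Hardy inequality on `(t,∞)` with constant `c`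
bounds `(∫_t^x u)^{1/r} V(x)^{1/p'}` by `c`. -/
lemma rpow_mul_dualTail_le {p r : ℝ} (hp : 1 < p) (hr : 0 < r) {u v : ℝ → ℝ≥0∞}
    (hu : Measurable u) (hv : Measurable v) {t x : ℝ} (htx : t < x) {c : ℝ≥0∞}
    (hc : ∀ h : ℝ → ℝ≥0∞, Measurable h → intIoi h t ≠ ∞ →
      intIoi (fun x => h x ^ p * v x) t ≠ ∞ →
      intIoi (fun x => intIoi h x ^ r * u x) t ^ (1 / r) ≤
        c * intIoi (fun x => h x ^ p * v x) t ^ (1 / p)) :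
    intIoo u t x ^ (1 / r) * dualTail p v x ^ (1 / p.conjExponent) ≤ c := by
  refine ENNReal.mul_le_of_forall_lt fun b hb d hd => ?_
  rcases eq_or_ne b 0 with rfl | hb0
  · simp
  have hbt : b ≠ ∞ := hb.ne_top
  have key : dualTail p v x ^ (1 / p.conjExponent) ≤ c / b := by
    refine dualTail_rpow_le hp hv fun h hh hfin hN => ?_
    have h1 := hc _ (hh.indicator (measurableSet_Ioi (a := x)))
    rw [indicator_rpow_mul (by linarith), intIoi_indicator' _ htx.le,
      intIoi_indicator' _ htx.le] at h1
    replace h1 := h1 hfin hN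
    have h2 : intIoo u t x ^ (1 / r) * intIoi h x ≤
        intIoi (fun y => intIoi ((Ioi x).indicator h) y ^ r * u y) t ^ (1 / r) := by
      have : intIoi h x ^ r * intIoo u t x ≤
          intIoi (fun y => intIoi ((Ioi x).indicator h) y ^ r * u y) t := by
        rw [intIoo, ← lintegral_const_mul _ hu]
        refine le_trans (setLIntegral_mono' measurableSet_Ioo fun y hy => ?_)
          (lintegral_mono_set Ioo_subset_Ioi_self)
        rw [intIoi_indicator' _ hy.2.le]
      refine le_trans (le_of_eq ?_) (ENNReal.rpow_le_rpow this (by positivity))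
      rw [ENNReal.mul_rpow_of_nonneg _ _ (by positivity), ← ENNReal.rpow_mul,
        mul_one_div_cancel hr.ne', ENNReal.rpow_one, mul_comm]
    have h3 : intIoi h x * b ≤ c * intIoi (fun x => h x ^ p * v x) x ^ (1 / p) := by
      rw [mul_comm]
      exact (mul_le_mul_left hb.le _).trans (h2.trans h1)
    rw [← ENNReal.le_div_iff_mul_le (.inl hb0) (.inl hbt)] at h3
    rwa [ENNReal.mul_div_right_comm] at h3
  calc b * d ≤ b * (c / b) := mul_le_mul_right (hd.le.trans key) _
    _ = c := ENNReal.mul_div_cancel hb0 hbt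

lemma IsHardyConst.rpow_mul_rpow_le {p r : ℝ} (hp : 1 < p) (hr : 0 < r) {u v S : ℝ → ℝ≥0∞}
    {K : ℝ≥0} (hS : IsHardyConst p r u v S K) (hu : Measurable u) (hv : Measurable v) {t x : ℝ}
    (ht : 0 < t) (htx : t < x) :
    intIoo u t x ^ (1 / r) * dualTail p v x ^ (1 / p.conjExponent) ≤ K * S t := by
  refine rpow_mul_dualTail_le hp hr hu hv htx fun h hh hfin hN => ?_
  have := ENNReal.rpow_le_rpow (hS.upper t ht h hh hfin hN) (one_div_nonneg.2 hr.le)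
  rwa [ENNReal.mul_rpow_of_nonneg _ _ (by positivity), ← ENNReal.rpow_mul, ← ENNReal.rpow_mul,
    mul_one_div_cancel hr.ne', ENNReal.rpow_one, show r / p * (1 / r) = 1 / p by field_simp] at this

theorem isHardyConst_supConst {p r : ℝ} (hp : 1 < p) (hr : 0 < r) (hpr : p ≤ r)
    {u v : ℝ → ℝ≥0∞} (hu : Measurable u) (hv : Measurable v) (hv0 : ∀ x, 0 < v x) :
    IsHardyConst p r u v (supConst p r u v) 8 where
  anti := supConst_anti hr u v
  upper := by
    intro t ht h hh hfin hN
    have hp0 : 0 < p := by linarith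
    have hE : ∀ x, 0 < x → tailMeasure u t (Iic x) * dualTail p v x ^ (r / p.conjExponent) ≤
        supConst p r u v t ^ r := by
      intro x _
      have := ENNReal.rpow_le_rpow (rpow_mul_rpow_le_supConst hp hr u v t x) hr.le
      rwa [ENNReal.mul_rpow_of_nonneg _ _ hr.le, ← ENNReal.rpow_mul, ← ENNReal.rpow_mul,
        one_div_mul_cancel hr.ne', ENNReal.rpow_one, one_div_mul_eq_div,
        ← tailMeasure_Iic] at this
    have h0 := intIoi_indicator' h ht.le
    have hNi := intIoi_indicator' (fun x => h x ^ p * v x) ht.le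
    rw [← indicator_rpow_mul hp0] at hNi
    have := hardy_of_le hp hpr hv hv0 (hh.indicator (measurableSet_Ioi (a := t)))
      (by rwa [h0]) (by rwa [hNi]) (tailMeasure u t) hE
    rw [setLIntegral_tailMeasure hu ((measurable_intIoi _).pow_const _) ht.le, hNi] at this
    rw [ENNReal.mul_rpow_of_nonneg _ _ hr.le, mul_assoc]
    refine le_trans (setLIntegral_mono' measurableSet_Ioi fun x hx => ?_) this
    rw [intIoi_indicator _ (le_of_lt hx)]
  lower := by
    intro t ht c hc
    refine le_trans ?_ (le_mul_of_one_le_left zero_le (by norm_num : (1 : ℝ≥0∞) ≤ (8 : ℝ≥0)))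
    refine essSup_le_of_ae_le _ ?_
    filter_upwards [ae_restrict_mem measurableSet_Ioi] with x hx
    exact rpow_mul_dualTail_le hp hr hu hv hx fun h hh _ _ => hc h hh

lemma intConst_anti {p r : ℝ} (hp : 1 < p) (hr : 0 < r) (hrp : r < p) (u v : ℝ → ℝ≥0∞) :
    Antitone (intConst p r u v) := by
  intro s t hst
  have : 0 < p - r := sub_pos.2 hrp
  refine ENNReal.rpow_le_rpow (le_trans (lintegral_mono fun x => ?_)
    (lintegral_mono_set (Ioi_subset_Ioi hst))) (by positivity)
  exact mul_le_mul_left (mul_le_mul_left (ENNReal.rpow_le_rpow (intIoo_anti_left u x hst)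
    (by positivity)) _) _

lemma hardyInt_tailMeasure {p r : ℝ} {u v : ℝ → ℝ≥0∞} (hu : Measurable u) {a t : ℝ}
    (hat : a ≤ t) :
    hardyInt p r v (tailMeasure u t) a = intIoi (fun x => intIoo u t x ^ (r / (p - r)) * u x *
      dualTail p v x ^ ((p - 1) * r / (p - r))) t := by
  have hm : Measurable fun x => tailMeasure u t (Iic x) ^ (r / (p - r)) *
      dualTail p v x ^ ((p - 1) * r / (p - r)) :=
    ((measurable_measure_Iic _).pow_const _).mul ((measurable_dualTail p v).pow_const _)
  rw [hardyInt, setLIntegral_tailMeasure hu hm hat]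
  simp_rw [tailMeasure_Iic, mul_right_comm]

lemma intConst_rpow {p r : ℝ} (hp : 1 < p) (hr : 0 < r) (u v : ℝ → ℝ≥0∞) (t : ℝ) :
    intConst p r u v t ^ r = intIoi (fun x => intIoo u t x ^ (r / (p - r)) * u x *
      dualTail p v x ^ ((p - 1) * r / (p - r))) t ^ ((p - r) / p) := by
  have : p ≠ 0 := by linarith
  rw [intConst, ← ENNReal.rpow_mul]
  congr 1
  field_simp

/-- In the case `r < p`, a Hardy inequality on `(t,∞)` with constant `c` bounds the integral
quantity: it is the limit of the finite quantities for truncations of `u`, to which the test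
functions apply. -/
lemma intConst_le (p r : ℝ) (hp : 1 < p) (hr : 0 < r) (hrp : r < p) :
    ∃ K : ℝ≥0, ∀ u v : ℝ → ℝ≥0∞, Measurable u → (∀ x, 0 < u x) → Measurable v →
      (∀ x, 0 < v x) → ∀ t c, (∀ h : ℝ → ℝ≥0∞, Measurable h →
        intIoi (fun x => intIoi h x ^ r * u x) t ^ (1 / r) ≤
          c * intIoi (fun x => h x ^ p * v x) t ^ (1 / p)) → intConst p r u v t ≤ K * c := by
  have hp0 : 0 < p := by linarith
  have hpr : 0 < p - r := sub_pos.2 hrp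
  have hp1 : 0 < p - 1 := by linarith
  have hp' := conjExponent_pos hp
  obtain ⟨K, hK⟩ := hardyInt_rpow_le p r hp hr hrp
  refine ⟨max (K ^ (1 / r)) 1, fun u v hu hu0 hv hv0 t c hc => ?_⟩
  rcases eq_or_ne c ∞ with rfl | hct
  · rw [ENNReal.mul_top]
    · exact le_top
    · exact (zero_lt_one.trans_le (ENNReal.coe_le_coe.2 (le_max_right _ _))).ne'
  have hV : ∀ x, t < x → dualTail p v x ≠ ∞ := by
    intro x hx htop
    have := rpow_mul_dualTail_le hp hr hu hv hx fun h hh _ _ => hc h hh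
    rw [htop, ENNReal.top_rpow_of_pos (by positivity), ENNReal.mul_top] at this
    · exact hct (top_le_iff.1 this)
    · exact (ENNReal.rpow_pos_of_nonneg (intIoo_pos hu hu0 hx) (by positivity)).ne'
  set f : ℕ → ℝ → ℝ≥0∞ := fun n => (Ioi (t + 1 / ((n : ℝ) + 1))).indicator (trunc u n) with hf
  have hfmeas : ∀ n, Measurable (f n) := fun n =>
    (measurable_trunc hu n).indicator measurableSet_Ioi
  have hfu : ∀ n x, f n x ≤ u x := fun n x =>
    (indicator_le_self _ _ _).trans (trunc_le u n x)
  have hfmono : Monotone f := by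
    intro m n hmn x
    have hsub : t + 1 / ((n : ℝ) + 1) ≤ t + 1 / ((m : ℝ) + 1) := by gcongr
    by_cases hx : x ∈ Ioi (t + 1 / ((m : ℝ) + 1))
    · have hx' : x ∈ Ioi (t + 1 / ((n : ℝ) + 1)) := hsub.trans_lt hx
      simp only [hf]
      rw [indicator_of_mem hx, indicator_of_mem hx']
      exact trunc_mono u hmn x
    · simp only [hf]
      rw [indicator_of_notMem hx]
      exact zero_le
  have hfsup : ∀ x, t < x → ⨆ n, f n x = u x := by
    intro x hx
    refine le_antisymm (iSup_le fun n => hfu n x) ?_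
    rw [← iSup_trunc u x]
    obtain ⟨N, hN⟩ := exists_nat_one_div_lt (sub_pos.2 hx)
    refine iSup_le fun n => le_trans ?_ (le_iSup _ (max n N))
    have hx' : x ∈ Ioi (t + 1 / (((max n N : ℕ) : ℝ) + 1)) := by
      have : 1 / (((max n N : ℕ) : ℝ) + 1) ≤ 1 / ((N : ℝ) + 1) := by
        gcongr
        exact le_max_right _ _
      rw [mem_Ioi]
      linarith
    simp only [hf]
    rw [indicator_of_mem hx']
    exact trunc_mono u (le_max_left _ _) x
  set ρ : ℕ → Measure ℝ := fun n => tailMeasure (f n) t with hρ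
  have hbound : ∀ n, hardyInt p r v (ρ n) t ^ ((p - r) / p) ≤ K * c ^ r := by
    intro n
    refine hK v hv hv0 (ρ n) (by simp only [hρ, tailMeasure]; infer_instance) t _
      (by rw [hρ, tailMeasure_Iic, intIoo_eq_zero _ le_rfl]) hV ?_ ?_
    · have hftop : intIoi (f n) t ≠ ∞ :=
        ne_top_of_le_ne_top (intIoi_trunc_ne_top u n t)
          (lintegral_mono fun x => indicator_le_self _ _ _)
      have hV' : dualTail p v (t + 1 / ((n : ℝ) + 1)) ≠ ∞ := hV _ (by
        have : (0 : ℝ) < 1 / ((n : ℝ) + 1) := by positivity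
        linarith)
      rw [hρ, hardyInt_tailMeasure (hfmeas n) le_rfl]
      have hle : intIoi (fun x => intIoo (f n) t x ^ (r / (p - r)) * f n x *
          dualTail p v x ^ ((p - 1) * r / (p - r))) t ≤
          ∫⁻ x in Ioi t, intIoi (f n) t ^ (r / (p - r)) *
            dualTail p v (t + 1 / ((n : ℝ) + 1)) ^ ((p - 1) * r / (p - r)) * f n x := by
        refine lintegral_mono fun x => ?_
        by_cases hx : x ∈ Ioi (t + 1 / ((n : ℝ) + 1))
        · beta_reduce
          rw [mul_right_comm]
          refine mul_le_mul_left (mul_le_mul' ?_ ?_) _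
          · exact ENNReal.rpow_le_rpow (lintegral_mono_set Ioo_subset_Ioi_self) (by positivity)
          · exact ENNReal.rpow_le_rpow (dualTail_anti p v (le_of_lt hx)) (by positivity)
        · have : f n x = 0 := indicator_of_notMem hx _
          simp [this]
      refine ne_top_of_le_ne_top ?_ hle
      rw [lintegral_const_mul _ (hfmeas n)]
      exact ENNReal.mul_ne_top (ENNReal.mul_ne_top
        (ENNReal.rpow_ne_top_of_nonneg (by positivity) hftop)
        (ENNReal.rpow_ne_top_of_nonneg (by positivity) hV')) hftop
    · set φ := testFun p r v (ρ n)
      have hφ : Measurable φ := measurable_testFun hv _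
      rw [hρ, setLIntegral_tailMeasure (hfmeas n) ((measurable_intIoi _).pow_const _) le_rfl]
      have h1 := ENNReal.rpow_le_rpow (hc φ hφ) hr.le
      rw [ENNReal.mul_rpow_of_nonneg _ _ hr.le, ← ENNReal.rpow_mul, ← ENNReal.rpow_mul,
        one_div_mul_cancel hr.ne', ENNReal.rpow_one, one_div_mul_eq_div] at h1
      refine le_trans (lintegral_mono fun x => ?_) h1
      exact mul_le_mul_right (hfu n x) _
  have hD : intIoi (fun x => intIoo u t x ^ (r / (p - r)) * u x *
      dualTail p v x ^ ((p - 1) * r / (p - r))) t = ⨆ n, hardyInt p r v (ρ n) t := by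
    have hI : ∀ x, ⨆ n, intIoo (f n) t x = intIoo u t x := by
      intro x
      simp only [intIoo]
      rw [← lintegral_iSup hfmeas hfmono]
      exact setLIntegral_congr_fun measurableSet_Ioo fun y hy => hfsup y hy.1
    have := setLIntegral_iSup_rpow_mul (S := Ioi t) (s := r / (p - r)) (by positivity)
      (F := fun n => intIoo (f n) t) (f := f)
      (Φ := fun x => dualTail p v x ^ ((p - 1) * r / (p - r)))
      (fun n => measurable_intIoo_right _ _)
      (fun m n hmn x => lintegral_mono fun y => hfmono hmn y) hfmeas hfmono
      ((measurable_dualTail p v).pow_const _)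
    simp_rw [hρ, fun n => hardyInt_tailMeasure (p := p) (r := r) (v := v) (hfmeas n) (le_refl t)]
    refine Eq.trans ?_ this
    refine setLIntegral_congr_fun measurableSet_Ioi fun x hx => ?_
    simp only [hI, hfsup x hx]
  have hr' : intConst p r u v t ^ r ≤ K * c ^ r := by
    rw [intConst_rpow hp hr, hD, iSup_rpow _ (by positivity)]
    exact iSup_le hbound
  have := ENNReal.rpow_le_rpow hr' (one_div_nonneg.2 hr.le)
  rw [← ENNReal.rpow_mul, mul_one_div_cancel hr.ne', ENNReal.rpow_one,
    ENNReal.mul_rpow_of_nonneg _ _ (by positivity), ← ENNReal.rpow_mul, mul_one_div_cancel hr.ne',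
    ENNReal.rpow_one] at this
  refine this.trans (mul_le_mul_left ?_ _)
  rw [← ENNReal.coe_rpow_of_nonneg _ (by positivity : 0 ≤ 1 / r)]
  exact ENNReal.coe_le_coe.2 (le_max_left _ _)

theorem exists_isHardyConst_intConst {p r : ℝ} (hp : 1 < p) (hr : 0 < r) (hrp : r < p) :
    ∃ K : ℝ≥0, ∀ u v : ℝ → ℝ≥0∞, Measurable u → (∀ x, 0 < u x) → Measurable v →
      (∀ x, 0 < v x) → IsHardyConst p r u v (intConst p r u v) K := by
  have hp0 : 0 < p := by linarith
  have hpr : 0 < p - r := sub_pos.2 hrp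
  obtain ⟨K, hK⟩ := intConst_le p r hp hr hrp
  refine ⟨max K (8 * 2 ^ (1 / r)), fun u v hu hu0 hv hv0 => ⟨intConst_anti hp hr hrp u v, ?_, ?_⟩⟩
  · intro t ht h hh hfin hN
    have h0 := intIoi_indicator' h ht.le
    have hNi := intIoi_indicator' (fun x => h x ^ p * v x) ht.le
    rw [← indicator_rpow_mul hp0] at hNi
    have := hardy_of_lt hp hr hrp hv hv0 (hh.indicator (measurableSet_Ioi (a := t)))
      (by rwa [h0]) (by rwa [hNi]) (tailMeasure u t)
    have hD := hardyInt_tailMeasure (p := p) (r := r) (v := v) hu ht.le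
    rw [hardyInt] at hD
    rw [setLIntegral_tailMeasure hu ((measurable_intIoi _).pow_const _) ht.le, hNi, hD,
      ← intConst_rpow hp hr] at this
    calc _ ≤ intIoi (fun x => intIoi ((Ioi t).indicator h) x ^ r * u x) t := by
          refine setLIntegral_mono' measurableSet_Ioi fun x hx => ?_
          rw [intIoi_indicator _ (le_of_lt hx)]
      _ ≤ _ := this
      _ = (((8 * 2 ^ (1 / r) : ℝ≥0) : ℝ≥0∞) * intConst p r u v t) ^ r *
            intIoi (fun x => h x ^ p * v x) t ^ (r / p) := by
          rw [ENNReal.mul_rpow_of_nonneg _ _ hr.le, ENNReal.coe_mul,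
            ENNReal.coe_rpow_of_nonneg _ (by positivity), ENNReal.mul_rpow_of_nonneg _ _ hr.le,
            ← ENNReal.rpow_mul, one_div_mul_cancel hr.ne', ENNReal.rpow_one]
          push_cast
          ring
      _ ≤ _ := by
          refine mul_le_mul_left (ENNReal.rpow_le_rpow (mul_le_mul_left ?_ _) hr.le) _
          exact ENNReal.coe_le_coe.2 (le_max_right _ _)
  · intro t ht c hc
    refine (hK u v hu hu0 hv hv0 t c hc).trans (mul_le_mul_left ?_ _)
    exact ENNReal.coe_le_coe.2 (le_max_left _ _)

/-! ### Geometric discretization of a weight -/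

lemma intIoi_eq_add (f : ℝ → ℝ≥0∞) {a b : ℝ} (h : a < b) :
    intIoi f a = intIoo f a b + intIoi f b := by
  rw [intIoi, ← Ioc_union_Ioi_eq_Ioi h.le, lintegral_union measurableSet_Ioi
    (Ioc_disjoint_Ioi le_rfl), setLIntegral_congr Ioo_ae_eq_Ioc.symm]
  rfl

lemma intIoo_eq_add (f : ℝ → ℝ≥0∞) {a b c : ℝ} (hab : a ≤ b) (hbc : b < c) :
    intIoo f a c = intIoo f a b + intIoo f b c := by
  rw [intIoo, ← Ioc_union_Ioo_eq_Ioo hab hbc, lintegral_union measurableSet_Ioo,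
    setLIntegral_congr Ioo_ae_eq_Ioc.symm]
  · rfl
  · exact Set.disjoint_left.2 fun t h1 h2 => absurd h2.1 (not_lt.2 h1.2)

/-- A sequence decreasing to `0` along which `∫_0^t w` decays geometrically with ratio `M`. -/
structure IsGeometric (w : ℝ → ℝ≥0∞) (M : ℝ≥0∞) (x : ℕ → ℝ) : Prop where
  anti : StrictAnti x
  pos : ∀ k, 0 < x k
  exists_lt : ∀ t, 0 < t → ∃ k, x k < t
  ne_top : ∀ k, intIoo w 0 (x k) ≠ ∞
  eq_mul : ∀ k, intIoo w 0 (x k) = M * intIoo w 0 (x (k + 1))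

lemma exists_isGeometric {w : ℝ → ℝ≥0∞} (hw : Measurable w) (hw0 : ∀ x, 0 < w x) {M : ℝ≥0∞}
    (hM : 1 < M) (hMt : M ≠ ∞) {T : ℝ} (hT : 0 < T) (hWT : intIoo w 0 T ≠ ∞) :
    ∃ x : ℕ → ℝ, x 0 = T ∧ IsGeometric w M x := by
  set L := intIoo w 0 T with hL
  have hL0 : 0 < L := intIoo_pos hw hw0 hT
  have hM0 : M ≠ 0 := (zero_lt_one.trans hM).ne'
  have hMi : M⁻¹ < 1 := ENNReal.inv_lt_one.2 hM
  have hMi0 : M⁻¹ ≠ 0 := ENNReal.inv_ne_zero.2 hMt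
  set c : ℕ → ℝ≥0∞ := fun k => L * M⁻¹ ^ k with hc
  have hc0 : ∀ k, 0 < c k := fun k => ENNReal.mul_pos hL0.ne' (pow_ne_zero _ hMi0)
  have hcL : ∀ k, c k ≤ L := fun k =>
    mul_le_of_le_one_right zero_le (pow_le_one₀ zero_le hMi.le)
  have hct : ∀ k, c k ≠ ∞ := fun k => ne_top_of_le_ne_top hWT (hcL k)
  have hcM : ∀ k, c k = M * c (k + 1) := fun k => by
    simp only [hc, pow_succ]
    rw [show M * (L * (M⁻¹ ^ k * M⁻¹)) = (M * M⁻¹) * (L * M⁻¹ ^ k) by ring,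
      ENNReal.mul_inv_cancel hM0 hMt, one_mul]
  have hcanti : ∀ k, c (k + 1) < c k := fun k => by
    rw [hcM k]
    calc c (k + 1) = 1 * c (k + 1) := (one_mul _).symm
      _ < M * c (k + 1) := ENNReal.mul_lt_mul_left (hc0 _).ne' (hct _) hM
  set η : Measure ℝ := (volume.restrict (Ioo 0 T)).withDensity w with hη
  have hηI : ∀ t, η (Iio t) = intIoo w 0 (min T t) := fun t => by
    rw [hη, withDensity_apply _ measurableSet_Iio, Measure.restrict_restrict measurableSet_Iio,
      inter_comm, Ioo_inter_Iio]; rfl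
  have hηfin : η univ ≠ ∞ := by
    rw [hη, withDensity_apply _ MeasurableSet.univ, Measure.restrict_univ]; exact hWT
  have hcont := continuous_measure_Iio η hηfin
  have hex : ∀ k, ∃ y, intIoo w 0 y = c k ∧ (k = 0 → y = T) := by
    intro k
    rcases Nat.eq_zero_or_pos k with rfl | hk
    · exact ⟨T, by simp [hc, hL], fun _ => rfl⟩
    · obtain ⟨y, hy⟩ := mem_range_of_exists_le_of_exists_ge (c := c k) hcont
        ⟨0, by rw [hηI, min_eq_right hT.le, intIoo_eq_zero _ le_rfl]; exact zero_le⟩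
        ⟨T, by rw [hηI, min_self]; exact hcL k⟩
      simp only [hηI] at hy
      exact ⟨min T y, hy, fun h => absurd h hk.ne'⟩
  choose x hx hx0 using hex
  refine ⟨x, hx0 0 rfl, ⟨strictAnti_nat_of_succ_lt fun k => ?_, fun k => ?_, fun t ht => ?_,
    fun k => hx k ▸ hct k, fun k => by rw [hx, hx]; exact hcM k⟩⟩
  · by_contra hcon
    have := intIoo_mono_right w 0 (not_lt.1 hcon)
    rw [hx, hx] at this
    exact absurd (hcanti k) (not_lt.2 this)
  · by_contra hcon
    have := hx k
    rw [intIoo_eq_zero _ (not_lt.1 hcon)] at this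
    exact (hc0 k).ne this
  · have hlim : Filter.Tendsto c Filter.atTop (nhds 0) := by
      have := ENNReal.Tendsto.const_mul (a := L)
        (ENNReal.tendsto_pow_atTop_nhds_zero_of_lt_one hMi) (.inr hWT)
      rwa [mul_zero] at this
    obtain ⟨k, hk⟩ := (hlim.eventually (gt_mem_nhds (intIoo_pos hw hw0 ht))).exists
    refine ⟨k, ?_⟩
    by_contra hcon
    have := intIoo_mono_right w 0 (not_lt.1 hcon)
    rw [hx] at this
    exact absurd hk (not_lt.2 this)

namespace IsGeometric

variable {w : ℝ → ℝ≥0∞} {M : ℝ≥0∞} {x : ℕ → ℝ}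

lemma shift (hx : IsGeometric w M x) (n : ℕ) : IsGeometric w M fun k => x (k + n) where
  anti := fun a b hab => hx.anti (Nat.add_lt_add_right hab n)
  pos := fun k => hx.pos _
  exists_lt := fun t ht => by
    obtain ⟨k, hk⟩ := hx.exists_lt t ht
    exact ⟨k, (hx.anti.antitone (Nat.le_add_right k n)).trans_lt hk⟩
  ne_top := fun k => hx.ne_top _
  eq_mul := fun k => by rw [hx.eq_mul (k + n), Nat.add_right_comm]

lemma lt_succ (hx : IsGeometric w M x) (k : ℕ) : x (k + 1) < x k := hx.anti (Nat.lt_succ_self k)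

lemma lintegral_le_tsum (hx : IsGeometric w M x) (f : ℝ → ℝ≥0∞) :
    ∫⁻ t in Ioo 0 (x 0), f t ≤ ∑' k, ∫⁻ t in Ioo (x (k + 1)) (x k), f t := by
  have hsub : Ioo 0 (x 0) ⊆ ⋃ k, Ioc (x (k + 1)) (x k) := by
    rintro t ⟨ht0, htx⟩
    classical
    have hex := hx.exists_lt t ht0
    have h1 := Nat.find_spec hex
    obtain ⟨j, hj⟩ : ∃ j, Nat.find hex = j + 1 := by
      refine Nat.exists_eq_succ_of_ne_zero fun h0 => ?_
      rw [h0] at h1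
      exact absurd h1 (not_lt.2 htx.le)
    have h2 := Nat.find_min hex (m := j) (by omega)
    rw [hj] at h1
    exact mem_iUnion.2 ⟨j, h1, not_lt.1 h2⟩
  calc _ ≤ ∫⁻ t in ⋃ k, Ioc (x (k + 1)) (x k), f t := lintegral_mono_set hsub
    _ ≤ ∑' k, ∫⁻ t in Ioc (x (k + 1)) (x k), f t := lintegral_iUnion_le _ _
    _ = _ := by
      congr 1; ext k
      exact setLIntegral_congr Ioo_ae_eq_Ioc.symm

lemma tsum_le_lintegral (hx : IsGeometric w M x) (f : ℝ → ℝ≥0∞) :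
    ∑' k, ∫⁻ t in Ioo (x (k + 1)) (x k), f t ≤ ∫⁻ t in Ioo 0 (x 0), f t := by
  have hd : Pairwise (Function.onFun Disjoint fun k => Ioo (x (k + 1)) (x k)) := by
    have := hx.anti.antitone.pairwise_disjoint_on_Ioc_succ
    exact fun i j hij => (this hij).mono Ioo_subset_Ioc_self Ioo_subset_Ioc_self
  rw [← lintegral_iUnion (fun _ => measurableSet_Ioo) hd]
  exact lintegral_mono_set (iUnion_subset fun k =>
    Ioo_subset_Ioo (hx.pos _).le (hx.anti.antitone (Nat.zero_le k)))

/-- For ratio at least `2`, the last interval carries at least half of the mass. -/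
lemma le_two_mul (hx : IsGeometric w M x) (hM : 2 ≤ M) (k : ℕ) :
    intIoo w 0 (x k) ≤ 2 * intIoo w (x (k + 1)) (x k) := by
  have h1 := intIoo_eq_add w (hx.pos _).le (hx.lt_succ k)
  have h2 : 2 * intIoo w 0 (x (k + 1)) ≤ intIoo w 0 (x k) := by
    rw [hx.eq_mul k]; gcongr
  have h3 : intIoo w 0 (x k) + 2 * intIoo w 0 (x (k + 1)) ≤
      2 * intIoo w (x (k + 1)) (x k) + 2 * intIoo w 0 (x (k + 1)) := by
    calc _ ≤ intIoo w 0 (x k) + intIoo w 0 (x k) := by gcongr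
      _ = 2 * intIoo w 0 (x k) := (two_mul _).symm
      _ = _ := by rw [h1]; ring
  exact (ENNReal.add_le_add_iff_right (ENNReal.mul_ne_top (by norm_num) (hx.ne_top _))).1 h3

end IsGeometric

/-- The purely atomic measure `∑ k, β k δ_{x k}`. -/
noncomputable def atomic (β : ℕ → ℝ≥0∞) (x : ℕ → ℝ) : Measure ℝ :=
  Measure.sum fun k => β k • Measure.dirac (x k)

instance (β : ℕ → ℝ≥0∞) (x : ℕ → ℝ) : SFinite (atomic β x) := by
  unfold atomic; infer_instance

lemma setLIntegral_atomic (β : ℕ → ℝ≥0∞) {x : ℕ → ℝ} (hx : ∀ k, 0 < x k) (f : ℝ → ℝ≥0∞) :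
    ∫⁻ t in Ioi 0, f t ∂(atomic β x) = ∑' k, β k * f (x k) := by
  rw [← lintegral_indicator measurableSet_Ioi, atomic, lintegral_sum_measure]
  congr 1; ext k
  rw [lintegral_smul_measure, lintegral_dirac, indicator_of_mem (show x k ∈ Ioi 0 from hx k)]
  rfl

lemma atomic_apply (β : ℕ → ℝ≥0∞) (x : ℕ → ℝ) {S : Set ℝ} (hS : MeasurableSet S) :
    atomic β x S = ∑' k, β k * S.indicator 1 (x k) := by
  rw [atomic, Measure.sum_apply _ hS]
  congr 1; ext k
  rw [Measure.smul_apply, Measure.dirac_apply' _ hS]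
  rfl

lemma atomic_Iic_zero (β : ℕ → ℝ≥0∞) {x : ℕ → ℝ} (hx : ∀ k, 0 < x k) :
    atomic β x (Iic 0) = 0 := by
  rw [atomic_apply _ _ measurableSet_Iic, ENNReal.tsum_eq_zero]
  intro k
  rw [indicator_of_notMem (show x k ∉ Iic 0 from not_le.2 (hx k)), mul_zero]

lemma atomic_Iic (β : ℕ → ℝ≥0∞) {x : ℕ → ℝ} (hx : StrictAnti x) (k : ℕ) :
    atomic β x (Iic (x k)) = ∑' j, β (j + k) := by
  rw [atomic_apply _ _ measurableSet_Iic,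
    ← Summable.sum_add_tsum_nat_add' (k := k) ENNReal.summable]
  have h0 : ∑ j ∈ Finset.range k, β j * (Iic (x k)).indicator (1 : ℝ → ℝ≥0∞) (x j) = 0 := by
    refine Finset.sum_eq_zero fun j hj => ?_
    rw [indicator_of_notMem, mul_zero]
    exact not_le.2 (hx (Finset.mem_range.1 hj))
  rw [h0, zero_add]
  congr 1; ext j
  rw [indicator_of_mem, Pi.one_apply, mul_one]
  exact hx.antitone (Nat.le_add_left k j)

lemma atomic_Iic_succ (β : ℕ → ℝ≥0∞) {x : ℕ → ℝ} (hx : StrictAnti x) (k : ℕ) :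
    atomic β x (Iic (x k)) = β k + atomic β x (Iic (x (k + 1))) := by
  rw [atomic_Iic β hx, atomic_Iic β hx, tsum_eq_zero_add' ENNReal.summable, zero_add]
  congr 1
  exact tsum_congr fun j => by rw [Nat.add_assoc, Nat.add_comm 1 k]

/-! ### The discretized inequality -/

/-- The `q`-th power of the left-hand side of the iterated inequality. -/
noncomputable def lhsInt (q r : ℝ) (u w h : ℝ → ℝ≥0∞) : ℝ≥0∞ :=
  intIoi (fun x => (intIoi (fun t => intIoi h t ^ r * u t) x) ^ (q / r) * w x) 0

/-- `∫_0^t w(s) (∫_s^t u)^{q/r} ds`. -/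
noncomputable def accum (q r : ℝ) (u w : ℝ → ℝ≥0∞) (t : ℝ) : ℝ≥0∞ :=
  intIoo (fun s => w s * intIoo u s t ^ (q / r)) 0 t

lemma accum_mono {q r : ℝ} (hq : 0 < q) (hr : 0 < r) (u w : ℝ → ℝ≥0∞) :
    Monotone (accum q r u w) := by
  intro a b hab
  refine le_trans (lintegral_mono fun s => ?_) (lintegral_mono_set (Ioo_subset_Ioo_right hab))
  exact mul_le_mul_right (ENNReal.rpow_le_rpow (intIoo_mono_right u s hab) (by positivity)) _

lemma one_lt_two_rpow {s : ℝ} (hs : 0 < s) : (1 : ℝ≥0∞) < 2 ^ s :=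
  ENNReal.one_lt_rpow (by norm_num) hs

lemma two_le_two_rpow {s : ℝ} (hs : 0 ≤ s) : (2 : ℝ≥0∞) ≤ 2 ^ (s + 1) := by
  conv_lhs => rw [← ENNReal.rpow_one 2]
  exact ENNReal.rpow_le_rpow_of_exponent_le (by norm_num) (by linarith)

lemma two_rpow_ne_top {s : ℝ} (hs : 0 ≤ s) : (2 : ℝ≥0∞) ^ s ≠ ∞ :=
  ENNReal.rpow_ne_top_of_nonneg hs (by norm_num)

/-- Along a geometric sequence for `w` the iterated inequality splits into a local part, which
involves `h` only between consecutive points, and a discrete Hardy inequality. -/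
lemma lhsInt_le_add {q r : ℝ} (hq : 0 < q) (hr : 0 < r) {u w h : ℝ → ℝ≥0∞} (hu : Measurable u)
    (hw : Measurable w) {x : ℕ → ℝ} (hx : IsGeometric w (2 ^ (q / r + 1)) x)
    (hT : intIoi h (x 0) = 0) :
    lhsInt q r u w h ≤ 2 ^ (q / r + 1) * (2 ^ q * 2 ^ (q / r)) *
      ((∑' k, intIoo w 0 (x k) * intIoi (fun t => intIoi ((Iio (x k)).indicator h) t ^ r * u t)
          (x (k + 1)) ^ (q / r)) +
        ∑' k, (intIoo w 0 (x k) * intIoo u (x (k + 1)) (x k) ^ (q / r)) * intIoi h (x k) ^ q) := by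
  have hθ : 0 < q / r := by positivity
  set f : ℝ → ℝ≥0∞ := fun t => intIoi h t ^ r * u t with hf
  set g : ℕ → ℝ≥0∞ := fun k => intIoo f (x (k + 1)) (x k) with hg
  set loc : ℕ → ℝ≥0∞ := fun k =>
    intIoi (fun t => intIoi ((Iio (x k)).indicator h) t ^ r * u t) (x (k + 1)) with hloc
  have hGT : ∀ t, x 0 ≤ t → intIoi f t = 0 := by
    intro t ht
    have : ∀ s ∈ Ioi t, f s = 0 := fun s hs => by
      have : intIoi h s = 0 :=
        le_antisymm (hT ▸ intIoi_anti h (ht.trans (le_of_lt hs))) zero_le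
      simp only [hf]
      rw [this, ENNReal.zero_rpow_of_pos hr, zero_mul]
    rw [intIoi, setLIntegral_congr_fun measurableSet_Ioi this]; simp
  have hG : ∀ k, intIoi f (x (k + 1)) = ∑ j ∈ Finset.range (k + 1), g j := by
    intro k
    induction k with
    | zero =>
      rw [intIoi_eq_add f (hx.lt_succ 0), hGT _ le_rfl]; simp [hg]
    | succ k ih =>
      rw [intIoi_eq_add f (hx.lt_succ (k + 1)), ih, Finset.sum_range_succ _ (k + 1), add_comm]
  have h1 : lhsInt q r u w h ≤
      ∑' k, intIoo w 0 (x k) * (∑ j ∈ Finset.range (k + 1), g j) ^ (q / r) := by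
    have e1 : lhsInt q r u w h ≤ ∫⁻ t in Ioo 0 (x 0), intIoi f t ^ (q / r) * w t := by
      rw [lhsInt, intIoi_eq_add _ (hx.pos 0)]
      have : intIoi (fun t => intIoi f t ^ (q / r) * w t) (x 0) = 0 := by
        have : ∀ s ∈ Ioi (x 0), intIoi f s ^ (q / r) * w s = 0 := fun s hs => by
          rw [hGT s (le_of_lt hs), ENNReal.zero_rpow_of_pos hθ, zero_mul]
        rw [intIoi, setLIntegral_congr_fun measurableSet_Ioi this]; simp
      rw [this, add_zero]; rfl
    refine e1.trans ((hx.lintegral_le_tsum _).trans (ENNReal.tsum_le_tsum fun k => ?_))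
    calc _ ≤ ∫⁻ t in Ioo (x (k + 1)) (x k), intIoi f (x (k + 1)) ^ (q / r) * w t := by
          refine setLIntegral_mono' measurableSet_Ioo fun t ht => ?_
          exact mul_le_mul_left (ENNReal.rpow_le_rpow (intIoi_anti f ht.1.le) hθ.le) _
      _ ≤ intIoi f (x (k + 1)) ^ (q / r) * intIoo w 0 (x k) := by
          rw [lintegral_const_mul _ hw]
          exact mul_le_mul_right (lintegral_mono_set (Ioo_subset_Ioo_left (hx.pos _).le)) _
      _ = _ := by rw [hG, mul_comm]
  have h2 := tsum_mul_partialSum_rpow_le hθ.le (fun k => intIoo w 0 (x k)) g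
    (fun k => (hx.eq_mul k).ge)
  have h3 : ∀ k, g k ≤ 2 ^ r * (loc k + intIoi h (x k) ^ r * intIoo u (x (k + 1)) (x k)) := by
    intro k
    have hpt : ∀ t ∈ Ioo (x (k + 1)) (x k), f t ≤
        2 ^ r * (intIoi ((Iio (x k)).indicator h) t ^ r * u t + intIoi h (x k) ^ r * u t) := by
      intro t ht
      have e : intIoi h t = intIoi ((Iio (x k)).indicator h) t + intIoi h (x k) := by
        rw [intIoi_eq_add h ht.2]
        congr 1
        rw [intIoi, setLIntegral_indicator measurableSet_Iio, inter_comm, Ioi_inter_Iio]; rfl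
      calc f t ≤ (2 ^ r * (intIoi ((Iio (x k)).indicator h) t ^ r + intIoi h (x k) ^ r)) * u t := by
            simp only [hf]
            rw [e]
            exact mul_le_mul_left (add_rpow_le hr.le _ _) _
        _ = _ := by ring
    have hm : Measurable fun t => intIoi ((Iio (x k)).indicator h) t ^ r * u t :=
      ((measurable_intIoi _).pow_const _).mul hu
    calc g k ≤ ∫⁻ t in Ioo (x (k + 1)) (x k), 2 ^ r *
          (intIoi ((Iio (x k)).indicator h) t ^ r * u t + intIoi h (x k) ^ r * u t) :=
          setLIntegral_mono' measurableSet_Ioo hpt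
      _ = 2 ^ r * (intIoo (fun t => intIoi ((Iio (x k)).indicator h) t ^ r * u t)
            (x (k + 1)) (x k) + intIoi h (x k) ^ r * intIoo u (x (k + 1)) (x k)) := by
          rw [lintegral_const_mul' _ _ (two_rpow_ne_top hr.le), lintegral_add_left hm,
            lintegral_const_mul _ hu]
          rfl
      _ ≤ _ := by
          gcongr
          exact lintegral_mono_set Ioo_subset_Ioi_self
  have h4 : ∀ k, intIoo w 0 (x k) * g k ^ (q / r) ≤ (2 ^ q * 2 ^ (q / r)) *
      (intIoo w 0 (x k) * loc k ^ (q / r) +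
        (intIoo w 0 (x k) * intIoo u (x (k + 1)) (x k) ^ (q / r)) * intIoi h (x k) ^ q) := by
    intro k
    have hrq : r * (q / r) = q := by field_simp
    calc _ ≤ intIoo w 0 (x k) * (2 ^ r * (loc k +
            intIoi h (x k) ^ r * intIoo u (x (k + 1)) (x k))) ^ (q / r) :=
          mul_le_mul_right (ENNReal.rpow_le_rpow (h3 k) hθ.le) _
      _ ≤ intIoo w 0 (x k) * (2 ^ q * (2 ^ (q / r) * (loc k ^ (q / r) +
            intIoi h (x k) ^ q * intIoo u (x (k + 1)) (x k) ^ (q / r)))) := by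
          refine mul_le_mul_right ?_ _
          rw [ENNReal.mul_rpow_of_nonneg _ _ hθ.le, ← ENNReal.rpow_mul, hrq]
          refine mul_le_mul_right ((add_rpow_le hθ.le _ _).trans (le_of_eq ?_)) _
          rw [ENNReal.mul_rpow_of_nonneg _ _ hθ.le, ← ENNReal.rpow_mul, hrq]
      _ = _ := by ring
  calc lhsInt q r u w h ≤ _ := h1
    _ ≤ _ := h2
    _ ≤ 2 ^ (q / r + 1) * ∑' k, (2 ^ q * 2 ^ (q / r)) *
      (intIoo w 0 (x k) * loc k ^ (q / r) +
        (intIoo w 0 (x k) * intIoo u (x (k + 1)) (x k) ^ (q / r)) * intIoi h (x k) ^ q) :=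
        mul_le_mul_right (ENNReal.tsum_le_tsum h4) _
    _ = _ := by rw [ENNReal.tsum_mul_left, ENNReal.tsum_add, ← mul_assoc]

/-! ### Sufficiency: the local part -/

lemma local_term_le {p q r : ℝ} (hp : 1 < p) (hq : 0 < q) (hr : 0 < r)
    {u v w h S : ℝ → ℝ≥0∞} {K : ℝ≥0} (hS : IsHardyConst p r u v S K) (hh : Measurable h)
    (hfin : intIoi h 0 ≠ ∞) (hN : intIoi (fun x => h x ^ p * v x) 0 ≠ ∞)
    {M : ℝ≥0∞} {x : ℕ → ℝ} (hx : IsGeometric w M x) (k : ℕ) :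
    intIoo w 0 (x k) * intIoi (fun t => intIoi ((Iio (x k)).indicator h) t ^ r * u t)
      (x (k + 1)) ^ (q / r) ≤
    (K : ℝ≥0∞) ^ q * ((intIoo w 0 (x k) * S (x (k + 1)) ^ q) *
      intIoo (fun x => h x ^ p * v x) (x (k + 1)) (x k) ^ (q / p)) := by
  have hp0 : 0 < p := by linarith
  have hN' : intIoi (fun y => (Iio (x k)).indicator h y ^ p * v y) (x (k + 1)) =
      intIoo (fun x => h x ^ p * v x) (x (k + 1)) (x k) := by
    rw [indicator_rpow_mul hp0, intIoi, setLIntegral_indicator measurableSet_Iio, inter_comm,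
      Ioi_inter_Iio]; rfl
  have hpos := (hx.pos (k + 1)).le
  have h1 := hS.upper (x (k + 1)) (hx.pos _) _ (hh.indicator (measurableSet_Iio (a := x k)))
    (ne_top_of_le_ne_top hfin ((lintegral_mono fun y => indicator_le_self _ _ _).trans
      (lintegral_mono_set (Ioi_subset_Ioi hpos))))
    (by
      rw [hN']
      exact ne_top_of_le_ne_top hN (lintegral_mono_set fun y hy => hpos.trans_lt hy.1))
  rw [hN'] at h1
  have h2 := ENNReal.rpow_le_rpow h1 (show 0 ≤ q / r by positivity)
  rw [ENNReal.mul_rpow_of_nonneg _ _ (by positivity), ← ENNReal.rpow_mul, ← ENNReal.rpow_mul,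
    show r * (q / r) = q by field_simp, show r / p * (q / r) = q / p by field_simp,
    ENNReal.mul_rpow_of_nonneg _ _ hq.le] at h2
  calc _ ≤ intIoo w 0 (x k) * _ := mul_le_mul_right h2 _
    _ = _ := by ring

lemma tsum_intIoo_le {w : ℝ → ℝ≥0∞} {M : ℝ≥0∞} {x : ℕ → ℝ} (hx : IsGeometric w M x)
    (f : ℝ → ℝ≥0∞) : ∑' k, intIoo f (x (k + 1)) (x k) ≤ intIoi f 0 :=
  (hx.tsum_le_lintegral f).trans (lintegral_mono_set Ioo_subset_Ioi_self)

lemma tsum_local_le_of_le {p q r : ℝ} (hp : 1 < p) (hpq : p ≤ q) (hr : 0 < r)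
    {u v w h S : ℝ → ℝ≥0∞} {K : ℝ≥0} (hS : IsHardyConst p r u v S K) (hh : Measurable h)
    (hfin : intIoi h 0 ≠ ∞) (hN : intIoi (fun x => h x ^ p * v x) 0 ≠ ∞)
    {M : ℝ≥0∞} {x : ℕ → ℝ} (hx : IsGeometric w M x) {Λ : ℝ≥0∞}
    (hΛ : ∀ k, intIoo w 0 (x k) * S (x (k + 1)) ^ q ≤ Λ) :
    ∑' k, intIoo w 0 (x k) * intIoi (fun t => intIoi ((Iio (x k)).indicator h) t ^ r * u t)
      (x (k + 1)) ^ (q / r) ≤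
    (K : ℝ≥0∞) ^ q * (Λ * intIoi (fun x => h x ^ p * v x) 0 ^ (q / p)) := by
  have hp0 : 0 < p := by linarith
  have hq : 0 < q := by linarith
  calc _ ≤ ∑' k, (K : ℝ≥0∞) ^ q * (Λ *
        intIoo (fun x => h x ^ p * v x) (x (k + 1)) (x k) ^ (q / p)) := by
        refine ENNReal.tsum_le_tsum fun k => ?_
        refine (local_term_le hp hq hr hS hh hfin hN hx k).trans ?_
        exact mul_le_mul_right (mul_le_mul_left (hΛ k) _) _
    _ = (K : ℝ≥0∞) ^ q * (Λ *
        ∑' k, intIoo (fun x => h x ^ p * v x) (x (k + 1)) (x k) ^ (q / p)) := by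
        rw [ENNReal.tsum_mul_left, ENNReal.tsum_mul_left]
    _ ≤ _ := by
        refine mul_le_mul_right (mul_le_mul_right ?_ _) _
        refine (tsum_rpow_le ((one_le_div hp0).2 hpq) _).trans ?_
        exact ENNReal.rpow_le_rpow (tsum_intIoo_le hx _) (by positivity)

lemma tsum_local_le_of_lt {p q r : ℝ} (hp : 1 < p) (hq : 0 < q) (hqp : q < p) (hr : 0 < r)
    {u v w h S : ℝ → ℝ≥0∞} {K : ℝ≥0} (hS : IsHardyConst p r u v S K) (hh : Measurable h)
    (hfin : intIoi h 0 ≠ ∞) (hN : intIoi (fun x => h x ^ p * v x) 0 ≠ ∞)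
    {M : ℝ≥0∞} {x : ℕ → ℝ} (hx : IsGeometric w M x) :
    ∑' k, intIoo w 0 (x k) * intIoi (fun t => intIoi ((Iio (x k)).indicator h) t ^ r * u t)
      (x (k + 1)) ^ (q / r) ≤
    (K : ℝ≥0∞) ^ q * ((∑' k, intIoo w 0 (x k) ^ (p / (p - q)) *
      S (x (k + 1)) ^ (p * q / (p - q))) ^ ((p - q) / p) *
        intIoi (fun x => h x ^ p * v x) 0 ^ (q / p)) := by
  have hp0 : 0 < p := by linarith
  have hpq : 0 < p - q := sub_pos.2 hqp
  calc _ ≤ ∑' k, (K : ℝ≥0∞) ^ q * ((intIoo w 0 (x k) * S (x (k + 1)) ^ q) *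
        intIoo (fun x => h x ^ p * v x) (x (k + 1)) (x k) ^ (q / p)) :=
        ENNReal.tsum_le_tsum fun k => local_term_le hp hq hr hS hh hfin hN hx k
    _ = (K : ℝ≥0∞) ^ q * ∑' k, (intIoo w 0 (x k) * S (x (k + 1)) ^ q) *
        intIoo (fun x => h x ^ p * v x) (x (k + 1)) (x k) ^ (q / p) := ENNReal.tsum_mul_left
    _ ≤ _ := by
        refine mul_le_mul_right ((tsum_mul_rpow_le hq hqp _ _).trans (mul_le_mul' (le_of_eq ?_) ?_))
          _
        · congr 2; ext k
          rw [ENNReal.mul_rpow_of_nonneg _ _ (by positivity), ← ENNReal.rpow_mul]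
          congr 2; ring
        · exact ENNReal.rpow_le_rpow (tsum_intIoo_le hx _) (by positivity)

/-! ### Comparison of the discrete quantities with integrals -/

/-- `∫_0^∞ (∫_0^t w)^{q/(p-q)} w(t) S(t)^{pq/(p-q)} dt`. -/
noncomputable def weightInt (p q : ℝ) (w S : ℝ → ℝ≥0∞) : ℝ≥0∞ :=
  intIoi (fun t => intIoo w 0 t ^ (q / (p - q)) * w t * S t ^ (p * q / (p - q))) 0

/-- `ess sup_{x > t} (∫_t^x u)^{q/r} V(x)^{(p-1)q/(p-q)}`. -/
noncomputable def supPsi (p q r : ℝ) (u v : ℝ → ℝ≥0∞) (t : ℝ) : ℝ≥0∞ :=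
  essSupIoi (fun x => intIoo u t x ^ (q / r) * dualTail p v x ^ ((p - 1) * q / (p - q))) t

/-- `∫_0^∞ A(t)^{q/(p-q)} w(t) Ψ(t) dt` with `A = accum` and `Ψ = supPsi`. -/
noncomputable def accumInt (p q r : ℝ) (u v w : ℝ → ℝ≥0∞) : ℝ≥0∞ :=
  intIoi (fun t => accum q r u w t ^ (q / (p - q)) * w t * supPsi p q r u v t) 0

lemma supPsi_anti {p q r : ℝ} (hq : 0 < q) (hr : 0 < r) (u v : ℝ → ℝ≥0∞) :
    Antitone (supPsi p q r u v) := by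
  intro s t hst
  refine le_trans (essSupIoi_mono (fun x => ?_) t) (essSupIoi_mono_set _ hst)
  exact mul_le_mul_left (ENNReal.rpow_le_rpow (intIoo_anti_left u x hst) (by positivity)) _

lemma le_supPsi {p q r : ℝ} (hp : 1 < p) (hq : 0 < q) (hqp : q < p) (hr : 0 < r)
    (u v : ℝ → ℝ≥0∞) (t x : ℝ) :
    intIoo u t x ^ (q / r) * dualTail p v x ^ ((p - 1) * q / (p - q)) ≤ supPsi p q r u v t := by
  have hp1 : 0 < p - 1 := by linarith
  have hpq : 0 < p - q := by linarith
  exact rpow_mul_rpow_le_of_ae_le (by positivity) (by positivity) (intIoo_mono_right u t)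
    (fun x c hc => exists_lt_intIoo hc) (dualTail_anti p v) (ENNReal.ae_le_essSup _) x

section Compare

variable {w : ℝ → ℝ≥0∞} {M : ℝ≥0∞} {x : ℕ → ℝ}

lemma IsGeometric.le_mul_succ (hx : IsGeometric w M x) (hM : 2 ≤ M) (k : ℕ) :
    intIoo w 0 (x k) ≤ 2 * M * intIoo w (x (k + 2)) (x (k + 1)) := by
  rw [hx.eq_mul k, mul_comm 2 M, mul_assoc]
  exact mul_le_mul_right (hx.le_two_mul hM (k + 1)) _

lemma IsGeometric.le_sq_mul (hx : IsGeometric w M x) (k : ℕ) {t : ℝ} (ht : x (k + 2) ≤ t) :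
    intIoo w 0 (x k) ≤ M * M * intIoo w 0 t := by
  rw [hx.eq_mul k, hx.eq_mul (k + 1), ← mul_assoc]
  exact mul_le_mul_right (intIoo_mono_right w 0 ht) _

/-- Integrals over consecutive intervals dominate the values of a product of increasing and
decreasing functions at the end points. -/
lemma mul_intIoo_le (hw : Measurable w) {F Φ : ℝ → ℝ≥0∞} (hF : Monotone F) (hΦ : Antitone Φ)
    {s : ℝ} (hs : 0 ≤ s) (a b : ℝ) :
    F a ^ s * intIoo w a b * Φ b ≤ intIoo (fun t => F t ^ s * w t * Φ t) a b := by
  have : F a ^ s * intIoo w a b * Φ b = ∫⁻ t in Ioo a b, F a ^ s * Φ b * w t := by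
    rw [lintegral_const_mul _ hw, mul_right_comm]; rfl
  rw [this]
  refine setLIntegral_mono' measurableSet_Ioo fun t ht => ?_
  rw [mul_right_comm]
  exact mul_le_mul' (mul_le_mul_left (ENNReal.rpow_le_rpow (hF ht.1.le) hs) _) (hΦ ht.2.le)

lemma tsum_weight_le {p q : ℝ} (hp : 1 < p) (hq : 0 < q) (hqp : q < p) {S : ℝ → ℝ≥0∞}
    (hw : Measurable w) (hS : Antitone S) (hx : IsGeometric w M x) (hM : 2 ≤ M) :
    ∑' k, intIoo w 0 (x k) ^ (p / (p - q)) * S (x (k + 1)) ^ (p * q / (p - q)) ≤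
      (M * M) ^ (q / (p - q)) * (2 * M) * weightInt p q w S := by
  have hpq : 0 < p - q := by linarith
  have hp0 : 0 < p := by linarith
  have hΦ : Antitone fun t => S t ^ (p * q / (p - q)) := fun a b hab =>
    ENNReal.rpow_le_rpow (hS hab) (by positivity)
  have hterm : ∀ k, intIoo w 0 (x k) ^ (p / (p - q)) * S (x (k + 1)) ^ (p * q / (p - q)) ≤
      (M * M) ^ (q / (p - q)) * (2 * M) *
        intIoo (fun t => intIoo w 0 t ^ (q / (p - q)) * w t * S t ^ (p * q / (p - q)))
          (x (k + 1 + 1)) (x (k + 1)) := by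
    intro k
    have h1 := mul_intIoo_le hw (intIoo_mono_right w 0) hΦ (show 0 ≤ q / (p - q) by positivity)
      (x (k + 2)) (x (k + 1))
    refine le_trans ?_ (mul_le_mul_right h1 _)
    rw [show p / (p - q) = q / (p - q) + 1 by field_simp; ring,
      ENNReal.rpow_add_of_nonneg _ _ (by positivity) zero_le_one, ENNReal.rpow_one]
    calc _ ≤ (M * M * intIoo w 0 (x (k + 2))) ^ (q / (p - q)) *
          (2 * M * intIoo w (x (k + 2)) (x (k + 1))) * S (x (k + 1)) ^ (p * q / (p - q)) := by
          refine mul_le_mul_left (mul_le_mul' ?_ (hx.le_mul_succ hM k)) _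
          exact ENNReal.rpow_le_rpow (hx.le_sq_mul k le_rfl) (by positivity)
      _ = _ := by
          rw [ENNReal.mul_rpow_of_nonneg _ _ (show 0 ≤ q / (p - q) by positivity)]
          ring
  calc _ ≤ _ := ENNReal.tsum_le_tsum hterm
    _ ≤ _ := by
      rw [ENNReal.tsum_mul_left]
      exact mul_le_mul_right (tsum_intIoo_le (hx.shift 1) _) _

/-- The discrete masses of the nonlocal part. -/
noncomputable def blockMass (q r : ℝ) (u w : ℝ → ℝ≥0∞) (x : ℕ → ℝ) (k : ℕ) : ℝ≥0∞ :=
  intIoo w 0 (x k) * intIoo u (x (k + 1)) (x k) ^ (q / r)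

lemma atomic_blockMass_Iic_le {q r : ℝ} (hq : 0 < q) (hr : 0 < r) {u : ℝ → ℝ≥0∞}
    (hw : Measurable w) (hx : IsGeometric w M x) (hM : 2 ≤ M) (t : ℝ) :
    atomic (blockMass q r u w x) x (Iic t) ≤ 2 * M * accum q r u w t := by
  rw [atomic_apply _ _ measurableSet_Iic]
  have hterm : ∀ k, blockMass q r u w x k * (Iic t).indicator 1 (x k) ≤ 2 * M *
      intIoo ((Ioo 0 t).indicator fun s => w s * intIoo u s t ^ (q / r))
        (x (k + 1 + 1)) (x (k + 1)) := by
    intro k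
    by_cases hk : x k ≤ t
    · rw [indicator_of_mem (show x k ∈ Iic t from hk), Pi.one_apply, mul_one]
      calc blockMass q r u w x k ≤ 2 * M * intIoo w (x (k + 2)) (x (k + 1)) *
            intIoo u (x (k + 1)) (x k) ^ (q / r) := mul_le_mul_left (hx.le_mul_succ hM k) _
        _ = 2 * M * ∫⁻ s in Ioo (x (k + 2)) (x (k + 1)),
              w s * intIoo u (x (k + 1)) (x k) ^ (q / r) := by
            rw [lintegral_mul_const _ hw, mul_assoc]; rfl
        _ ≤ _ := by
            refine mul_le_mul_right (setLIntegral_mono' measurableSet_Ioo fun s hs => ?_) _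
            have hst : s ∈ Ioo 0 t := ⟨(hx.pos _).trans hs.1,
              hs.2.trans ((hx.lt_succ k).trans_le hk)⟩
            rw [indicator_of_mem hst]
            refine mul_le_mul_right (ENNReal.rpow_le_rpow ?_ (by positivity)) _
            exact lintegral_mono_set (Ioo_subset_Ioo hs.2.le hk)
    · rw [indicator_of_notMem (show x k ∉ Iic t from hk), mul_zero]
      exact zero_le
  calc _ ≤ _ := ENNReal.tsum_le_tsum hterm
    _ ≤ _ := by
      rw [ENNReal.tsum_mul_left]
      refine mul_le_mul_right ((tsum_intIoo_le (hx.shift 1) _).trans ?_) _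
      rw [intIoi, setLIntegral_indicator measurableSet_Ioo, inter_eq_left.2 Ioo_subset_Ioi_self]
      exact le_rfl

/-- The characterizing quantity of the discrete Hardy inequality is controlled by the two integral
quantities of the iterated inequality. -/
lemma hardyInt_atomic_le {p q r : ℝ} (hp : 1 < p) (hq : 0 < q) (hqp : q < p) (hr : 0 < r)
    {u v S : ℝ → ℝ≥0∞} {K : ℝ≥0} (hS : IsHardyConst p r u v S K) (hu : Measurable u)
    (hv : Measurable v) (hw : Measurable w) (hx : IsGeometric w M x) (hM : 2 ≤ M) :
    hardyInt p q v (atomic (blockMass q r u w x) x) 0 ≤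
      2 ^ (q / (p - q)) * (2 ^ (q / (p - q)) * (K ^ (p * q / (p - q)) *
        (M ^ (p / (p - q)) * ((M * M) ^ (q / (p - q)) * (2 * M) * weightInt p q w S))) +
          (2 * M) ^ (q / (p - q)) * (2 * M * accumInt p q r u v w)) := by
  have hpq : 0 < p - q := by linarith
  have hp0 : 0 < p := by linarith
  have hp1 : 0 < p - 1 := by linarith
  have ha : 0 ≤ q / (p - q) := by positivity
  set a := q / (p - q) with ha_def
  set σ := (p - 1) * q / (p - q) with hσ
  set β := blockMass q r u w x with hβ
  have hae : a + 1 = p / (p - q) := by rw [ha_def]; field_simp; ring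
  rw [hardyInt, setLIntegral_atomic _ hx.pos]
  set W : ℕ → ℝ≥0∞ := fun k => intIoo w 0 (x k) with hW
  -- the mass to the left of `x k` consists of two neighbouring blocks and of the mass up to
  -- `x (k + 2)`
  have hB : ∀ k, atomic β x (Iic (x k)) ≤
      2 * (W k * intIoo u (x (k + 2)) (x k) ^ (q / r)) + 2 * M * accum q r u w (x (k + 2)) := by
    intro k
    have h1 : atomic β x (Iic (x k)) = β k + β (k + 1) + atomic β x (Iic (x (k + 2))) := by
      rw [atomic_Iic_succ β hx.anti, atomic_Iic_succ β hx.anti (k + 1), ← add_assoc]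
    have h2 : β k ≤ W k * intIoo u (x (k + 2)) (x k) ^ (q / r) := by
      refine mul_le_mul_right (ENNReal.rpow_le_rpow ?_ (by positivity)) _
      exact intIoo_anti_left u _ (hx.lt_succ (k + 1)).le
    have h3 : β (k + 1) ≤ W k * intIoo u (x (k + 2)) (x k) ^ (q / r) := by
      refine mul_le_mul' (intIoo_mono_right w 0 (hx.lt_succ k).le)
        (ENNReal.rpow_le_rpow ?_ (by positivity))
      exact intIoo_mono_right u _ (hx.lt_succ k).le
    rw [h1, two_mul]
    exact add_le_add (add_le_add h2 h3) (atomic_blockMass_Iic_le hq hr hw hx hM _)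
  have hfirst : ∀ k, (W k * intIoo u (x (k + 2)) (x k) ^ (q / r)) ^ a *
      (β k * dualTail p v (x k) ^ σ) ≤ K ^ (p * q / (p - q)) *
        (M ^ (p / (p - q)) * (W (k + 1) ^ (p / (p - q)) * S (x (k + 2)) ^ (p * q / (p - q)))) := by
    intro k
    have hUV := ENNReal.rpow_le_rpow (hS.rpow_mul_rpow_le hp hr hu hv (hx.pos (k + 2))
      ((hx.lt_succ (k + 1)).trans (hx.lt_succ k))) (show 0 ≤ p * q / (p - q) by positivity)
    have e1 : 1 / r * (p * q / (p - q)) = q / r * (p / (p - q)) := by field_simp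
    have e2 : 1 / p.conjExponent * (p * q / (p - q)) = σ := by
      rw [Real.conjExponent, hσ]; field_simp
    rw [ENNReal.mul_rpow_of_nonneg _ _ (by positivity), ENNReal.mul_rpow_of_nonneg _ _
      (by positivity), ← ENNReal.rpow_mul, ← ENNReal.rpow_mul, e1, e2] at hUV
    have hβ' : β k ≤ W k * intIoo u (x (k + 2)) (x k) ^ (q / r) := by
      refine mul_le_mul_right (ENNReal.rpow_le_rpow ?_ (by positivity)) _
      exact intIoo_anti_left u _ (hx.lt_succ (k + 1)).le
    calc _ ≤ (W k * intIoo u (x (k + 2)) (x k) ^ (q / r)) ^ a *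
          ((W k * intIoo u (x (k + 2)) (x k) ^ (q / r)) * dualTail p v (x k) ^ σ) :=
          mul_le_mul_right (mul_le_mul_left hβ' _) _
      _ = (W k * intIoo u (x (k + 2)) (x k) ^ (q / r)) ^ (a + 1) * dualTail p v (x k) ^ σ := by
          rw [ENNReal.rpow_add_of_nonneg _ _ ha zero_le_one, ENNReal.rpow_one]
          ring
      _ = W k ^ (p / (p - q)) * (intIoo u (x (k + 2)) (x k) ^ (q / r * (p / (p - q))) *
            dualTail p v (x k) ^ σ) := by
          rw [hae, ENNReal.mul_rpow_of_nonneg _ _ (by positivity), ← ENNReal.rpow_mul, mul_assoc]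
      _ ≤ (M * W (k + 1)) ^ (p / (p - q)) *
            (K ^ (p * q / (p - q)) * S (x (k + 2)) ^ (p * q / (p - q))) :=
          mul_le_mul' (ENNReal.rpow_le_rpow (hx.eq_mul k).le (by positivity)) hUV
      _ = _ := by
          rw [ENNReal.mul_rpow_of_nonneg _ _ (by positivity : 0 ≤ p / (p - q))]
          ring
  have hsecond : ∀ k, accum q r u w (x (k + 2)) ^ a * (β k * dualTail p v (x k) ^ σ) ≤
      2 * M * intIoo (fun t => accum q r u w t ^ a * w t * supPsi p q r u v t)
        (x (k + 1 + 1)) (x (k + 1)) := by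
    intro k
    have h1 := mul_intIoo_le hw (accum_mono hq hr u w) (supPsi_anti (p := p) hq hr u v) ha
      (x (k + 2)) (x (k + 1))
    refine le_trans ?_ (mul_le_mul_right h1 _)
    calc _ = accum q r u w (x (k + 2)) ^ a * (W k * (intIoo u (x (k + 1)) (x k) ^ (q / r) *
          dualTail p v (x k) ^ σ)) := by rw [hβ, blockMass]; ring
      _ ≤ accum q r u w (x (k + 2)) ^ a * (2 * M * intIoo w (x (k + 2)) (x (k + 1)) *
          supPsi p q r u v (x (k + 1))) := by
          refine mul_le_mul_right (mul_le_mul' (hx.le_mul_succ hM k) ?_) _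
          exact le_supPsi hp hq hqp hr u v _ _
      _ = _ := by ring
  have hterm : ∀ k, β k * (atomic β x (Iic (x k)) ^ a * dualTail p v (x k) ^ σ) ≤
      2 ^ a * (2 ^ a * (K ^ (p * q / (p - q)) *
        (M ^ (p / (p - q)) * (W (k + 1) ^ (p / (p - q)) * S (x (k + 2)) ^ (p * q / (p - q))))) +
        (2 * M) ^ a * (2 * M * intIoo (fun t => accum q r u w t ^ a * w t * supPsi p q r u v t)
          (x (k + 1 + 1)) (x (k + 1)))) := by
    intro k
    calc _ ≤ β k * ((2 ^ a * ((2 * (W k * intIoo u (x (k + 2)) (x k) ^ (q / r))) ^ a +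
          (2 * M * accum q r u w (x (k + 2))) ^ a)) * dualTail p v (x k) ^ σ) := by
          refine mul_le_mul_right (mul_le_mul_left ?_ _) _
          exact (ENNReal.rpow_le_rpow (hB k) ha).trans (add_rpow_le ha _ _)
      _ = 2 ^ a * (2 ^ a * ((W k * intIoo u (x (k + 2)) (x k) ^ (q / r)) ^ a *
            (β k * dualTail p v (x k) ^ σ)) + (2 * M) ^ a * (accum q r u w (x (k + 2)) ^ a *
            (β k * dualTail p v (x k) ^ σ))) := by
          rw [ENNReal.mul_rpow_of_nonneg 2 _ ha, ENNReal.mul_rpow_of_nonneg (2 * M) _ ha]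
          ring
      _ ≤ _ := by
          gcongr 2 ^ a * (2 ^ a * ?_ + (2 * M) ^ a * ?_)
          · exact hfirst k
          · exact hsecond k
  calc _ ≤ _ := ENNReal.tsum_le_tsum hterm
    _ = 2 ^ a * (2 ^ a * (K ^ (p * q / (p - q)) * (M ^ (p / (p - q)) *
          ∑' k, W (k + 1) ^ (p / (p - q)) * S (x (k + 1 + 1)) ^ (p * q / (p - q)))) +
        (2 * M) ^ a * (2 * M * ∑' k, intIoo (fun t => accum q r u w t ^ a * w t *
          supPsi p q r u v t) (x (k + 1 + 1)) (x (k + 1)))) := by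
        simp only [ENNReal.tsum_mul_left, ENNReal.tsum_add]
    _ ≤ _ := by
        gcongr 2 ^ a * (2 ^ a * (K ^ (p * q / (p - q)) * (M ^ (p / (p - q)) * ?_)) +
          (2 * M) ^ a * (2 * M * ?_))
        · exact tsum_weight_le hp hq hqp hw hS.anti (hx.shift 1) hM
        · exact tsum_intIoo_le (hx.shift 1) _

end Compare

/-! ### Sufficiency -/

/-- The function `accum` is left-continuous. -/
lemma exists_lt_accum {q r : ℝ} (hq : 0 < q) (hr : 0 < r) {u w : ℝ → ℝ≥0∞}
    (hw : Measurable w) {x : ℝ} {c : ℝ≥0∞} (hc : c < accum q r u w x) :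
    ∃ y, 0 ≤ y ∧ y < x ∧ c < accum q r u w y := by
  have hθ : 0 < q / r := by positivity
  set y : ℕ → ℝ := fun n => x - 1 / ((n : ℝ) + 1) with hy
  have hymono : Monotone y := fun m n hmn => by
    simp only [hy]; gcongr
  have hle : accum q r u w x ≤ ⨆ n, accum q r u w (y n) := by
    have e : accum q r u w x = ∫⁻ s in Ioo 0 x, ⨆ n, w s * intIoo u s (y n) ^ (q / r) := by
      rw [accum, intIoo]
      refine lintegral_congr fun s => ?_
      rw [intIoo_eq_iSup u s x, iSup_rpow _ hθ, ENNReal.mul_iSup]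
    have hm : ∀ n, Measurable fun s => w s * intIoo u s (y n) ^ (q / r) := fun n =>
      hw.mul ((measurable_intIoo_left u _).pow_const _)
    rw [e, lintegral_iSup hm
      (fun m n hmn s => mul_le_mul_right
        (ENNReal.rpow_le_rpow (intIoo_mono_right u s (hymono hmn)) hθ.le) _)]
    refine iSup_mono fun n => ?_
    calc _ ≤ ∫⁻ s in Ioo 0 x, (Iio (y n)).indicator
            (fun s => w s * intIoo u s (y n) ^ (q / r)) s := by
          refine lintegral_mono fun s => ?_
          by_cases hs : s ∈ Iio (y n)
          · rw [indicator_of_mem hs]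
          · beta_reduce
            rw [intIoo_eq_zero u (not_lt.1 hs), ENNReal.zero_rpow_of_pos hθ, mul_zero]
            exact zero_le
      _ ≤ _ := by
          rw [setLIntegral_indicator measurableSet_Iio]
          exact lintegral_mono_set fun s hs => ⟨hs.2.1, hs.1⟩
  obtain ⟨n, hn⟩ := lt_iSup_iff.1 (hc.trans_le hle)
  refine ⟨y n, ?_, ?_, hn⟩
  · by_contra hcon
    rw [accum, intIoo_eq_zero _ (not_le.1 hcon).le] at hn
    exact not_lt_zero hn
  · have : (0 : ℝ) < 1 / ((n : ℝ) + 1) := by positivity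
    simp only [hy]
    linarith

lemma rpow_mul_rpow_le_E₁ {p q r : ℝ} (hp : 1 < p) (hq : 0 < q) (hr : 0 < r)
    (u v : ℝ → ℝ≥0∞) {w : ℝ → ℝ≥0∞} (hw : Measurable w) (t : ℝ) :
    accum q r u w t ^ (1 / q) * dualTail p v t ^ (1 / p.conjExponent) ≤ E₁ p q r u v w := by
  have hp' := conjExponent_pos hp
  exact rpow_mul_rpow_le_of_ae_le (by positivity) (by positivity) (accum_mono hq hr u w)
    (fun x c hc => exists_lt_accum hq hr hw hc) (dualTail_anti p v) (ENNReal.ae_le_essSup _) t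

/-- `ess sup_{t > 0} (∫_0^t w)^{1/q} S(t)`. -/
noncomputable def weightSup (q : ℝ) (w S : ℝ → ℝ≥0∞) : ℝ≥0∞ :=
  essSupIoi (fun t => intIoo w 0 t ^ (1 / q) * S t) 0

lemma weight_mul_le {q : ℝ} (hq : 0 < q) {w S : ℝ → ℝ≥0∞} (hS : Antitone S) {M : ℝ≥0∞}
    {x : ℕ → ℝ} (hx : IsGeometric w M x) (k : ℕ) :
    intIoo w 0 (x k) * S (x (k + 1)) ^ q ≤ M * M * weightSup q w S ^ q := by
  obtain ⟨t, ht, hle⟩ := exists_mem_Ioo_of_ae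
    (ENNReal.ae_le_essSup (fun t => intIoo w 0 t ^ (1 / q) * S t)) (hx.pos (k + 2)).le
    (hx.lt_succ (k + 1))
  have h1 := ENNReal.rpow_le_rpow hle hq.le
  rw [ENNReal.mul_rpow_of_nonneg _ _ hq.le, ← ENNReal.rpow_mul, one_div_mul_cancel hq.ne',
    ENNReal.rpow_one] at h1
  calc _ ≤ (M * M * intIoo w 0 t) * S t ^ q :=
        mul_le_mul' (hx.le_sq_mul k ht.1.le) (ENNReal.rpow_le_rpow (hS ht.2.le) hq.le)
    _ = M * M * (intIoo w 0 t * S t ^ q) := mul_assoc _ _ _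
    _ ≤ _ := mul_le_mul_right h1 _

/-- Sufficiency in the case `p ≤ q`, for weights `w` with finite integrals `∫_0^t w` and functions
`h` that vanish near infinity. -/
theorem lhsInt_le_of_le (p q r : ℝ) (hp : 1 < p) (hpq : p ≤ q) (hr : 0 < r) (K : ℝ≥0) :
    ∃ C : ℝ≥0∞, C ≠ ∞ ∧ ∀ u v w S h : ℝ → ℝ≥0∞, Measurable u → Measurable v → (∀ x, 0 < v x) →
      Measurable w → (∀ x, 0 < w x) → (∀ t, intIoo w 0 t ≠ ∞) → IsHardyConst p r u v S K →
      Measurable h → intIoi h 0 ≠ ∞ → (∃ T, 0 < T ∧ intIoi h T = 0) →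
      intIoi (fun x => h x ^ p * v x) 0 ≠ ∞ →
      lhsInt q r u w h ≤ C * ((weightSup q w S ^ q + E₁ p q r u v w ^ q) *
        intIoi (fun x => h x ^ p * v x) 0 ^ (q / p)) := by
  have hq : 0 < q := by linarith
  have hθ : 0 < q / r := by positivity
  set M : ℝ≥0∞ := 2 ^ (q / r + 1) with hM
  have hMt : M ≠ ∞ := two_rpow_ne_top (by positivity)
  have h2M : 2 ≤ M := two_le_two_rpow hθ.le
  have h1M : 1 < M := one_lt_two_rpow (by positivity)
  have hMMt : M * M ≠ ∞ := ENNReal.mul_ne_top hMt hMt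
  have h2Mt : 2 * M ≠ ∞ := ENNReal.mul_ne_top (by norm_num) hMt
  set C₀ : ℝ≥0∞ := M * (2 ^ q * 2 ^ (q / r)) with hC₀
  have hC₀t : C₀ ≠ ∞ :=
    ENNReal.mul_ne_top hMt (ENNReal.mul_ne_top (two_rpow_ne_top hq.le) (two_rpow_ne_top hθ.le))
  have hKt : (K : ℝ≥0∞) ^ q ≠ ∞ := ENNReal.rpow_ne_top_of_nonneg hq.le ENNReal.coe_ne_top
  have h8t : (8 : ℝ≥0∞) ^ q ≠ ∞ := ENNReal.rpow_ne_top_of_nonneg hq.le (by norm_num)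
  refine ⟨C₀ * (K ^ q * (M * M) + 8 ^ q * (2 * M)), ENNReal.mul_ne_top hC₀t
    (ENNReal.add_ne_top.2 ⟨ENNReal.mul_ne_top hKt hMMt, ENNReal.mul_ne_top h8t h2Mt⟩), ?_⟩
  intro u v w S h hu hv hv0 hw hw0 hWfin hS hh hfin ⟨T, hT0, hT⟩ hN
  obtain ⟨x, hx0, hx⟩ := exists_isGeometric hw hw0 h1M hMt hT0 (hWfin T)
  have h1 := lhsInt_le_add hq hr hu hw hx (by rw [hx0]; exact hT)
  have h2 := tsum_local_le_of_le hp hpq hr hS hh hfin hN hx (weight_mul_le hq hS.anti hx)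
  have hE : ∀ t, 0 < t → atomic (blockMass q r u w x) x (Iic t) *
      dualTail p v t ^ (q / p.conjExponent) ≤ 2 * M * E₁ p q r u v w ^ q := by
    intro t _
    have := ENNReal.rpow_le_rpow (rpow_mul_rpow_le_E₁ hp hq hr u v hw t) hq.le
    rw [ENNReal.mul_rpow_of_nonneg _ _ hq.le, ← ENNReal.rpow_mul, ← ENNReal.rpow_mul,
      one_div_mul_cancel hq.ne', ENNReal.rpow_one, one_div_mul_eq_div] at this
    calc _ ≤ 2 * M * accum q r u w t * dualTail p v t ^ (q / p.conjExponent) :=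
          mul_le_mul_left (atomic_blockMass_Iic_le hq hr hw hx h2M t) _
      _ ≤ _ := by rw [mul_assoc]; exact mul_le_mul_right this _
  have h3 := hardy_of_le hp hpq hv hv0 hh hfin hN (atomic (blockMass q r u w x) x) hE
  rw [setLIntegral_atomic _ hx.pos] at h3
  set N := intIoi (fun x => h x ^ p * v x) 0 ^ (q / p)
  set A := weightSup q w S ^ q
  set B := E₁ p q r u v w ^ q
  calc _ ≤ _ := h1
    _ ≤ C₀ * (K ^ q * (M * M * A * N) + 8 ^ q * (2 * M * B * N)) := by
        gcongr C₀ * (?_ + ?_)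
        exact h3
    _ ≤ C₀ * (K ^ q * (M * M * (A + B) * N) + 8 ^ q * (2 * M * (A + B) * N)) := by
        gcongr
        · exact le_self_add
        · exact le_add_self
    _ = _ := by ring

/-- Sufficiency in the case `q < p`, for weights `w` with finite integrals `∫_0^t w` and functions
`h` that vanish near infinity. -/
theorem lhsInt_le_of_lt (p q r : ℝ) (hp : 1 < p) (hq : 0 < q) (hqp : q < p) (hr : 0 < r)
    (K : ℝ≥0) :
    ∃ C : ℝ≥0∞, C ≠ ∞ ∧ ∀ u v w S h : ℝ → ℝ≥0∞, Measurable u → Measurable v → (∀ x, 0 < v x) →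
      Measurable w → (∀ x, 0 < w x) → (∀ t, intIoo w 0 t ≠ ∞) → IsHardyConst p r u v S K →
      Measurable h → intIoi h 0 ≠ ∞ → (∃ T, 0 < T ∧ intIoi h T = 0) →
      intIoi (fun x => h x ^ p * v x) 0 ≠ ∞ →
      lhsInt q r u w h ≤ C * ((weightInt p q w S + accumInt p q r u v w) ^ ((p - q) / p) *
        intIoi (fun x => h x ^ p * v x) 0 ^ (q / p)) := by
  have hp0 : 0 < p := by linarith
  have hpq : 0 < p - q := by linarith
  have hθ : 0 < q / r := by positivity
  have hα : 0 ≤ (p - q) / p := by positivity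
  set M : ℝ≥0∞ := 2 ^ (q / r + 1) with hM
  have hMt : M ≠ ∞ := two_rpow_ne_top (by positivity)
  have h2M : 2 ≤ M := two_le_two_rpow hθ.le
  have h1M : 1 < M := one_lt_two_rpow (by positivity)
  have hMMt : M * M ≠ ∞ := ENNReal.mul_ne_top hMt hMt
  have h2Mt : 2 * M ≠ ∞ := ENNReal.mul_ne_top (by norm_num) hMt
  have hpow : ∀ {a : ℝ≥0∞} {s : ℝ}, 0 ≤ s → a ≠ ∞ → a ^ s ≠ ∞ := fun hs ha =>
    ENNReal.rpow_ne_top_of_nonneg hs ha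
  set C₀ : ℝ≥0∞ := M * (2 ^ q * 2 ^ (q / r)) with hC₀
  have hC₀t : C₀ ≠ ∞ :=
    ENNReal.mul_ne_top hMt (ENNReal.mul_ne_top (two_rpow_ne_top hq.le) (two_rpow_ne_top hθ.le))
  set C₁ : ℝ≥0∞ := (M * M) ^ (q / (p - q)) * (2 * M) with hC₁
  have hC₁t : C₁ ≠ ∞ := ENNReal.mul_ne_top (hpow (by positivity) hMMt) h2Mt
  set C₂ : ℝ≥0∞ := 2 ^ (q / (p - q)) * (2 ^ (q / (p - q)) * (K ^ (p * q / (p - q)) *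
        (M ^ (p / (p - q)) * C₁)) + (2 * M) ^ (q / (p - q)) * (2 * M)) with hC₂
  have hC₂t : C₂ ≠ ∞ := by
    refine ENNReal.mul_ne_top (two_rpow_ne_top (by positivity)) (ENNReal.add_ne_top.2
      ⟨ENNReal.mul_ne_top (two_rpow_ne_top (by positivity)) (ENNReal.mul_ne_top
        (hpow (by positivity) ENNReal.coe_ne_top) (ENNReal.mul_ne_top
        (hpow (by positivity) hMt) hC₁t)), ENNReal.mul_ne_top (hpow (by positivity) h2Mt) h2Mt⟩)
  refine ⟨C₀ * (K ^ q * C₁ ^ ((p - q) / p) + 8 ^ q * (2 * C₂ ^ ((p - q) / p))),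
    ENNReal.mul_ne_top hC₀t (ENNReal.add_ne_top.2
      ⟨ENNReal.mul_ne_top (hpow hq.le ENNReal.coe_ne_top) (hpow hα hC₁t),
      ENNReal.mul_ne_top (hpow hq.le (by norm_num))
        (ENNReal.mul_ne_top (by norm_num) (hpow hα hC₂t))⟩), ?_⟩
  intro u v w S h hu hv hv0 hw hw0 hWfin hS hh hfin ⟨T, hT0, hT⟩ hN
  obtain ⟨x, hx0, hx⟩ := exists_isGeometric hw hw0 h1M hMt hT0 (hWfin T)
  have h1 := lhsInt_le_add hq hr hu hw hx (by rw [hx0]; exact hT)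
  have h2 := tsum_local_le_of_lt hp hq hqp hr hS hh hfin hN hx
  have h3 := hardy_of_lt hp hq hqp hv hv0 hh hfin hN (atomic (blockMass q r u w x) x)
  rw [setLIntegral_atomic _ hx.pos] at h3
  set N := intIoi (fun x => h x ^ p * v x) 0 ^ (q / p)
  set A := weightInt p q w S
  set B := accumInt p q r u v w
  have h4 : ∑' k, intIoo w 0 (x k) ^ (p / (p - q)) * S (x (k + 1)) ^ (p * q / (p - q)) ≤
      C₁ * (A + B) :=
    (tsum_weight_le hp hq hqp hw hS.anti hx h2M).trans (mul_le_mul_right le_self_add _)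
  have h5 : hardyInt p q v (atomic (blockMass q r u w x) x) 0 ≤ C₂ * (A + B) := by
    refine (hardyInt_atomic_le hp hq hqp hr hS hu hv hw hx h2M).trans ?_
    calc _ ≤ 2 ^ (q / (p - q)) * (2 ^ (q / (p - q)) * (K ^ (p * q / (p - q)) *
        (M ^ (p / (p - q)) * (C₁ * (A + B)))) +
          (2 * M) ^ (q / (p - q)) * (2 * M * (A + B))) := by
          gcongr
          · exact le_self_add
          · exact le_add_self
      _ = _ := by rw [hC₂]; ring
  calc _ ≤ _ := h1
    _ ≤ C₀ * (K ^ q * ((C₁ * (A + B)) ^ ((p - q) / p) * N) +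
          8 ^ q * (2 * (C₂ * (A + B)) ^ ((p - q) / p) * N)) := by
        gcongr C₀ * (?_ + ?_)
        · refine h2.trans (mul_le_mul_right (mul_le_mul_left ?_ _) _)
          exact ENNReal.rpow_le_rpow h4 hα
        · refine h3.trans (mul_le_mul_right (mul_le_mul_left (mul_le_mul_right ?_ _) _) _)
          exact ENNReal.rpow_le_rpow h5 hα
    _ = _ := by
        rw [ENNReal.mul_rpow_of_nonneg C₁ _ hα, ENNReal.mul_rpow_of_nonneg C₂ _ hα]
        ring

/-! ### Lower bounds for the left-hand side -/

lemma rpow_mul_intIoo_le {r : ℝ} (hr : 0 < r) {u : ℝ → ℝ≥0∞} (hu : Measurable u)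
    (h : ℝ → ℝ≥0∞) (s x : ℝ) :
    intIoi h x ^ r * intIoo u s x ≤ intIoi (fun t => intIoi h t ^ r * u t) s := by
  rw [intIoo, ← lintegral_const_mul _ hu]
  refine le_trans (setLIntegral_mono' measurableSet_Ioo fun t ht => ?_)
    (lintegral_mono_set Ioo_subset_Ioi_self)
  exact mul_le_mul_left (ENNReal.rpow_le_rpow (intIoi_anti h ht.2.le) hr.le) _

lemma rpow_mul_rpow_intIoo_le {q r : ℝ} (hq : 0 < q) (hr : 0 < r) {u : ℝ → ℝ≥0∞}
    (hu : Measurable u) (h : ℝ → ℝ≥0∞) (s x : ℝ) :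
    intIoi h x ^ q * intIoo u s x ^ (q / r) ≤
      intIoi (fun t => intIoi h t ^ r * u t) s ^ (q / r) := by
  have hθ : 0 < q / r := by positivity
  have := ENNReal.rpow_le_rpow (rpow_mul_intIoo_le hr hu h s x) hθ.le
  rwa [ENNReal.mul_rpow_of_nonneg _ _ hθ.le, ← ENNReal.rpow_mul,
    show r * (q / r) = q by field_simp] at this

lemma accum_mul_le_lhsInt {q r : ℝ} (hq : 0 < q) (hr : 0 < r) {u w : ℝ → ℝ≥0∞}
    (hu : Measurable u) (hw : Measurable w) (h : ℝ → ℝ≥0∞) (t : ℝ) :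
    accum q r u w t * intIoi h t ^ q ≤ lhsInt q r u w h := by
  have hm : Measurable fun s => w s * intIoo u s t ^ (q / r) :=
    hw.mul ((measurable_intIoo_left u t).pow_const _)
  rw [accum, intIoo, ← lintegral_mul_const _ hm]
  refine le_trans (setLIntegral_mono' measurableSet_Ioo fun s _ => ?_)
    (lintegral_mono_set Ioo_subset_Ioi_self)
  rw [mul_assoc, mul_comm]
  refine mul_le_mul_left ?_ _
  rw [mul_comm]
  exact rpow_mul_rpow_intIoo_le hq hr hu h s t

lemma intIoo_mul_rpow_le {q r : ℝ} (hq : 0 < q) (hr : 0 < r) (u h : ℝ → ℝ≥0∞) {w : ℝ → ℝ≥0∞}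
    (hw : Measurable w) (a b : ℝ) :
    intIoo w a b * intIoi (fun t => intIoi h t ^ r * u t) b ^ (q / r) ≤
      intIoo (fun x => intIoi (fun t => intIoi h t ^ r * u t) x ^ (q / r) * w x) a b := by
  rw [mul_comm, intIoo, ← lintegral_const_mul _ hw]
  refine setLIntegral_mono' measurableSet_Ioo fun s hs => ?_
  exact mul_le_mul_left (ENNReal.rpow_le_rpow (intIoi_anti _ hs.2.le) (by positivity)) _

lemma intIoo_mul_le_lhsInt {q r : ℝ} (hq : 0 < q) (hr : 0 < r) (u h : ℝ → ℝ≥0∞)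
    {w : ℝ → ℝ≥0∞} (hw : Measurable w) (t : ℝ) :
    intIoo w 0 t * intIoi (fun t => intIoi h t ^ r * u t) t ^ (q / r) ≤ lhsInt q r u w h :=
  (intIoo_mul_rpow_le hq hr u h hw 0 t).trans (lintegral_mono_set Ioo_subset_Ioi_self)

lemma tsum_mul_le_lhsInt {q r : ℝ} (hq : 0 < q) (hr : 0 < r) (u h : ℝ → ℝ≥0∞)
    {w : ℝ → ℝ≥0∞} (hw : Measurable w) {M : ℝ≥0∞} {x : ℕ → ℝ} (hx : IsGeometric w M x)
    (hM : 2 ≤ M) :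
    ∑' k, intIoo w 0 (x k) * intIoi (fun t => intIoi h t ^ r * u t) (x k) ^ (q / r) ≤
      2 * lhsInt q r u w h := by
  refine le_trans (ENNReal.tsum_le_tsum fun k => ?_)
    ((ENNReal.tsum_mul_left (a := 2)).trans_le (mul_le_mul_right (tsum_intIoo_le hx _) _))
  refine (mul_le_mul_left (hx.le_two_mul hM k) _).trans ?_
  rw [mul_assoc]
  exact mul_le_mul_right (intIoo_mul_rpow_le hq hr u h hw _ _) _

/-! ### Necessity -/

/-- The iterated inequality with constant `c` for everywhere measurable functions, raised to the
power `q`. -/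
def IterBound (p q r : ℝ) (u v w : ℝ → ℝ≥0∞) (c : ℝ≥0∞) : Prop :=
  ∀ h : ℝ → ℝ≥0∞, Measurable h →
    lhsInt q r u w h ≤ c ^ q * intIoi (fun x => h x ^ p * v x) 0 ^ (q / p)

section Necessity

variable {p q r : ℝ} {u v w S : ℝ → ℝ≥0∞} {K : ℝ≥0} {c : ℝ≥0∞}

/-- The bound on the function in `E₁`, from functions supported on `(t,∞)`. -/
lemma IterBound.accum_mul_dualTail_le (hC : IterBound p q r u v w c) (hp : 1 < p) (hq : 0 < q)
    (hr : 0 < r) (hu : Measurable u) (hv : Measurable v) (hw : Measurable w) {t : ℝ}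
    (ht : 0 ≤ t) :
    accum q r u w t ^ (1 / q) * dualTail p v t ^ (1 / p.conjExponent) ≤ c := by
  refine ENNReal.mul_le_of_forall_lt fun b hb d hd => ?_
  rcases eq_or_ne b 0 with rfl | hb0
  · simp
  have hbt : b ≠ ∞ := hb.ne_top
  have key : dualTail p v t ^ (1 / p.conjExponent) ≤ c / b := by
    refine dualTail_rpow_le hp hv fun h hh _ _ => ?_
    have h1 := hC _ (hh.indicator (measurableSet_Ioi (a := t)))
    rw [indicator_rpow_mul (by linarith), intIoi_indicator' _ ht] at h1
    have h2 := accum_mul_le_lhsInt hq hr hu hw ((Ioi t).indicator h) t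
    rw [intIoi_indicator' _ le_rfl] at h2
    have h3 := ENNReal.rpow_le_rpow (h2.trans h1) (one_div_nonneg.2 hq.le)
    rw [ENNReal.mul_rpow_of_nonneg _ _ (by positivity), ENNReal.mul_rpow_of_nonneg _ _
      (by positivity), ← ENNReal.rpow_mul, ← ENNReal.rpow_mul, ← ENNReal.rpow_mul,
      mul_one_div_cancel hq.ne', ENNReal.rpow_one, ENNReal.rpow_one,
      show q / p * (1 / q) = 1 / p by field_simp] at h3
    have h4 : intIoi h t * b ≤ c * intIoi (fun x => h x ^ p * v x) t ^ (1 / p) := by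
      rw [mul_comm]
      exact (mul_le_mul_left hb.le _).trans h3
    rw [← ENNReal.le_div_iff_mul_le (.inl hb0) (.inl hbt)] at h4
    rwa [ENNReal.mul_div_right_comm] at h4
  calc b * d ≤ b * (c / b) := mul_le_mul_right (hd.le.trans key) _
    _ = c := ENNReal.mul_div_cancel hb0 hbt

lemma accum_pos (hq : 0 < q) (hr : 0 < r) (hu : Measurable u) (hu0 : ∀ x, 0 < u x)
    (hw : Measurable w) (hw0 : ∀ x, 0 < w x) {t : ℝ} (ht : 0 < t) : 0 < accum q r u w t := by
  have hhalf : t / 2 < t := by linarith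
  have h1 : intIoo w 0 (t / 2) * intIoo u (t / 2) t ^ (q / r) ≤ accum q r u w t := by
    rw [intIoo, ← lintegral_mul_const _ hw]
    refine le_trans (setLIntegral_mono' measurableSet_Ioo fun s hs => ?_)
      (lintegral_mono_set (Ioo_subset_Ioo_right hhalf.le))
    exact mul_le_mul_right (ENNReal.rpow_le_rpow (intIoo_anti_left u t hs.2.le)
      (by positivity)) _
  refine (ENNReal.mul_pos (intIoo_pos hw hw0 (by linarith)).ne' ?_).trans_le h1
  exact (ENNReal.rpow_pos_of_nonneg (intIoo_pos hu hu0 hhalf) (by positivity)).ne'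

lemma IterBound.dualTail_ne_top (hC : IterBound p q r u v w c) (hc : c ≠ ∞) (hp : 1 < p)
    (hq : 0 < q) (hr : 0 < r) (hu : Measurable u) (hu0 : ∀ x, 0 < u x) (hv : Measurable v)
    (hw : Measurable w) (hw0 : ∀ x, 0 < w x) {t : ℝ} (ht : 0 < t) : dualTail p v t ≠ ∞ := by
  intro htop
  have hp' := conjExponent_pos hp
  have := hC.accum_mul_dualTail_le hp hq hr hu hv hw ht.le
  rw [htop, ENNReal.top_rpow_of_pos (by positivity), ENNReal.mul_top] at this
  · exact hc (top_le_iff.1 this)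
  · exact (ENNReal.rpow_pos_of_nonneg (accum_pos hq hr hu hu0 hw hw0 ht) (by positivity)).ne'

/-- For functions supported on `(t,∞)` the iterated inequality contains the inner Hardy inequality
on `(t,∞)`. -/
lemma IterBound.rpow_mul_rpow_le (hC : IterBound p q r u v w c) (hp : 1 < p) (hq : 0 < q)
    (hr : 0 < r) (hw : Measurable w) {t : ℝ} (ht : 0 ≤ t) {h : ℝ → ℝ≥0∞} (hh : Measurable h) :
    intIoo w 0 t ^ (1 / q) * intIoi (fun x => intIoi h x ^ r * u x) t ^ (1 / r) ≤
      c * intIoi (fun x => h x ^ p * v x) t ^ (1 / p) := by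
  have h1 := hC _ (hh.indicator (measurableSet_Ioi (a := t)))
  rw [indicator_rpow_mul (by linarith), intIoi_indicator' _ ht] at h1
  have h2 := intIoo_mul_le_lhsInt hq hr u ((Ioi t).indicator h) hw t
  have h3 : intIoi (fun x => intIoi ((Ioi t).indicator h) x ^ r * u x) t =
      intIoi (fun x => intIoi h x ^ r * u x) t :=
    setLIntegral_congr_fun measurableSet_Ioi fun x hx => by
      rw [intIoi_indicator _ (le_of_lt hx)]
  rw [h3] at h2
  have h4 := ENNReal.rpow_le_rpow (h2.trans h1) (one_div_nonneg.2 hq.le)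
  rwa [ENNReal.mul_rpow_of_nonneg _ _ (by positivity), ENNReal.mul_rpow_of_nonneg _ _
    (by positivity), ← ENNReal.rpow_mul, ← ENNReal.rpow_mul, ← ENNReal.rpow_mul,
    mul_one_div_cancel hq.ne', ENNReal.rpow_one,
    show q / p * (1 / q) = 1 / p by field_simp,
    show q / r * (1 / q) = 1 / r by field_simp] at h4

lemma IterBound.rpow_mul_le (hC : IterBound p q r u v w c) (hp : 1 < p) (hq : 0 < q)
    (hr : 0 < r) (hw : Measurable w) (hw0 : ∀ x, 0 < w x) (hWfin : ∀ t, intIoo w 0 t ≠ ∞)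
    (hS : IsHardyConst p r u v S K) {t : ℝ} (ht : 0 < t) :
    intIoo w 0 t ^ (1 / q) * S t ≤ K * c := by
  have hW0 : intIoo w 0 t ^ (1 / q) ≠ 0 :=
    (ENNReal.rpow_pos_of_nonneg (intIoo_pos hw hw0 ht) (by positivity)).ne'
  have hWt : intIoo w 0 t ^ (1 / q) ≠ ∞ :=
    ENNReal.rpow_ne_top_of_nonneg (by positivity) (hWfin t)
  have h1 : S t ≤ K * (c / intIoo w 0 t ^ (1 / q)) := by
    refine hS.lower t ht _ fun h hh => ?_
    have h2 := hC.rpow_mul_rpow_le hp hq hr hw ht.le hh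
    rw [mul_comm, ← ENNReal.le_div_iff_mul_le (.inl hW0) (.inl hWt)] at h2
    rwa [ENNReal.mul_div_right_comm] at h2
  calc _ ≤ intIoo w 0 t ^ (1 / q) * (K * (c / intIoo w 0 t ^ (1 / q))) := mul_le_mul_right h1 _
    _ = K * (intIoo w 0 t ^ (1 / q) * (c / intIoo w 0 t ^ (1 / q))) := by ring
    _ = _ := by rw [ENNReal.mul_div_cancel hW0 hWt]

lemma IterBound.apply_ne_top (hC : IterBound p q r u v w c) (hc : c ≠ ∞) (hp : 1 < p)
    (hq : 0 < q) (hr : 0 < r) (hw : Measurable w) (hw0 : ∀ x, 0 < w x)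
    (hWfin : ∀ t, intIoo w 0 t ≠ ∞) (hS : IsHardyConst p r u v S K) {t : ℝ} (ht : 0 < t) :
    S t ≠ ∞ := by
  intro htop
  have := hC.rpow_mul_le hp hq hr hw hw0 hWfin hS ht
  rw [htop, ENNReal.mul_top
    (ENNReal.rpow_pos_of_nonneg (intIoo_pos hw hw0 ht) (by positivity)).ne'] at this
  exact ENNReal.mul_ne_top ENNReal.coe_ne_top hc (top_le_iff.1 this)

/-- Functions of norm at most `1` that are extremal up to a factor for Hardy's inequality on
`(t,∞)`. -/
lemma IterBound.exists_near_extremal (hC : IterBound p q r u v w c) (hc : c ≠ ∞) (hp : 1 < p)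
    (hq : 0 < q) (hr : 0 < r) (hw : Measurable w) (hw0 : ∀ x, 0 < w x)
    (hWfin : ∀ t, intIoo w 0 t ≠ ∞) (hS : IsHardyConst p r u v S K) {t : ℝ} (ht : 0 < t) :
    ∃ h : ℝ → ℝ≥0∞, Measurable h ∧ intIoi (fun x => h x ^ p * v x) 0 ≤ 1 ∧
      S t ≤ 2 * K * intIoi (fun x => intIoi h x ^ r * u x) t ^ (1 / r) := by
  have hp0 : 0 < p := by linarith
  have hSt := hC.apply_ne_top hc hp hq hr hw hw0 hWfin hS ht
  rcases eq_or_ne (S t) 0 with hS0 | hS0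
  · refine ⟨0, measurable_const, ?_, by rw [hS0]; exact zero_le⟩
    simp [intIoi, ENNReal.zero_rpow_of_pos hp0]
  have hK0 : (K : ℝ≥0∞) ≠ 0 := by
    intro h0
    have := hS.lower t ht ∞ (fun h _ => ?_)
    · rw [h0, zero_mul] at this
      exact hS0 (le_antisymm this zero_le)
    · rcases eq_or_ne (intIoi (fun x => h x ^ p * v x) t ^ (1 / p)) 0 with hz | hz
      · have h2 := hC.rpow_mul_rpow_le hp hq hr hw ht.le (h := h) ‹_›
        rw [hz, mul_zero, nonpos_iff_eq_zero, mul_eq_zero] at h2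
        rw [h2.resolve_left (ENNReal.rpow_pos_of_nonneg (intIoo_pos hw hw0 ht)
          (by positivity)).ne']
        exact zero_le
      · rw [ENNReal.top_mul hz]; exact le_top
  have h2K0 : 2 * (K : ℝ≥0∞) ≠ 0 := mul_ne_zero (by norm_num) hK0
  have h2Kt : 2 * (K : ℝ≥0∞) ≠ ∞ := ENNReal.mul_ne_top (by norm_num) ENNReal.coe_ne_top
  have hex : ∃ h : ℝ → ℝ≥0∞, Measurable h ∧
      S t / (2 * K) * intIoi (fun x => h x ^ p * v x) t ^ (1 / p) <
        intIoi (fun x => intIoi h x ^ r * u x) t ^ (1 / r) := by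
    by_contra! hcon
    have h1 := hS.lower t ht _ hcon
    have h2 : (K : ℝ≥0∞) * (S t / (2 * K)) = S t / 2 := by
      rw [ENNReal.div_eq_inv_mul, ENNReal.div_eq_inv_mul,
        ENNReal.mul_inv (.inl (by norm_num)) (.inl (by norm_num)),
        show ∀ a b c d : ℝ≥0∞, a * (b * c * d) = (a * c) * (b * d) by intros; ring,
        ENNReal.mul_inv_cancel hK0 ENNReal.coe_ne_top, one_mul]
    rw [h2] at h1
    exact absurd (ENNReal.half_lt_self hS0 hSt) (not_lt.2 h1)
  obtain ⟨h, hh, hlt⟩ := hex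
  set N := intIoi (fun x => h x ^ p * v x) t ^ (1 / p) with hN
  set G := intIoi (fun x => intIoi h x ^ r * u x) t ^ (1 / r) with hG
  have hN0 : N ≠ 0 := by
    intro hz
    have h2 := hC.rpow_mul_rpow_le hp hq hr hw ht.le hh
    rw [← hN, ← hG, hz, mul_zero, nonpos_iff_eq_zero, mul_eq_zero] at h2
    have h3 := h2.resolve_left (ENNReal.rpow_pos_of_nonneg (intIoo_pos hw hw0 ht)
      (by positivity)).ne'
    rw [h3] at hlt
    exact not_lt_zero hlt
  have hNt : N ≠ ∞ := by
    intro hz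
    rw [hz, ENNReal.mul_top (ENNReal.div_pos hS0 h2Kt).ne'] at hlt
    exact not_top_lt hlt
  have hNi : N⁻¹ ≠ ∞ := ENNReal.inv_ne_top.2 hN0
  have hscale : ∀ x, intIoi (fun y => N⁻¹ * (Ioi t).indicator h y) x =
      N⁻¹ * intIoi ((Ioi t).indicator h) x := fun x =>
    lintegral_const_mul' _ _ hNi
  refine ⟨fun y => N⁻¹ * (Ioi t).indicator h y,
    measurable_const.mul (hh.indicator measurableSet_Ioi), ?_, ?_⟩
  · have e1 : (fun x => (N⁻¹ * (Ioi t).indicator h x) ^ p * v x) =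
        fun x => N⁻¹ ^ p * ((Ioi t).indicator h x ^ p * v x) := by
      ext x
      rw [ENNReal.mul_rpow_of_nonneg _ _ hp0.le, mul_assoc]
    have e2 : N ^ p = intIoi (fun x => h x ^ p * v x) t := by
      rw [hN, ← ENNReal.rpow_mul, one_div_mul_cancel hp0.ne', ENNReal.rpow_one]
    rw [e1, intIoi, lintegral_const_mul' _ _ (ENNReal.rpow_ne_top_of_nonneg hp0.le hNi)]
    change _ * intIoi (fun x => (Ioi t).indicator h x ^ p * v x) 0 ≤ 1
    rw [indicator_rpow_mul hp0, intIoi_indicator' _ ht.le, ← e2, ENNReal.inv_rpow]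
    exact ENNReal.inv_mul_le_one _
  · have e1 : intIoi (fun x => intIoi (fun y => N⁻¹ * (Ioi t).indicator h y) x ^ r * u x) t =
        N⁻¹ ^ r * intIoi (fun x => intIoi h x ^ r * u x) t := by
      rw [intIoi, intIoi, ← lintegral_const_mul' _ _ (ENNReal.rpow_ne_top_of_nonneg hr.le hNi)]
      refine setLIntegral_congr_fun measurableSet_Ioi fun x hx => ?_
      rw [hscale, intIoi_indicator _ (le_of_lt hx), ENNReal.mul_rpow_of_nonneg _ _ hr.le,
        mul_assoc]
    rw [e1, ENNReal.mul_rpow_of_nonneg _ _ (by positivity), ← ENNReal.rpow_mul,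
      mul_one_div_cancel hr.ne', ENNReal.rpow_one, ← hG]
    calc S t = 2 * K * (N⁻¹ * (S t / (2 * K) * N)) := by
          rw [show ∀ a b c d : ℝ≥0∞, a * (b * (c * d)) = a * c * (b * d) by intros; ring,
            ENNReal.inv_mul_cancel hN0 hNt, mul_one, ENNReal.mul_div_cancel h2K0 h2Kt]
      _ ≤ _ := mul_le_mul_right (mul_le_mul_right hlt.le _) _

end Necessity

section NecessitySums

variable {p q r : ℝ} {u v w S : ℝ → ℝ≥0∞} {K : ℝ≥0} {c : ℝ≥0∞} {M : ℝ≥0∞} {x : ℕ → ℝ}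

/-- The discrete form of the bound on `weightInt`; the test function is the `ℓ^p`-sum of
near-extremal functions at the points `x k`. -/
lemma IterBound.tsum_weight_le (hC : IterBound p q r u v w c) (hc : c ≠ ∞) (hp : 1 < p)
    (hq : 0 < q) (hqp : q < p) (hr : 0 < r) (hv : Measurable v)
    (hw : Measurable w) (hw0 : ∀ x, 0 < w x) (hWfin : ∀ t, intIoo w 0 t ≠ ∞)
    (hS : IsHardyConst p r u v S K) (hx : IsGeometric w M x) (hM : 2 ≤ M) :
    (∑' k, intIoo w 0 (x k) ^ (p / (p - q)) * S (x k) ^ (p * q / (p - q))) ^ ((p - q) / p) ≤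
      (2 * K) ^ q * 2 * c ^ q := by
  have hp0 : 0 < p := by linarith
  have hpq : 0 < p - q := by linarith
  have hθ : 0 < q / r := by positivity
  choose h hh hN hSh using fun k =>
    hC.exists_near_extremal hc hp hq hr hw hw0 hWfin hS (hx.pos k)
  set W : ℕ → ℝ≥0∞ := fun k => intIoo w 0 (x k) with hW
  set τ : ℕ → ℝ≥0∞ := fun k => W k ^ (p / (p - q)) * S (x k) ^ (p * q / (p - q)) with hτ
  have hτt : ∀ k, τ k ≠ ∞ := fun k =>
    ENNReal.mul_ne_top (ENNReal.rpow_ne_top_of_nonneg (by positivity) (hWfin _))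
      (ENNReal.rpow_ne_top_of_nonneg (by positivity)
        (hC.apply_ne_top hc hp hq hr hw hw0 hWfin hS (hx.pos k)))
  have hfinite : ∀ s : Finset ℕ, (∑ k ∈ s, τ k) ^ ((p - q) / p) ≤ (2 * K) ^ q * 2 * c ^ q := by
    intro s
    set g : ℝ → ℝ≥0∞ := fun y => (∑ k ∈ s, τ k * h k y ^ p) ^ (1 / p) with hg
    have hgm : Measurable g :=
      (Finset.measurable_sum s fun k _ => ((hh k).pow_const p).const_mul _).pow_const _
    have hgN : intIoi (fun y => g y ^ p * v y) 0 ≤ ∑ k ∈ s, τ k := by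
      have e : (fun y => g y ^ p * v y) = fun y => ∑ k ∈ s, τ k * (h k y ^ p * v y) := by
        ext y
        simp only [hg]
        rw [← ENNReal.rpow_mul, one_div_mul_cancel hp0.ne', ENNReal.rpow_one, Finset.sum_mul]
        exact Finset.sum_congr rfl fun k _ => mul_assoc _ _ _
      have hm : ∀ k, Measurable fun y => h k y ^ p * v y := fun k =>
        measurable_rpow_mul (hh k) hv
      rw [e, intIoi, lintegral_finsetSum s fun k _ => (hm k).const_mul _]
      refine Finset.sum_le_sum fun k _ => ?_
      rw [lintegral_const_mul _ (hm k)]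
      exact mul_le_of_le_one_right zero_le (hN k)
    have hgk : ∀ k ∈ s, ∀ y, τ k ^ (1 / p) * h k y ≤ g y := by
      intro k hk y
      have : τ k * h k y ^ p ≤ ∑ k ∈ s, τ k * h k y ^ p :=
        Finset.single_le_sum (f := fun k => τ k * h k y ^ p) (fun _ _ => zero_le) hk
      have h1 := ENNReal.rpow_le_rpow this (one_div_nonneg.2 hp0.le)
      rwa [ENNReal.mul_rpow_of_nonneg _ _ (by positivity), ← ENNReal.rpow_mul,
        mul_one_div_cancel hp0.ne', ENNReal.rpow_one] at h1
    have hG : ∀ k ∈ s, τ k ≤ (2 * K) ^ q *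
        (W k * intIoi (fun t => intIoi g t ^ r * u t) (x k) ^ (q / r)) := by
      intro k hk
      have h1 : τ k ^ (r / p) * intIoi (fun t => intIoi (h k) t ^ r * u t) (x k) ≤
          intIoi (fun t => intIoi g t ^ r * u t) (x k) := by
        have ht : τ k ^ (1 / p) ≠ ∞ := ENNReal.rpow_ne_top_of_nonneg (by positivity) (hτt k)
        have ht' : τ k ^ (r / p) ≠ ∞ := ENNReal.rpow_ne_top_of_nonneg (by positivity) (hτt k)
        rw [intIoi, ← lintegral_const_mul' _ _ ht']
        refine lintegral_mono fun t => ?_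
        have h2 : τ k ^ (1 / p) * intIoi (h k) t ≤ intIoi g t := by
          rw [intIoi, ← lintegral_const_mul' _ _ ht]
          exact lintegral_mono fun y => hgk k hk y
        have h3 := ENNReal.rpow_le_rpow h2 hr.le
        rw [ENNReal.mul_rpow_of_nonneg _ _ hr.le, ← ENNReal.rpow_mul, one_div_mul_eq_div] at h3
        rw [← mul_assoc]
        exact mul_le_mul_left h3 _
      have h2 := ENNReal.rpow_le_rpow h1 hθ.le
      rw [ENNReal.mul_rpow_of_nonneg _ _ hθ.le, ← ENNReal.rpow_mul,
        show r / p * (q / r) = q / p by field_simp] at h2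
      have h3 := ENNReal.rpow_le_rpow (hSh k) hq.le
      rw [ENNReal.mul_rpow_of_nonneg _ _ hq.le, ← ENNReal.rpow_mul, one_div_mul_eq_div] at h3
      have e : τ k = W k * (τ k ^ (q / p) * S (x k) ^ q) := by
        have e1 : τ k ^ (q / p) = W k ^ (q / (p - q)) * S (x k) ^ (q * q / (p - q)) := by
          simp only [hτ]
          rw [ENNReal.mul_rpow_of_nonneg _ _ (by positivity), ← ENNReal.rpow_mul,
            ← ENNReal.rpow_mul]
          congr 2 <;> field_simp
        rw [e1, show ∀ a b c d : ℝ≥0∞, a * (b * c * d) = (b * a) * (c * d) by intros; ring,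
          ← ENNReal.rpow_add_of_nonneg _ _ (by positivity) hq.le]
        conv_rhs => enter [1, 2]; rw [← ENNReal.rpow_one (W k)]
        rw [← ENNReal.rpow_add_of_nonneg _ _ (by positivity) zero_le_one]
        simp only [hτ]
        congr 2 <;> field_simp <;> ring
      calc τ k = W k * (τ k ^ (q / p) * S (x k) ^ q) := e
        _ ≤ W k * (τ k ^ (q / p) * ((2 * K) ^ q *
              intIoi (fun t => intIoi (h k) t ^ r * u t) (x k) ^ (q / r))) :=
            mul_le_mul_right (mul_le_mul_right h3 _) _
        _ = (2 * K) ^ q * (W k * (τ k ^ (q / p) *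
              intIoi (fun t => intIoi (h k) t ^ r * u t) (x k) ^ (q / r))) := by ring
        _ ≤ _ := mul_le_mul_right (mul_le_mul_right h2 _) _
    -- the sum is finite, so its power on the right can be absorbed
    have hX : ∑ k ∈ s, τ k ≤ ((2 * K) ^ q * 2 * c ^ q) * (∑ k ∈ s, τ k) ^ (q / p) := by
      calc _ ≤ ∑ k ∈ s, (2 * K) ^ q *
            (W k * intIoi (fun t => intIoi g t ^ r * u t) (x k) ^ (q / r)) :=
            Finset.sum_le_sum hG
        _ = (2 * K) ^ q * ∑ k ∈ s,
            W k * intIoi (fun t => intIoi g t ^ r * u t) (x k) ^ (q / r) :=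
            (Finset.mul_sum _ _ _).symm
        _ ≤ (2 * K) ^ q * (2 * (c ^ q * (∑ k ∈ s, τ k) ^ (q / p))) := by
            gcongr
            refine (ENNReal.sum_le_tsum s).trans ((tsum_mul_le_lhsInt hq hr u g hw hx hM).trans ?_)
            refine mul_le_mul_right ((hC g hgm).trans (mul_le_mul_right ?_ _)) _
            exact ENNReal.rpow_le_rpow hgN (by positivity)
        _ = _ := by ring
    have := rpow_le_of_le_mul_rpow (ENNReal.sum_ne_top.2 fun k _ => hτt k)
      ((div_lt_one hp0).2 hqp) hX
    rwa [show 1 - q / p = (p - q) / p by field_simp] at this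
  rw [ENNReal.tsum_eq_iSup_sum, iSup_rpow _ (by positivity : 0 < (p - q) / p)]
  exact iSup_le hfinite

/-- Finitely supported bounded truncations of a sequence. -/
noncomputable def truncSeq (β : ℕ → ℝ≥0∞) (n k : ℕ) : ℝ≥0∞ := if k < n then min (β k) n else 0

lemma truncSeq_le (β : ℕ → ℝ≥0∞) (n k : ℕ) : truncSeq β n k ≤ β k := by
  unfold truncSeq; split_ifs
  · exact min_le_left _ _
  · exact zero_le

lemma truncSeq_ne_top (β : ℕ → ℝ≥0∞) (n k : ℕ) : truncSeq β n k ≠ ∞ := by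
  unfold truncSeq; split_ifs
  · exact ne_top_of_le_ne_top (ENNReal.natCast_ne_top n) (min_le_right _ _)
  · exact ENNReal.zero_ne_top

lemma truncSeq_mono (β : ℕ → ℝ≥0∞) (k : ℕ) : Monotone fun n => truncSeq β n k := by
  intro m n hmn
  have hc : (m : ℝ≥0∞) ≤ n := Nat.cast_le.2 hmn
  simp only [truncSeq]
  split_ifs with h1 h2
  · exact min_le_min_left _ hc
  · omega
  · exact zero_le
  · exact le_rfl

lemma iSup_truncSeq (β : ℕ → ℝ≥0∞) (k : ℕ) : ⨆ n, truncSeq β n k = β k := by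
  refine le_antisymm (iSup_le fun n => truncSeq_le β n k) ?_
  have e : β k = ⨆ n : ℕ, min (β k) n := by
    rw [← inf_iSup_eq, ENNReal.iSup_natCast, inf_top_eq]
  conv_lhs => rw [e]
  refine iSup_le fun n => le_trans ?_ (le_iSup _ (max n (k + 1)))
  have : k < max n (k + 1) := lt_of_lt_of_le (Nat.lt_succ_self k) (le_max_right _ _)
  rw [truncSeq, if_pos this]
  exact min_le_min_left _ (Nat.cast_le.2 (le_max_left _ _))

lemma iSup_atomic_Iic (β : ℕ → ℝ≥0∞) (hx : StrictAnti x) (k : ℕ) :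
    ⨆ n, atomic (truncSeq β n) x (Iic (x k)) = atomic β x (Iic (x k)) := by
  simp_rw [atomic_Iic _ hx]
  rw [← lintegral_count, ← funext fun n => lintegral_count (fun j => truncSeq β n (j + k))]
  rw [← lintegral_iSup (fun n => measurable_of_countable _)
    (fun m n hmn j => truncSeq_mono β (j + k) hmn)]
  simp_rw [iSup_truncSeq]

end NecessitySums

section NecessityAccum

variable {p q r : ℝ} {u v w S : ℝ → ℝ≥0∞} {K : ℝ≥0} {c : ℝ≥0∞} {M : ℝ≥0∞} {x : ℕ → ℝ}

lemma hardyInt_truncSeq_ne_top (hp : 1 < p) (hq : 0 < q) (hqp : q < p) (β : ℕ → ℝ≥0∞)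
    (hx : StrictAnti x) (hx0 : ∀ k, 0 < x k) (hV : ∀ t, 0 < t → dualTail p v t ≠ ∞) (n : ℕ) :
    hardyInt p q v (atomic (truncSeq β n) x) 0 ≠ ∞ := by
  have hpq : 0 < p - q := by linarith
  have hp1 : 0 < p - 1 := by linarith
  have hz : ∀ k, k ∉ Finset.range n → truncSeq β n k = 0 := fun k hk => by
    rw [truncSeq, if_neg (by simpa using hk)]
  rw [hardyInt, setLIntegral_atomic _ hx0, tsum_eq_sum (s := Finset.range n)
    (fun k hk => by rw [hz k hk, zero_mul])]
  refine ENNReal.sum_ne_top.2 fun k _ => ENNReal.mul_ne_top (truncSeq_ne_top _ _ _)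
    (ENNReal.mul_ne_top (ENNReal.rpow_ne_top_of_nonneg (by positivity) ?_)
      (ENNReal.rpow_ne_top_of_nonneg (by positivity) (hV _ (hx0 k))))
  rw [atomic_Iic _ hx, tsum_eq_sum (s := Finset.range n) (fun j hj => ?_)]
  · exact ENNReal.sum_ne_top.2 fun j _ => truncSeq_ne_top _ _ _
  · refine hz _ ?_
    simp only [Finset.mem_range, not_lt] at hj ⊢
    omega

/-- For the test function `h` of a measure `ρ`, `∫_t^∞ (∫_s^∞ h)^r u(s) ds` is at least
`(∫_t^x u) (∫_x^∞ h)^r` for every `x > t`, and hence controls the essential supremum `supPsi`. -/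
lemma rpow_mul_supPsi_le (hp : 1 < p) (hq : 0 < q) (hqp : q < p) (hr : 0 < r)
    (hu : Measurable u) (hv : Measurable v) (hV : ∀ t, 0 < t → dualTail p v t ≠ ∞)
    (ρ : Measure ℝ) {t : ℝ} (ht : 0 < t) :
    ρ (Iic t) ^ (q / (p - q)) * supPsi p q r u v t ≤ ENNReal.ofReal ((p - 1) / (p - q)) ^ q *
      intIoi (fun s => intIoi (testFun p q v ρ) s ^ r * u s) t ^ (q / r) := by
  have hpq : 0 < p - q := by linarith
  rw [supPsi, essSupIoi, ← ENNReal.essSup_const_mul]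
  refine essSup_le_of_ae_le _ ?_
  filter_upwards [ae_restrict_mem measurableSet_Ioi] with y hy
  have hy0 : 0 < y := ht.trans hy
  have h1 := ENNReal.rpow_le_rpow (le_intIoi_testFun hp hqp hv ρ (hV y hy0)) hq.le
  rw [ENNReal.mul_rpow_of_nonneg _ _ hq.le, ENNReal.mul_rpow_of_nonneg _ _ hq.le,
    ← ENNReal.rpow_mul, ← ENNReal.rpow_mul, one_div_mul_eq_div, div_mul_eq_mul_div] at h1
  calc ρ (Iic t) ^ (q / (p - q)) *
        (intIoo u t y ^ (q / r) * dualTail p v y ^ ((p - 1) * q / (p - q)))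
      ≤ ρ (Iic y) ^ (q / (p - q)) *
        (intIoo u t y ^ (q / r) * dualTail p v y ^ ((p - 1) * q / (p - q))) := by
        refine mul_le_mul_left (ENNReal.rpow_le_rpow (measure_mono ?_) (by positivity)) _
        exact Iic_subset_Iic.2 (le_of_lt hy)
    _ = intIoo u t y ^ (q / r) *
        (ρ (Iic y) ^ (q / (p - q)) * dualTail p v y ^ ((p - 1) * q / (p - q))) := by ring
    _ ≤ intIoo u t y ^ (q / r) * (ENNReal.ofReal ((p - 1) / (p - q)) ^ q *
          intIoi (testFun p q v ρ) y ^ q) := mul_le_mul_right h1 _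
    _ = ENNReal.ofReal ((p - 1) / (p - q)) ^ q *
          (intIoi (testFun p q v ρ) y ^ q * intIoo u t y ^ (q / r)) := by ring
    _ ≤ _ := mul_le_mul_right (rpow_mul_rpow_intIoo_le hq hr hu _ _ _) _

/-- The discrete form of the bound on `accumInt`. The test functions belong to finitely supported
truncations of the atomic measure of block masses, for which the characterizing quantity `hardyInt`
is finite and can be absorbed. -/
lemma exists_tsum_supPsi_le (p q r : ℝ) (hp : 1 < p) (hq : 0 < q) (hqp : q < p) (hr : 0 < r)
    (M : ℝ≥0∞) (hM : 2 ≤ M) (hMt : M ≠ ∞) :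
    ∃ C : ℝ≥0∞, C ≠ ∞ ∧ ∀ u v w c x, Measurable u → (∀ t, 0 < u t) → Measurable v →
      (∀ t, 0 < v t) → Measurable w → (∀ t, 0 < w t) → IterBound p q r u v w c → c ≠ ∞ →
      IsGeometric w M x →
      ∑' k, intIoo w 0 (x k) * (atomic (blockMass q r u w x) x (Iic (x k)) ^ (q / (p - q)) *
        supPsi p q r u v (x k)) ≤ C * c ^ (p * q / (p - q)) := by
  have hp0 : 0 < p := by linarith
  have hpq : 0 < p - q := by linarith
  have hp1 : 0 < p - 1 := by linarith
  have hθ : 0 < q / r := by positivity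
  have ha : 0 < q / (p - q) := by positivity
  have hpow : ∀ {a : ℝ≥0∞} {s : ℝ}, 0 ≤ s → a ≠ ∞ → a ^ s ≠ ∞ := fun hs ha =>
    ENNReal.rpow_ne_top_of_nonneg hs ha
  obtain ⟨K₀, hK₀⟩ := hardyInt_rpow_le p q hp hq hqp
  set C₁ : ℝ≥0∞ := ENNReal.ofReal ((p - 1) / (p - q)) ^ q with hC₁
  set C₂ : ℝ≥0∞ := 2 ^ (p / (p - q)) * ENNReal.ofReal ((p - 1) * q / (p - q))⁻¹ with hC₂
  have hC₁t : C₁ ≠ ∞ := hpow hq.le ENNReal.ofReal_ne_top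
  have hC₂t : C₂ ≠ ∞ := ENNReal.mul_ne_top (two_rpow_ne_top (by positivity)) ENNReal.ofReal_ne_top
  have h2Mt : 2 * M ≠ ∞ := ENNReal.mul_ne_top (by norm_num) hMt
  refine ⟨C₁ * 2 * (C₂ ^ (q / p) * (K₀ * (2 * M)) ^ (q / (p - q))),
    ENNReal.mul_ne_top (ENNReal.mul_ne_top hC₁t (by norm_num))
      (ENNReal.mul_ne_top (hpow (by positivity) hC₂t)
        (hpow ha.le (ENNReal.mul_ne_top ENNReal.coe_ne_top h2Mt))), ?_⟩
  intro u v w c x hu hu0 hv hv0 hw hw0 hC hc hx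
  have hV : ∀ t, 0 < t → dualTail p v t ≠ ∞ := fun t ht =>
    hC.dualTail_ne_top hc hp hq hr hu hu0 hv hw hw0 ht
  set β := blockMass q r u w x with hβ
  set W : ℕ → ℝ≥0∞ := fun k => intIoo w 0 (x k) with hW
  have hn : ∀ n, ∑' k, W k * (atomic (truncSeq β n) x (Iic (x k)) ^ (q / (p - q)) *
      supPsi p q r u v (x k)) ≤
      C₁ * 2 * (C₂ ^ (q / p) * (K₀ * (2 * M)) ^ (q / (p - q))) * c ^ (p * q / (p - q)) := by
    intro n
    set ρ := atomic (truncSeq β n) x with hρ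
    set g := testFun p q v ρ with hg
    have hgm : Measurable g := measurable_testFun hv ρ
    have hρ0 : ρ (Iic 0) = 0 := atomic_Iic_zero _ hx.pos
    have hDt : hardyInt p q v ρ 0 ≠ ∞ := hardyInt_truncSeq_ne_top hp hq hqp β hx.anti hx.pos hV n
    -- the masses are such that the iterated inequality contains Hardy's inequality for `ρ`
    have hstep : ∫⁻ t in Ioi 0, intIoi g t ^ q ∂ρ ≤
        2 * M * c ^ q * intIoi (fun y => g y ^ p * v y) 0 ^ (q / p) := by
      rw [hρ, setLIntegral_atomic _ hx.pos]
      calc _ ≤ ∑' k, M * (W (k + 1) *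
            intIoi (fun s => intIoi g s ^ r * u s) (x (k + 1)) ^ (q / r)) := by
            refine ENNReal.tsum_le_tsum fun k => (mul_le_mul_left (truncSeq_le β n k) _).trans ?_
            rw [hβ, blockMass, hx.eq_mul k, mul_assoc, mul_assoc]
            refine mul_le_mul_right (mul_le_mul_right ?_ _) _
            rw [mul_comm]
            exact rpow_mul_rpow_intIoo_le hq hr hu g _ _
        _ ≤ M * (2 * lhsInt q r u w g) := by
            rw [ENNReal.tsum_mul_left]
            exact mul_le_mul_right (tsum_mul_le_lhsInt hq hr u g hw (hx.shift 1) hM) _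
        _ ≤ M * (2 * (c ^ q * intIoi (fun y => g y ^ p * v y) 0 ^ (q / p))) :=
            mul_le_mul_right (mul_le_mul_right (hC g hgm) _) _
        _ = _ := by ring
    have hD := hK₀ v hv hv0 ρ inferInstance 0 _ hρ0 hV hDt hstep
    have hD' : hardyInt p q v ρ 0 ^ (q / p) ≤ (K₀ * (2 * M * c ^ q)) ^ (q / (p - q)) := by
      have := ENNReal.rpow_le_rpow hD ha.le
      rwa [← ENNReal.rpow_mul, show (p - q) / p * (q / (p - q)) = q / p by field_simp] at this
    have hN : intIoi (fun y => g y ^ p * v y) 0 ≤ C₂ * hardyInt p q v ρ 0 :=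
      intIoi_testFun_rpow_le hp hq hqp hv hv0 ρ hρ0 hV
    calc _ ≤ ∑' k, C₁ * (W k * intIoi (fun s => intIoi g s ^ r * u s) (x k) ^ (q / r)) := by
          refine ENNReal.tsum_le_tsum fun k => ?_
          rw [mul_left_comm C₁]
          exact mul_le_mul_right (rpow_mul_supPsi_le hp hq hqp hr hu hv hV ρ (hx.pos k)) _
      _ ≤ C₁ * (2 * lhsInt q r u w g) := by
          rw [ENNReal.tsum_mul_left]
          exact mul_le_mul_right (tsum_mul_le_lhsInt hq hr u g hw hx hM) _
      _ ≤ C₁ * (2 * (c ^ q * (C₂ * hardyInt p q v ρ 0) ^ (q / p))) := by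
          refine mul_le_mul_right (mul_le_mul_right ((hC g hgm).trans
            (mul_le_mul_right ?_ _)) _) _
          exact ENNReal.rpow_le_rpow hN (by positivity)
      _ ≤ C₁ * (2 * (c ^ q * (C₂ ^ (q / p) * (K₀ * (2 * M * c ^ q)) ^ (q / (p - q))))) := by
          rw [ENNReal.mul_rpow_of_nonneg C₂ _ (by positivity : 0 ≤ q / p)]
          gcongr
      _ = C₁ * 2 * (C₂ ^ (q / p) * (K₀ * (2 * M)) ^ (q / (p - q))) *
            (c ^ q * (c ^ q) ^ (q / (p - q))) := by
          rw [← mul_assoc (K₀ : ℝ≥0∞), ENNReal.mul_rpow_of_nonneg _ (c ^ q) ha.le]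
          ring
      _ = _ := by
          rw [← ENNReal.rpow_mul, ← ENNReal.rpow_add_of_nonneg _ _ hq.le (by positivity)]
          congr 2
          field_simp
          ring
  have hsup : ∀ k, W k * (atomic β x (Iic (x k)) ^ (q / (p - q)) * supPsi p q r u v (x k)) =
      ⨆ n, W k * (atomic (truncSeq β n) x (Iic (x k)) ^ (q / (p - q)) *
        supPsi p q r u v (x k)) := fun k => by
    rw [← iSup_atomic_Iic β hx.anti, iSup_rpow _ ha, ENNReal.iSup_mul, ENNReal.mul_iSup]
  have hmono : Monotone fun n k => W k * (atomic (truncSeq β n) x (Iic (x k)) ^ (q / (p - q)) *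
      supPsi p q r u v (x k)) := by
    intro m n hmn k
    refine mul_le_mul_right (mul_le_mul_left (ENNReal.rpow_le_rpow ?_ ha.le) _) _
    rw [atomic_Iic _ hx.anti, atomic_Iic _ hx.anti]
    exact ENNReal.tsum_le_tsum fun j => truncSeq_mono β _ hmn
  refine (tsum_congr hsup).trans_le ?_
  rw [← lintegral_count, lintegral_iSup (fun n => measurable_of_countable _) hmono]
  exact iSup_le fun n => (lintegral_count _).trans_le (hn n)

lemma intIoo_eq_sum_range (hx : StrictAnti x) (f : ℝ → ℝ≥0∞) (k j : ℕ) :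
    intIoo f (x (j + k)) (x k) =
      ∑ i ∈ Finset.range j, intIoo f (x (i + k + 1)) (x (i + k)) := by
  induction j with
  | zero => rw [Nat.zero_add, intIoo_eq_zero f le_rfl]; simp
  | succ j ih =>
    rcases Nat.eq_zero_or_pos j with rfl | hj
    · simp [Nat.add_comm]
    · rw [Finset.sum_range_succ, ← ih, add_comm (intIoo f _ _), Nat.add_right_comm]
      exact intIoo_eq_add f (hx.antitone (Nat.le_succ (j + k))) (hx (show k < j + k by omega))

/-- The function `accum` at the points `x k` is controlled by the block masses up to `x k`. -/
lemma accum_le_atomic (hq : 0 < q) (hr : 0 < r) (hw : Measurable w)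
    (hx : IsGeometric w (2 ^ (q / r + 1)) x) (k : ℕ) :
    accum q r u w (x k) ≤ 2 ^ (q / r + 1) * atomic (blockMass q r u w x) x (Iic (x k)) := by
  have hθ : 0 < q / r := by positivity
  have hxk := hx.shift k
  have h1 : accum q r u w (x k) ≤ ∑' j, intIoo w 0 (x (j + k)) *
      (∑ i ∈ Finset.range (j + 1), intIoo u (x (i + k + 1)) (x (i + k))) ^ (q / r) := by
    have h0 := hxk.lintegral_le_tsum fun s => w s * intIoo u s (x k) ^ (q / r)
    simp only [Nat.zero_add] at h0
    refine h0.trans (ENNReal.tsum_le_tsum fun j => ?_)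
    calc _ ≤ ∫⁻ s in Ioo (x (j + 1 + k)) (x (j + k)),
          w s * intIoo u (x (j + 1 + k)) (x k) ^ (q / r) := by
          refine setLIntegral_mono' measurableSet_Ioo fun s hs => ?_
          exact mul_le_mul_right (ENNReal.rpow_le_rpow (intIoo_anti_left u _ hs.1.le) hθ.le) _
      _ ≤ intIoo w 0 (x (j + k)) * intIoo u (x (j + 1 + k)) (x k) ^ (q / r) := by
          rw [lintegral_mul_const _ hw]
          exact mul_le_mul_left (lintegral_mono_set (Ioo_subset_Ioo_left (hx.pos _).le)) _
      _ = _ := by rw [intIoo_eq_sum_range hx.anti]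
  refine h1.trans ((tsum_mul_partialSum_rpow_le hθ.le (fun j => intIoo w 0 (x (j + k)))
    (fun i => intIoo u (x (i + k + 1)) (x (i + k))) fun j => ?_).trans ?_)
  · rw [hx.eq_mul (j + k), Nat.add_right_comm]
  · rw [atomic_Iic _ hx.anti]; exact le_rfl

lemma accum_le_add (hq : 0 < q) (hr : 0 < r) (hw : Measurable w) {s t : ℝ} (hs : 0 ≤ s)
    (hst : s < t) :
    accum q r u w t ≤ 2 ^ (q / r) * (accum q r u w s + intIoo w 0 t * intIoo u s t ^ (q / r)) := by
  have hθ : 0 < q / r := by positivity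
  have h2 : (1 : ℝ≥0∞) ≤ 2 ^ (q / r) := (one_lt_two_rpow hθ).le
  have hm : ∀ b, Measurable fun y => w y * intIoo u y b ^ (q / r) := fun b =>
    hw.mul ((measurable_intIoo_left u b).pow_const _)
  have e1 : intIoo (fun y => w y * intIoo u y t ^ (q / r)) 0 s ≤
      2 ^ (q / r) * (accum q r u w s + intIoo w 0 s * intIoo u s t ^ (q / r)) := by
    rw [accum, intIoo, intIoo, intIoo, ← lintegral_mul_const _ hw, ← lintegral_add_left (hm s),
      ← lintegral_const_mul' _ _ (two_rpow_ne_top hθ.le)]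
    refine setLIntegral_mono' measurableSet_Ioo fun y hy => ?_
    rw [intIoo_eq_add u hy.2.le hst]
    calc _ ≤ w y * (2 ^ (q / r) * (intIoo u y s ^ (q / r) + intIoo u s t ^ (q / r))) :=
          mul_le_mul_right (add_rpow_le hθ.le _ _) _
      _ = _ := by simp only [intIoo]; ring
  have e2 : intIoo (fun y => w y * intIoo u y t ^ (q / r)) s t ≤
      intIoo w s t * intIoo u s t ^ (q / r) := by
    rw [intIoo, intIoo, ← lintegral_mul_const _ hw]
    refine setLIntegral_mono' measurableSet_Ioo fun y hy => ?_
    exact mul_le_mul_right (ENNReal.rpow_le_rpow (intIoo_anti_left u t hy.1.le) hθ.le) _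
  rw [accum, intIoo_eq_add _ hs hst]
  calc _ ≤ 2 ^ (q / r) * (accum q r u w s + intIoo w 0 s * intIoo u s t ^ (q / r)) +
        2 ^ (q / r) * (intIoo w s t * intIoo u s t ^ (q / r)) :=
        add_le_add e1 (e2.trans (le_mul_of_one_le_left zero_le h2))
    _ = _ := by rw [intIoo_eq_add w hs hst]; ring

end NecessityAccum

lemma intIoi_le_of_forall_intIoo_le {f : ℝ → ℝ≥0∞} {B : ℝ≥0∞}
    (h : ∀ T, 0 < T → intIoo f 0 T ≤ B) : intIoi f 0 ≤ B := by
  have hmono : Monotone fun n : ℕ => Ioo (0 : ℝ) (n + 1) := fun m n hmn =>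
    Ioo_subset_Ioo_right (by gcongr)
  have hU : Ioi (0 : ℝ) ⊆ ⋃ n : ℕ, Ioo (0 : ℝ) (n + 1) := by
    intro y hy
    obtain ⟨n, hn⟩ := exists_nat_gt y
    exact mem_iUnion.2 ⟨n, hy, by linarith⟩
  calc intIoi f 0 ≤ ∫⁻ s in ⋃ n : ℕ, Ioo (0 : ℝ) (n + 1), f s := lintegral_mono_set hU
    _ = ⨆ n : ℕ, ∫⁻ s in Ioo (0 : ℝ) (n + 1), f s :=
      setLIntegral_iUnion_of_directed f hmono.directed_le
    _ ≤ B := iSup_le fun n => h _ (by positivity)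

/-- The products `(∫_s^t u)^{1/r} (∫_t^x u)^{1/r} V(x)^{1/p'}`, with suitable powers, are controlled
by the Hardy constant on `(s,∞)` because both integrals are at most `∫_s^x u`. -/
lemma rpow_mul_supPsi_le_rpow {p q r : ℝ} (hp : 1 < p) (hq : 0 < q) (hqp : q < p) (hr : 0 < r)
    {u v S : ℝ → ℝ≥0∞} {K : ℝ≥0} (hS : IsHardyConst p r u v S K) (hu : Measurable u)
    (hv : Measurable v) {s t : ℝ} (hs : 0 < s) (hst : s ≤ t) :
    (intIoo u s t ^ (q / r)) ^ (q / (p - q)) * supPsi p q r u v t ≤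
      K ^ (p * q / (p - q)) * S s ^ (p * q / (p - q)) := by
  have hp0 : 0 < p := by linarith
  have hpq : 0 < p - q := by linarith
  have hp1 : 0 < p - 1 := by linarith
  rw [supPsi, essSupIoi, ← ENNReal.essSup_const_mul]
  refine essSup_le_of_ae_le _ ?_
  filter_upwards [ae_restrict_mem measurableSet_Ioi] with y hy
  have hUV := ENNReal.rpow_le_rpow (hS.rpow_mul_rpow_le hp hr hu hv hs (hst.trans_lt hy))
    (show 0 ≤ p * q / (p - q) by positivity)
  have e2 : 1 / p.conjExponent * (p * q / (p - q)) = (p - 1) * q / (p - q) := by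
    rw [Real.conjExponent]; field_simp
  rw [ENNReal.mul_rpow_of_nonneg _ _ (by positivity), ENNReal.mul_rpow_of_nonneg _ _
    (by positivity), ← ENNReal.rpow_mul, ← ENNReal.rpow_mul, e2,
    show 1 / r * (p * q / (p - q)) = q / r * (q / (p - q)) + q / r by field_simp; ring,
    ENNReal.rpow_add_of_nonneg _ _ (by positivity) (by positivity)] at hUV
  refine le_trans ?_ hUV
  rw [← ENNReal.rpow_mul, ← mul_assoc]
  refine mul_le_mul_left (mul_le_mul' (ENNReal.rpow_le_rpow ?_ (by positivity))
    (ENNReal.rpow_le_rpow ?_ (by positivity))) _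
  · exact intIoo_mono_right u s (le_of_lt hy)
  · exact intIoo_anti_left u y hst

/-- Necessity in the case `q < p`: on each interval `(x (k + 1), x k)` the two integrands are
compared with their values at `x (k + 1)`, which the discrete bounds control. -/
theorem exists_weightInt_accumInt_le (p q r : ℝ) (hp : 1 < p) (hq : 0 < q) (hqp : q < p)
    (hr : 0 < r) (K : ℝ≥0) :
    ∃ C : ℝ≥0∞, C ≠ ∞ ∧ ∀ u v w S c, Measurable u → (∀ t, 0 < u t) → Measurable v →
      (∀ t, 0 < v t) → Measurable w → (∀ t, 0 < w t) → (∀ t, intIoo w 0 t ≠ ∞) →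
      IsHardyConst p r u v S K → IterBound p q r u v w c → c ≠ ∞ →
      weightInt p q w S ≤ C * c ^ (p * q / (p - q)) ∧
      accumInt p q r u v w ≤ C * c ^ (p * q / (p - q)) := by
  have hp0 : 0 < p := by linarith
  have hpq : 0 < p - q := by linarith
  have hθ : 0 < q / r := by positivity
  have ha : 0 ≤ q / (p - q) := by positivity
  set a := q / (p - q) with ha_def
  set e := p * q / (p - q) with he_def
  have he : 0 < e := by positivity
  set M : ℝ≥0∞ := 2 ^ (q / r + 1) with hM
  have hMt : M ≠ ∞ := two_rpow_ne_top (by positivity)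
  have h2M : 2 ≤ M := two_le_two_rpow hθ.le
  have h1M : 1 < M := one_lt_two_rpow (by positivity)
  have hpow : ∀ {a : ℝ≥0∞} {s : ℝ}, 0 ≤ s → a ≠ ∞ → a ^ s ≠ ∞ := fun hs ha =>
    ENNReal.rpow_ne_top_of_nonneg hs ha
  have hae : a + 1 = p / (p - q) := by rw [ha_def]; field_simp; ring
  obtain ⟨C₀, hC₀t, hC₀⟩ := exists_tsum_supPsi_le p q r hp hq hqp hr M h2M hMt
  set C₁ : ℝ≥0∞ := M ^ (p / (p - q)) * ((2 * K) ^ q * 2) ^ (p / (p - q)) with hC₁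
  have hC₁t : C₁ ≠ ∞ := ENNReal.mul_ne_top (hpow (by positivity) hMt) (hpow (by positivity)
    (ENNReal.mul_ne_top (hpow hq.le (ENNReal.mul_ne_top (by norm_num) ENNReal.coe_ne_top))
      (by norm_num)))
  set C₂ : ℝ≥0∞ := (2 ^ (q / r)) ^ a * 2 ^ a * (M ^ a * M * C₀ + K ^ e * C₁) with hC₂
  have hC₂t : C₂ ≠ ∞ := ENNReal.mul_ne_top
    (ENNReal.mul_ne_top (hpow ha (two_rpow_ne_top hθ.le)) (two_rpow_ne_top ha))
    (ENNReal.add_ne_top.2 ⟨ENNReal.mul_ne_top (ENNReal.mul_ne_top (hpow ha hMt) hMt) hC₀t,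
      ENNReal.mul_ne_top (hpow he.le ENNReal.coe_ne_top) hC₁t⟩)
  refine ⟨C₁ + C₂, ENNReal.add_ne_top.2 ⟨hC₁t, hC₂t⟩, ?_⟩
  intro u v w S c hu hu0 hv hv0 hw hw0 hWfin hS hC hc
  -- the discrete sum associated with `weightInt`
  have hsum : ∀ x, IsGeometric w M x →
      ∑' k, intIoo w 0 (x k) ^ (p / (p - q)) * S (x (k + 1)) ^ e ≤ C₁ * c ^ e := by
    intro x hx
    have h1 := ENNReal.rpow_le_rpow (hC.tsum_weight_le hc hp hq hqp hr hv hw hw0 hWfin hS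
      (hx.shift 1) h2M) (show 0 ≤ p / (p - q) by positivity)
    rw [← ENNReal.rpow_mul, show (p - q) / p * (p / (p - q)) = 1 by field_simp,
      ENNReal.rpow_one, ENNReal.mul_rpow_of_nonneg _ (c ^ q) (by positivity), ← ENNReal.rpow_mul,
      show q * (p / (p - q)) = e by rw [he_def]; ring] at h1
    calc _ = M ^ (p / (p - q)) * ∑' k, intIoo w 0 (x (k + 1)) ^ (p / (p - q)) *
          S (x (k + 1)) ^ e := by
          rw [← ENNReal.tsum_mul_left]
          refine tsum_congr fun k => ?_
          rw [hx.eq_mul k, ENNReal.mul_rpow_of_nonneg _ _ (by positivity), mul_assoc]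
      _ ≤ _ := by
          rw [hC₁, mul_assoc]
          exact mul_le_mul_right h1 _
  constructor
  · refine intIoi_le_of_forall_intIoo_le fun T hT => ?_
    obtain ⟨x, hx0, hx⟩ := exists_isGeometric hw hw0 h1M hMt hT (hWfin T)
    rw [← hx0]
    refine (hx.lintegral_le_tsum _).trans ((ENNReal.tsum_le_tsum fun k => ?_).trans
      ((hsum x hx).trans (mul_le_mul_left le_self_add _)))
    calc _ ≤ ∫⁻ t in Ioo (x (k + 1)) (x k), intIoo w 0 (x k) ^ a * S (x (k + 1)) ^ e * w t := by
          refine setLIntegral_mono' measurableSet_Ioo fun t ht => ?_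
          rw [mul_right_comm]
          exact mul_le_mul_left (mul_le_mul'
            (ENNReal.rpow_le_rpow (intIoo_mono_right w 0 ht.2.le) ha)
            (ENNReal.rpow_le_rpow (hS.anti ht.1.le) he.le)) _
      _ ≤ intIoo w 0 (x k) ^ a * S (x (k + 1)) ^ e * intIoo w 0 (x k) := by
          rw [lintegral_const_mul _ hw]
          exact mul_le_mul_right (lintegral_mono_set (Ioo_subset_Ioo_left (hx.pos _).le)) _
      _ = _ := by
          rw [← hae, ENNReal.rpow_add_of_nonneg _ _ ha zero_le_one, ENNReal.rpow_one,
            mul_right_comm]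
  · refine intIoi_le_of_forall_intIoo_le fun T hT => ?_
    obtain ⟨x, hx0, hx⟩ := exists_isGeometric hw hw0 h1M hMt hT (hWfin T)
    set W : ℕ → ℝ≥0∞ := fun k => intIoo w 0 (x k) with hW
    set B : ℕ → ℝ≥0∞ := fun k => atomic (blockMass q r u w x) x (Iic (x k)) with hB
    have hR := hC₀ u v w c x hu hu0 hv hv0 hw hw0 hC hc hx
    have hterm : ∀ k, ∫⁻ t in Ioo (x (k + 1)) (x k), accum q r u w t ^ a * w t *
        supPsi p q r u v t ≤ (2 ^ (q / r)) ^ a * 2 ^ a *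
          (M ^ a * M * (W (k + 1) * (B (k + 1) ^ a * supPsi p q r u v (x (k + 1)))) +
            K ^ e * (W k ^ (p / (p - q)) * S (x (k + 1)) ^ e)) := by
      intro k
      have hpt : ∀ t ∈ Ioo (x (k + 1)) (x k), accum q r u w t ^ a * w t * supPsi p q r u v t ≤
          (2 ^ (q / r)) ^ a * 2 ^ a *
            (M ^ a * (B (k + 1) ^ a * supPsi p q r u v (x (k + 1))) +
              K ^ e * (W k ^ a * S (x (k + 1)) ^ e)) * w t := by
        intro t ht
        rw [mul_right_comm]
        refine mul_le_mul_left ?_ _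
        have h1 : accum q r u w t ≤ 2 ^ (q / r) * (M * B (k + 1) +
            W k * intIoo u (x (k + 1)) t ^ (q / r)) := by
          refine (accum_le_add hq hr hw (hx.pos (k + 1)).le ht.1).trans ?_
          refine mul_le_mul_right (add_le_add (accum_le_atomic hq hr hw hx _)
            (mul_le_mul_left (intIoo_mono_right w 0 ht.2.le) _)) _
        have h2 : accum q r u w t ^ a ≤ (2 ^ (q / r)) ^ a * (2 ^ a * (M ^ a * B (k + 1) ^ a +
            W k ^ a * (intIoo u (x (k + 1)) t ^ (q / r)) ^ a)) := by
          refine (ENNReal.rpow_le_rpow h1 ha).trans ?_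
          rw [ENNReal.mul_rpow_of_nonneg _ _ ha]
          refine mul_le_mul_right ((add_rpow_le ha _ _).trans (le_of_eq ?_)) _
          rw [ENNReal.mul_rpow_of_nonneg M _ ha, ENNReal.mul_rpow_of_nonneg (W k) _ ha]
        calc _ ≤ ((2 ^ (q / r)) ^ a * (2 ^ a * (M ^ a * B (k + 1) ^ a +
            W k ^ a * (intIoo u (x (k + 1)) t ^ (q / r)) ^ a))) * supPsi p q r u v t :=
              mul_le_mul_left h2 _
          _ = (2 ^ (q / r)) ^ a * 2 ^ a * (M ^ a * (B (k + 1) ^ a * supPsi p q r u v t) +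
              W k ^ a * ((intIoo u (x (k + 1)) t ^ (q / r)) ^ a * supPsi p q r u v t)) := by ring
          _ ≤ (2 ^ (q / r)) ^ a * 2 ^ a *
              (M ^ a * (B (k + 1) ^ a * supPsi p q r u v (x (k + 1))) +
                W k ^ a * (K ^ e * S (x (k + 1)) ^ e)) := by
              gcongr (2 ^ (q / r)) ^ a * 2 ^ a *
                (M ^ a * (B (k + 1) ^ a * ?_) + W k ^ a * ?_)
              · exact supPsi_anti hq hr u v ht.1.le
              · exact rpow_mul_supPsi_le_rpow hp hq hqp hr hS hu hv (hx.pos _) ht.1.le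
          _ = _ := by ring
      calc _ ≤ _ := setLIntegral_mono' measurableSet_Ioo hpt
        _ ≤ (2 ^ (q / r)) ^ a * 2 ^ a *
            (M ^ a * (B (k + 1) ^ a * supPsi p q r u v (x (k + 1))) +
              K ^ e * (W k ^ a * S (x (k + 1)) ^ e)) * W k := by
            rw [lintegral_const_mul _ hw]
            exact mul_le_mul_right (lintegral_mono_set (Ioo_subset_Ioo_left (hx.pos _).le)) _
        _ = (2 ^ (q / r)) ^ a * 2 ^ a *
            (M ^ a * (W k * (B (k + 1) ^ a * supPsi p q r u v (x (k + 1)))) +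
              K ^ e * (W k ^ a * W k * S (x (k + 1)) ^ e)) := by ring
        _ = _ := by
            rw [← hae, ENNReal.rpow_add_of_nonneg _ _ ha zero_le_one, ENNReal.rpow_one]
            have : W k = M * W (k + 1) := hx.eq_mul k
            conv_lhs => enter [2, 1, 2]; rw [this]
            ring
    rw [← hx0]
    calc _ ≤ _ := hx.lintegral_le_tsum _
      _ ≤ _ := ENNReal.tsum_le_tsum hterm
      _ = (2 ^ (q / r)) ^ a * 2 ^ a *
          (M ^ a * M * ∑' k, W (k + 1) * (B (k + 1) ^ a * supPsi p q r u v (x (k + 1))) +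
            K ^ e * ∑' k, W k ^ (p / (p - q)) * S (x (k + 1)) ^ e) := by
          simp only [ENNReal.tsum_mul_left, ENNReal.tsum_add]
      _ ≤ (2 ^ (q / r)) ^ a * 2 ^ a *
          (M ^ a * M * (C₀ * c ^ e) + K ^ e * (C₁ * c ^ e)) := by
          gcongr (2 ^ (q / r)) ^ a * 2 ^ a * (M ^ a * M * ?_ + K ^ e * ?_)
          · exact (ENNReal.tsum_comp_le_tsum_of_injective (Nat.succ_injective) _).trans hR
          · exact hsum x hx
      _ = C₂ * c ^ e := by rw [hC₂]; ring
      _ ≤ _ := mul_le_mul_left le_add_self _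

/-! ### Passage to the limit in the truncations -/

/-- The bounded weight `min f (n + 1)`, which stays positive for positive `f`. -/
noncomputable def cap (f : ℝ → ℝ≥0∞) (n : ℕ) : ℝ → ℝ≥0∞ := fun x => min (f x) ((n + 1 : ℕ) : ℝ≥0∞)

section Cap

variable {p q r : ℝ} {u v w S f : ℝ → ℝ≥0∞}

lemma measurable_cap (hf : Measurable f) (n : ℕ) : Measurable (cap f n) :=
  hf.min measurable_const

lemma cap_pos (hf : ∀ x, 0 < f x) (n : ℕ) (x : ℝ) : 0 < cap f n x :=
  lt_min (hf x) (Nat.cast_pos.2 n.succ_pos)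

lemma cap_le (f : ℝ → ℝ≥0∞) (n : ℕ) (x : ℝ) : cap f n x ≤ f x := min_le_left _ _

lemma cap_mono (f : ℝ → ℝ≥0∞) : Monotone (cap f) := fun _ _ hmn _ =>
  min_le_min_left _ (Nat.cast_le.2 (Nat.succ_le_succ hmn))

lemma iSup_cap (f : ℝ → ℝ≥0∞) (x : ℝ) : ⨆ n, cap f n x = f x := by
  refine le_antisymm (iSup_le fun n => cap_le f n x) ?_
  have e : f x = ⨆ n : ℕ, min (f x) n := by
    rw [← inf_iSup_eq, ENNReal.iSup_natCast, inf_top_eq]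
  conv_lhs => rw [e]
  exact iSup_mono fun n => min_le_min_left _ (Nat.cast_le.2 n.le_succ)

lemma intIoo_cap_ne_top (f : ℝ → ℝ≥0∞) (n : ℕ) (a b : ℝ) : intIoo (cap f n) a b ≠ ∞ := by
  have : intIoo (cap f n) a b ≤ ((n + 1 : ℕ) : ℝ≥0∞) * volume (Ioo a b) := by
    rw [← setLIntegral_const]
    exact lintegral_mono fun t => min_le_right _ _
  refine ne_top_of_le_ne_top ?_ this
  rw [Real.volume_Ioo]
  exact ENNReal.mul_ne_top (ENNReal.natCast_ne_top _) ENNReal.ofReal_ne_top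

lemma lhsInt_mono_weight (q r : ℝ) (u h : ℝ → ℝ≥0∞) : Monotone fun w => lhsInt q r u w h :=
  fun _ _ hw => lintegral_mono fun x => mul_le_mul_right (hw x) _

lemma iSup_lhsInt_cap (hw : Measurable w) (q r : ℝ) (u h : ℝ → ℝ≥0∞) :
    ⨆ n, lhsInt q r u (cap w n) h = lhsInt q r u w h := by
  unfold lhsInt intIoi
  rw [← lintegral_iSup]
  · exact lintegral_congr fun x => by rw [← ENNReal.mul_iSup, iSup_cap]
  · exact fun n => ((measurable_intIoi _).pow_const _).mul (measurable_cap hw n)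
  · exact fun m n hmn x => mul_le_mul_right (cap_mono w hmn x) _

lemma iSup_intIoo_cap (hw : Measurable w) (a b : ℝ) :
    ⨆ n, intIoo (cap w n) a b = intIoo w a b := by
  unfold intIoo
  rw [← lintegral_iSup (measurable_cap hw) (cap_mono w)]
  exact lintegral_congr fun x => iSup_cap w x

lemma intIoo_mono {f g : ℝ → ℝ≥0∞} (h : f ≤ g) (a b : ℝ) : intIoo f a b ≤ intIoo g a b :=
  lintegral_mono h

lemma accum_mono_weight (q r : ℝ) (u : ℝ → ℝ≥0∞) (t : ℝ) :
    Monotone fun w => accum q r u w t :=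
  fun _ _ hw => lintegral_mono fun x => mul_le_mul_left (hw x) _

lemma iSup_accum_cap (hw : Measurable w) (q r : ℝ) (u : ℝ → ℝ≥0∞) (t : ℝ) :
    ⨆ n, accum q r u (cap w n) t = accum q r u w t := by
  unfold accum
  unfold intIoo
  rw [← lintegral_iSup]
  · exact lintegral_congr fun x => by rw [← ENNReal.iSup_mul, iSup_cap]
  · exact fun n => (measurable_cap hw n).mul ((measurable_intIoo_left u t).pow_const _)
  · exact fun m n hmn x => mul_le_mul_left (cap_mono w hmn x) _

lemma iSup_weightInt_cap (hq : 0 < q) (hqp : q < p) (hw : Measurable w)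
    (hS : Antitone S) : ⨆ n, weightInt p q (cap w n) S = weightInt p q w S := by
  have hpq : 0 < p - q := by linarith
  have := setLIntegral_iSup_rpow_mul (S := Ioi 0) (s := q / (p - q)) (by positivity)
    (F := fun n => intIoo (cap w n) 0) (f := cap w) (Φ := fun t => S t ^ (p * q / (p - q)))
    (fun n => measurable_intIoo_right _ _)
    (fun m n hmn t => intIoo_mono (cap_mono w hmn) _ _) (measurable_cap hw) (cap_mono w)
    (hS.measurable.pow_const _)
  simp_rw [iSup_intIoo_cap hw, iSup_cap] at this
  exact this.symm

lemma iSup_accumInt_cap (hq : 0 < q) (hqp : q < p) (hr : 0 < r)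
    (hw : Measurable w) (u v : ℝ → ℝ≥0∞) :
    ⨆ n, accumInt p q r u v (cap w n) = accumInt p q r u v w := by
  have hpq : 0 < p - q := by linarith
  have := setLIntegral_iSup_rpow_mul (S := Ioi 0) (s := q / (p - q)) (by positivity)
    (F := fun n => accum q r u (cap w n)) (f := cap w) (Φ := supPsi p q r u v)
    (fun n => (accum_mono hq hr u _).measurable)
    (fun m n hmn t => accum_mono_weight q r u t (cap_mono w hmn)) (measurable_cap hw) (cap_mono w)
    (supPsi_anti hq hr u v).measurable
  simp_rw [iSup_accum_cap hw, iSup_cap] at this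
  exact this.symm

lemma iSup_lhsInt_trunc (hq : 0 < q) (hr : 0 < r) (hu : Measurable u) (hw : Measurable w)
    {h : ℝ → ℝ≥0∞} (hh : Measurable h) :
    ⨆ n, lhsInt q r u w (trunc h n) = lhsInt q r u w h := by
  have hθ : 0 < q / r := by positivity
  have h1 : ∀ t, Monotone fun n => intIoi (trunc h n) t ^ r * u t := fun t m n hmn =>
    mul_le_mul_left (ENNReal.rpow_le_rpow (lintegral_mono (trunc_mono h hmn)) hr.le) _
  have h2 : ∀ x, ⨆ n, intIoi (fun t => intIoi (trunc h n) t ^ r * u t) x =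
      intIoi (fun t => intIoi h t ^ r * u t) x := by
    intro x
    unfold intIoi
    rw [← lintegral_iSup]
    · exact lintegral_congr fun t => by
        rw [← ENNReal.iSup_mul, ← iSup_rpow _ hr, iSup_setLIntegral_trunc hh]
    · exact fun n => ((measurable_intIoi _).pow_const _).mul hu
    · exact fun m n hmn t => h1 t hmn
  have h3 : lhsInt q r u w h = intIoi (fun x =>
      ⨆ n, intIoi (fun t => intIoi (trunc h n) t ^ r * u t) x ^ (q / r) * w x) 0 := by
    unfold lhsInt
    congr 1
    ext x
    rw [← ENNReal.iSup_mul, ← iSup_rpow _ hθ, h2]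
  rw [h3, intIoi, lintegral_iSup]
  · rfl
  · exact fun n => ((measurable_intIoi _).pow_const _).mul hw
  · exact fun m n hmn x => mul_le_mul_left (ENNReal.rpow_le_rpow
      (lintegral_mono fun t => h1 t hmn) hθ.le) _

lemma weightSup_mono (hq : 0 < q) (S : ℝ → ℝ≥0∞) : Monotone fun w => weightSup q w S :=
  fun _ _ hw => essSupIoi_mono (fun t => mul_le_mul_left
    (ENNReal.rpow_le_rpow (intIoo_mono hw _ _) (by positivity)) _) _

lemma E₁_mono_weight (p : ℝ) (hq : 0 < q) (r : ℝ) (u v : ℝ → ℝ≥0∞) : Monotone (E₁ p q r u v) :=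
  fun _ _ hw => essSupIoi_mono (fun t => mul_le_mul_left
    (ENNReal.rpow_le_rpow (accum_mono_weight q r u t hw) (by positivity)) _) _

end Cap

/-! ### The two characterizations -/

/-- A bound for truncated functions and bounded weights suffices for the iterated inequality. The
constant has to be nonzero because of the convention `0 * ∞ = 0` on the right-hand side. -/
lemma iterBound_of_cap_trunc {p q r : ℝ} (hp : 0 < p) (hq : 0 < q) (hr : 0 < r)
    {u v w : ℝ → ℝ≥0∞} (hu : Measurable u) (hw : Measurable w) {c : ℝ≥0∞} (hc : c ≠ 0)
    (h : ∀ n h, Measurable h → intIoi h 0 ≠ ∞ → (∃ T, 0 < T ∧ intIoi h T = 0) →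
      intIoi (fun x => h x ^ p * v x) 0 ≠ ∞ →
      lhsInt q r u (cap w n) h ≤ c ^ q * intIoi (fun x => h x ^ p * v x) 0 ^ (q / p)) :
    IterBound p q r u v w c := by
  intro f hf
  rcases eq_or_ne (intIoi (fun x => f x ^ p * v x) 0) ∞ with hN | hN
  · have : c ^ q ≠ 0 := by
      rw [Ne, ENNReal.rpow_eq_zero_iff_of_pos hq]; exact hc
    rw [hN, ENNReal.top_rpow_of_pos (by positivity), ENNReal.mul_top this]
    exact le_top
  rw [← iSup_lhsInt_cap hw]
  refine iSup_le fun n => ?_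
  rw [← iSup_lhsInt_trunc hq hr hu (measurable_cap hw n) hf]
  refine iSup_le fun m => ?_
  have hle : intIoi (fun x => trunc f m x ^ p * v x) 0 ≤ intIoi (fun x => f x ^ p * v x) 0 :=
    lintegral_mono fun x => mul_le_mul_left (ENNReal.rpow_le_rpow (trunc_le f m x) hp.le) _
  refine (h n _ (measurable_trunc hf m) (intIoi_trunc_ne_top f m 0)
    ⟨(m : ℝ) + 1, by positivity, ?_⟩ (ne_top_of_le_ne_top hN hle)).trans
    (mul_le_mul_right (ENNReal.rpow_le_rpow hle (by positivity)) _)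
  rw [intIoi, setLIntegral_congr_fun measurableSet_Ioi (g := 0), Pi.zero_def, lintegral_zero]
  intro t ht
  rw [trunc, indicator_of_notMem]
  · rfl
  · simp only [mem_Ioi, mem_Iio] at ht ⊢
    linarith

lemma IterBound.cap {p q r : ℝ} {u v w : ℝ → ℝ≥0∞} {c : ℝ≥0∞} (hC : IterBound p q r u v w c)
    (n : ℕ) : IterBound p q r u v (cap w n) c := fun h hh =>
  (lhsInt_mono_weight q r u h (cap_le w n)).trans (hC h hh)

/-- The characterization in the case `p ≤ q`, for an arbitrary function `S` comparable to the inner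
Hardy constant. -/
theorem exists_iterBound_iff_of_le (p q r : ℝ) (hp : 1 < p) (hpq : p ≤ q) (hr : 0 < r)
    (K : ℝ≥0) :
    ∃ L : ℝ≥0, 0 < L ∧ ∀ u v w S, Measurable u → (∀ x, 0 < u x) → Measurable v →
      (∀ x, 0 < v x) → Measurable w → (∀ x, 0 < w x) → IsHardyConst p r u v S K →
      (∀ c, L * (E₁ p q r u v w + weightSup q w S) < c → IterBound p q r u v w c) ∧
      (∀ c, c ≠ ∞ → IterBound p q r u v w c →
        E₁ p q r u v w + weightSup q w S ≤ L * c) := by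
  have hp0 : 0 < p := by linarith
  have hq : 0 < q := by linarith
  obtain ⟨C, hCt, hC⟩ := lhsInt_le_of_le p q r hp hpq hr K
  set L : ℝ≥0 := (2 * C.toNNReal) ^ (1 / q) + 1 + K with hL
  have hLC : 2 * C ≤ (L : ℝ≥0∞) ^ q := by
    have h1 : (2 * C) ^ (1 / q) ≤ (L : ℝ≥0∞) := by
      rw [← ENNReal.coe_toNNReal hCt, hL, ENNReal.coe_add, ENNReal.coe_add,
        ENNReal.coe_rpow_of_nonneg _ (by positivity), add_assoc]
      exact le_self_add
    have h2 := ENNReal.rpow_le_rpow h1 hq.le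
    rwa [← ENNReal.rpow_mul, one_div_mul_cancel hq.ne', ENNReal.rpow_one] at h2
  have hL0 : 0 < L := by positivity
  refine ⟨L, hL0, fun u v w S hu hu0 hv hv0 hw hw0 hS => ⟨fun c hc => ?_, fun c hc hB => ?_⟩⟩
  · refine iterBound_of_cap_trunc hp0 hq hr hu hw (ne_bot_of_gt hc)
      fun n h hh hfin hT hN => ?_
    have h1 := hC u v (cap w n) S h hu hv hv0 (measurable_cap hw n) (cap_pos hw0 n)
      (fun t => intIoo_cap_ne_top w n 0 t) hS hh hfin hT hN
    refine h1.trans ?_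
    rw [← mul_assoc]
    refine mul_le_mul_left ?_ _
    set E := E₁ p q r u v w + weightSup q w S with hE
    have h2 : weightSup q (cap w n) S ≤ E :=
      (weightSup_mono hq S (cap_le w n)).trans le_add_self
    have h3 : E₁ p q r u v (cap w n) ≤ E :=
      (E₁_mono_weight p hq r u v (cap_le w n)).trans le_self_add
    calc _ ≤ C * (E ^ q + E ^ q) := by gcongr
      _ = 2 * C * E ^ q := by ring
      _ ≤ (L : ℝ≥0∞) ^ q * E ^ q := mul_le_mul_left hLC _
      _ = (L * E) ^ q := (ENNReal.mul_rpow_of_nonneg _ _ hq.le).symm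
      _ ≤ c ^ q := ENNReal.rpow_le_rpow hc.le hq.le
  · have h1 : E₁ p q r u v w ≤ c := by
      refine essSup_le_of_ae_le _ ?_
      filter_upwards [ae_restrict_mem measurableSet_Ioi] with t ht
      exact hB.accum_mul_dualTail_le hp hq hr hu hv hw (le_of_lt ht)
    have h2 : weightSup q w S ≤ K * c := by
      refine essSup_le_of_ae_le _ ?_
      filter_upwards [ae_restrict_mem measurableSet_Ioi] with t ht
      rw [← iSup_intIoo_cap hw, iSup_rpow _ (by positivity : 0 < 1 / q), ENNReal.iSup_mul]
      exact iSup_le fun n => (hB.cap n).rpow_mul_le hp hq hr (measurable_cap hw n)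
        (cap_pos hw0 n) (fun t => intIoo_cap_ne_top w n 0 t) hS ht
    calc _ ≤ c + K * c := add_le_add h1 h2
      _ = (1 + K) * c := by ring
      _ ≤ L * c := by
        refine mul_le_mul_left ?_ _
        rw [hL, add_assoc, ENNReal.coe_add, ENNReal.coe_add, ENNReal.coe_one]
        exact le_add_self

/-- The characterization in the case `q < p`, for an arbitrary function `S` comparable to the inner
Hardy constant. -/
theorem exists_iterBound_iff_of_lt (p q r : ℝ) (hp : 1 < p) (hq : 0 < q) (hqp : q < p)
    (hr : 0 < r) (K : ℝ≥0) :
    ∃ L : ℝ≥0, 0 < L ∧ ∀ u v w S, Measurable u → (∀ x, 0 < u x) → Measurable v →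
      (∀ x, 0 < v x) → Measurable w → (∀ x, 0 < w x) → IsHardyConst p r u v S K →
      (∀ c, L * (weightInt p q w S ^ ((p - q) / (p * q)) +
        accumInt p q r u v w ^ ((p - q) / (p * q))) < c → IterBound p q r u v w c) ∧
      (∀ c, c ≠ ∞ → IterBound p q r u v w c → weightInt p q w S ^ ((p - q) / (p * q)) +
        accumInt p q r u v w ^ ((p - q) / (p * q)) ≤ L * c) := by
  have hp0 : 0 < p := by linarith
  have hpq : 0 < p - q := by linarith
  have hs : 0 < (p - q) / (p * q) := by positivity
  have hs' : 0 < p * q / (p - q) := by positivity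
  have hα : 0 < (p - q) / p := by positivity
  obtain ⟨C, hCt, hC⟩ := lhsInt_le_of_lt p q r hp hq hqp hr K
  obtain ⟨D, hDt, hD⟩ := exists_weightInt_accumInt_le p q r hp hq hqp hr K
  have h2α : (2 : ℝ≥0∞) ^ ((p - q) / p) ≠ ∞ := two_rpow_ne_top hα.le
  set C' : ℝ≥0∞ := (C * 2 ^ ((p - q) / p)) ^ (1 / q) with hC'
  have hC't : C' ≠ ∞ :=
    ENNReal.rpow_ne_top_of_nonneg (by positivity) (ENNReal.mul_ne_top hCt h2α)
  set D' : ℝ≥0∞ := 2 * D ^ ((p - q) / (p * q)) with hD'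
  have hD't : D' ≠ ∞ :=
    ENNReal.mul_ne_top (by norm_num) (ENNReal.rpow_ne_top_of_nonneg hs.le hDt)
  set L : ℝ≥0 := C'.toNNReal + D'.toNNReal + 1 with hL
  have hLE : (L : ℝ≥0∞) = C' + D' + 1 := by
    rw [hL, ENNReal.coe_add, ENNReal.coe_add, ENNReal.coe_toNNReal hC't,
      ENNReal.coe_toNNReal hD't, ENNReal.coe_one]
  have hLC : C * 2 ^ ((p - q) / p) ≤ (L : ℝ≥0∞) ^ q := by
    have h1 : C' ≤ (L : ℝ≥0∞) := by rw [hLE, add_assoc]; exact le_self_add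
    have h2 := ENNReal.rpow_le_rpow h1 hq.le
    rwa [hC', ← ENNReal.rpow_mul, one_div_mul_cancel hq.ne', ENNReal.rpow_one] at h2
  refine ⟨L, by positivity, fun u v w S hu hu0 hv hv0 hw hw0 hS =>
    ⟨fun c hc => ?_, fun c hc hB => ?_⟩⟩
  · refine iterBound_of_cap_trunc hp0 hq hr hu hw (ne_bot_of_gt hc)
      fun n h hh hfin hT hN => ?_
    have h1 := hC u v (cap w n) S h hu hv hv0 (measurable_cap hw n) (cap_pos hw0 n)
      (fun t => intIoo_cap_ne_top w n 0 t) hS hh hfin hT hN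
    refine h1.trans ?_
    rw [← mul_assoc]
    refine mul_le_mul_left ?_ _
    set E := weightInt p q w S ^ ((p - q) / (p * q)) +
      accumInt p q r u v w ^ ((p - q) / (p * q)) with hE
    have hcancel : ∀ X : ℝ≥0∞, (X ^ ((p - q) / (p * q))) ^ (p * q / (p - q)) = X := fun X => by
      rw [← ENNReal.rpow_mul, show (p - q) / (p * q) * (p * q / (p - q)) = 1 by field_simp,
        ENNReal.rpow_one]
    have h2 : weightInt p q (cap w n) S ≤ E ^ (p * q / (p - q)) := by
      refine (le_iSup (fun n => weightInt p q (cap w n) S) n).trans ?_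
      rw [iSup_weightInt_cap hq hqp hw hS.anti, ← hcancel (weightInt p q w S)]
      exact ENNReal.rpow_le_rpow le_self_add hs'.le
    have h3 : accumInt p q r u v (cap w n) ≤ E ^ (p * q / (p - q)) := by
      refine (le_iSup (fun n => accumInt p q r u v (cap w n)) n).trans ?_
      rw [iSup_accumInt_cap hq hqp hr hw, ← hcancel (accumInt p q r u v w)]
      exact ENNReal.rpow_le_rpow le_add_self hs'.le
    calc _ ≤ C * (E ^ (p * q / (p - q)) + E ^ (p * q / (p - q))) ^ ((p - q) / p) := by gcongr
      _ = C * 2 ^ ((p - q) / p) * E ^ q := by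
          rw [← two_mul, ENNReal.mul_rpow_of_nonneg _ _ hα.le, ← ENNReal.rpow_mul,
            show p * q / (p - q) * ((p - q) / p) = q by field_simp, mul_assoc]
      _ ≤ (L : ℝ≥0∞) ^ q * E ^ q := mul_le_mul_left hLC _
      _ = (L * E) ^ q := (ENNReal.mul_rpow_of_nonneg _ _ hq.le).symm
      _ ≤ c ^ q := ENNReal.rpow_le_rpow hc.le hq.le
  · have hn := fun n => hD u v (cap w n) S c hu hu0 hv hv0 (measurable_cap hw n) (cap_pos hw0 n)
      (fun t => intIoo_cap_ne_top w n 0 t) hS (hB.cap n) hc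
    have hroot : ∀ X : ℝ≥0∞, X ≤ D * c ^ (p * q / (p - q)) →
        X ^ ((p - q) / (p * q)) ≤ D ^ ((p - q) / (p * q)) * c := fun X hX => by
      have := ENNReal.rpow_le_rpow hX hs.le
      rwa [ENNReal.mul_rpow_of_nonneg _ _ hs.le, ← ENNReal.rpow_mul,
        show p * q / (p - q) * ((p - q) / (p * q)) = 1 by field_simp, ENNReal.rpow_one] at this
    have h1 := hroot _ ((iSup_weightInt_cap hq hqp hw hS.anti).symm.trans_le
      (iSup_le fun n => (hn n).1))
    have h2 := hroot _ ((iSup_accumInt_cap hq hqp hr hw u v).symm.trans_le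
      (iSup_le fun n => (hn n).2))
    calc _ ≤ D' * c := by
          rw [hD', mul_assoc, two_mul]
          exact add_le_add h1 h2
      _ ≤ L * c := by
          refine mul_le_mul_left ?_ _
          rw [hLE, add_right_comm]
          exact le_add_self

/-! ### Reduction to everywhere positive Borel weights -/

section Congr

variable {p q r : ℝ} {f g u u' v v' w w' S S' : ℝ → ℝ≥0∞}

lemma IsWeight.exists_measurable_pos (hw : IsWeight w) :
    ∃ w' : ℝ → ℝ≥0∞, Measurable w' ∧ (∀ x, 0 < w' x) ∧ w =ᵐ[volume.restrict (Ioi 0)] w' := by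
  obtain ⟨hm, hpos⟩ := hw
  refine ⟨fun x => if 0 < hm.mk w x then hm.mk w x else 1,
    Measurable.ite (measurableSet_lt measurable_const hm.measurable_mk) hm.measurable_mk
      measurable_const, fun x => ?_, ?_⟩
  · beta_reduce
    split_ifs with h
    · exact h
    · exact one_pos
  · filter_upwards [hpos, hm.ae_eq_mk] with x hx he
    rw [← he, if_pos hx]

lemma intIoi_congr (h : f =ᵐ[volume.restrict (Ioi 0)] g) {a : ℝ} (ha : 0 ≤ a) :
    intIoi f a = intIoi g a :=
  lintegral_congr_ae (ae_restrict_of_ae_restrict_of_subset (Ioi_subset_Ioi ha) h)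

lemma intIoo_congr (h : f =ᵐ[volume.restrict (Ioi 0)] g) {a : ℝ} (ha : 0 ≤ a) (b : ℝ) :
    intIoo f a b = intIoo g a b :=
  lintegral_congr_ae (ae_restrict_of_ae_restrict_of_subset
    (Ioo_subset_Ioi_self.trans (Ioi_subset_Ioi ha)) h)

lemma dualTail_congr (hv : v =ᵐ[volume.restrict (Ioi 0)] v') (p : ℝ) {t : ℝ} (ht : 0 ≤ t) :
    dualTail p v t = dualTail p v' t := by
  refine intIoi_congr ?_ ht
  filter_upwards [hv] with x hx
  rw [hx]

lemma accum_congr (hu : u =ᵐ[volume.restrict (Ioi 0)] u')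
    (hw : w =ᵐ[volume.restrict (Ioi 0)] w') (q r t : ℝ) :
    accum q r u w t = accum q r u' w' t := by
  refine intIoo_congr ?_ le_rfl t
  filter_upwards [hw, ae_restrict_mem measurableSet_Ioi] with s hs hs0
  rw [hs, intIoo_congr hu (le_of_lt hs0)]

lemma E₁_congr (hu : u =ᵐ[volume.restrict (Ioi 0)] u') (hv : v =ᵐ[volume.restrict (Ioi 0)] v')
    (hw : w =ᵐ[volume.restrict (Ioi 0)] w') (p q r : ℝ) :
    E₁ p q r u v w = E₁ p q r u' v' w' := by
  refine essSup_congr_ae ?_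
  filter_upwards [ae_restrict_mem measurableSet_Ioi] with t ht
  have := accum_congr hu hw q r t
  unfold accum at this
  rw [this, dualTail_congr hv p (le_of_lt ht)]

lemma supPsi_congr (hu : u =ᵐ[volume.restrict (Ioi 0)] u')
    (hv : v =ᵐ[volume.restrict (Ioi 0)] v') (p q r : ℝ) {t : ℝ} (ht : 0 ≤ t) :
    supPsi p q r u v t = supPsi p q r u' v' t := by
  refine essSup_congr_ae ?_
  filter_upwards [ae_restrict_mem measurableSet_Ioi] with x hx
  rw [intIoo_congr hu ht, dualTail_congr hv p (ht.trans (le_of_lt hx))]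

lemma supConst_congr (hu : u =ᵐ[volume.restrict (Ioi 0)] u')
    (hv : v =ᵐ[volume.restrict (Ioi 0)] v') (p r : ℝ) {t : ℝ} (ht : 0 ≤ t) :
    supConst p r u v t = supConst p r u' v' t := by
  refine essSup_congr_ae ?_
  filter_upwards [ae_restrict_mem measurableSet_Ioi] with x hx
  rw [intIoo_congr hu ht, dualTail_congr hv p (ht.trans (le_of_lt hx))]

lemma intConst_congr (hu : u =ᵐ[volume.restrict (Ioi 0)] u')
    (hv : v =ᵐ[volume.restrict (Ioi 0)] v') (p r : ℝ) {t : ℝ} (ht : 0 ≤ t) :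
    intConst p r u v t = intConst p r u' v' t := by
  unfold intConst
  congr 1
  refine lintegral_congr_ae ?_
  filter_upwards [ae_restrict_of_ae_restrict_of_subset (Ioi_subset_Ioi ht) hu,
    ae_restrict_mem measurableSet_Ioi] with x hx hx0
  rw [hx, intIoo_congr hu ht, dualTail_congr hv p (ht.trans (le_of_lt hx0))]

lemma weightInt_congr (hw : w =ᵐ[volume.restrict (Ioi 0)] w') (hS : ∀ t, 0 < t → S t = S' t)
    (p q : ℝ) : weightInt p q w S = weightInt p q w' S' := by
  refine intIoi_congr ?_ le_rfl
  filter_upwards [hw, ae_restrict_mem measurableSet_Ioi] with t ht ht0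
  rw [ht, hS t ht0, intIoo_congr hw le_rfl]

lemma weightSup_congr (hw : w =ᵐ[volume.restrict (Ioi 0)] w') (hS : ∀ t, 0 < t → S t = S' t)
    (q : ℝ) : weightSup q w S = weightSup q w' S' := by
  refine essSup_congr_ae ?_
  filter_upwards [ae_restrict_mem measurableSet_Ioi] with t ht0
  rw [hS t ht0, intIoo_congr hw le_rfl]

lemma accumInt_congr (hu : u =ᵐ[volume.restrict (Ioi 0)] u')
    (hv : v =ᵐ[volume.restrict (Ioi 0)] v') (hw : w =ᵐ[volume.restrict (Ioi 0)] w')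
    (p q r : ℝ) : accumInt p q r u v w = accumInt p q r u' v' w' := by
  refine intIoi_congr ?_ le_rfl
  filter_upwards [hw, ae_restrict_mem measurableSet_Ioi] with t ht ht0
  rw [ht, accum_congr hu hw, supPsi_congr hu hv p q r (le_of_lt ht0)]

lemma lhsInt_congr {h h' : ℝ → ℝ≥0∞} (hu : u =ᵐ[volume.restrict (Ioi 0)] u')
    (hw : w =ᵐ[volume.restrict (Ioi 0)] w') (hh : h =ᵐ[volume.restrict (Ioi 0)] h') (q r : ℝ) :
    lhsInt q r u w h = lhsInt q r u' w' h' := by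
  refine intIoi_congr ?_ le_rfl
  filter_upwards [hw, ae_restrict_mem measurableSet_Ioi] with x hx hx0
  rw [hx]
  congr 2
  refine intIoi_congr ?_ (le_of_lt hx0)
  filter_upwards [hu, ae_restrict_mem measurableSet_Ioi] with t ht ht0
  rw [ht, intIoi_congr hh (le_of_lt ht0)]

lemma holdsWith_iff_iterBound (hq : 0 < q)
    (hu : u =ᵐ[volume.restrict (Ioi 0)] u') (hv : v =ᵐ[volume.restrict (Ioi 0)] v')
    (hw : w =ᵐ[volume.restrict (Ioi 0)] w') (c : ℝ≥0∞) :
    HoldsWith p q r u v w c ↔ IterBound p q r u' v' w' c := by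
  have key : ∀ h h' : ℝ → ℝ≥0∞, h =ᵐ[volume.restrict (Ioi 0)] h' →
      (lhs q r u w h ≤ c * rhsNorm p v h ↔
        lhsInt q r u' w' h' ≤ c ^ q * intIoi (fun x => h' x ^ p * v' x) 0 ^ (q / p)) := by
    intro h h' hh
    have e1 : lhs q r u w h = lhsInt q r u' w' h' ^ (1 / q) := by
      rw [← lhsInt_congr hu hw hh]; rfl
    have e2 : rhsNorm p v h = intIoi (fun x => h' x ^ p * v' x) 0 ^ (1 / p) := by
      unfold rhsNorm
      congr 1
      refine intIoi_congr ?_ le_rfl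
      filter_upwards [hv, hh] with x hx hx'
      rw [hx, hx']
    rw [e1, e2, one_div q, ENNReal.rpow_inv_le_iff hq, ENNReal.mul_rpow_of_nonneg _ _ hq.le,
      ← ENNReal.rpow_mul, one_div_mul_eq_div]
  constructor
  · exact fun H h hh => (key h h .rfl).1 (H h hh.aemeasurable)
  · exact fun H h hh => (key h _ hh.ae_eq_mk).2 (H _ hh.measurable_mk)

end Congr

/-! ### The best constant -/

/-- The infimum defining `bestConst` need not be attained: with constant `0` the right-hand side is
`0` even for functions of infinite norm. Hence `hsuff` only asks for constants above `L * E`. -/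
lemma bestConst_equiv {p q r : ℝ} {u v w : ℝ → ℝ≥0∞} {E : ℝ≥0∞} {L : ℝ≥0} (hL : 0 < L)
    (hsuff : ∀ c, L * E < c → HoldsWith p q r u v w c)
    (hnec : ∀ c, c ≠ ∞ → HoldsWith p q r u v w c → E ≤ L * c) :
    (Holds p q r u v w ↔ E < ∞) ∧ bestConst p q r u v w ≤ L * E ∧
      E ≤ L * bestConst p q r u v w := by
  have hL0 : (L : ℝ≥0∞) ≠ 0 := by exact_mod_cast hL.ne'
  refine ⟨⟨fun ⟨C, hC⟩ => ?_, fun hE => ?_⟩, ?_, ?_⟩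
  · exact (hnec C ENNReal.coe_ne_top hC).trans_lt
      (ENNReal.mul_lt_top ENNReal.coe_lt_top ENNReal.coe_lt_top)
  · obtain ⟨C, hC, -⟩ := ENNReal.lt_iff_exists_nnreal_btwn.1
      (ENNReal.mul_lt_top ENNReal.coe_lt_top hE : (L : ℝ≥0∞) * E < ∞)
    exact ⟨C, hsuff C hC⟩
  · exact le_of_forall_gt_imp_ge_of_dense fun c hc => sInf_le (hsuff c hc)
  · rw [← ENNReal.div_le_iff' hL0 ENNReal.coe_ne_top]
    refine le_sInf fun c hc => ?_
    rcases eq_or_ne c ∞ with rfl | hct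
    · exact le_top
    · rw [ENNReal.div_le_iff' hL0 ENNReal.coe_ne_top]
      exact hnec c hct hc

/-- Since `(∫_0^t w) (∫_t^x u)^{q/r}` is at most `∫_0^x w(s) (∫_s^x u)^{q/r} ds`, the quantity `E₁`
controls the supremum over the inner Hardy constants; therefore it suffices alone when
`p ≤ min q r`. -/
lemma weightSup_supConst_le {p q r : ℝ} (hp : 1 < p) (hq : 0 < q) (hr : 0 < r)
    {u v w : ℝ → ℝ≥0∞} (hw : IsWeight w) :
    weightSup q w (supConst p r u v) ≤ E₁ p q r u v w := by
  obtain ⟨w', hw', -, hwe⟩ := hw.exists_measurable_pos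
  rw [weightSup_congr hwe (fun _ _ => rfl), E₁_congr .rfl .rfl hwe]
  refine essSup_le_of_ae_le _ ?_
  filter_upwards [ae_restrict_mem measurableSet_Ioi] with t ht
  rw [supConst, essSupIoi, ← ENNReal.essSup_const_mul]
  refine essSup_le_of_ae_le _ ?_
  filter_upwards [ae_restrict_mem measurableSet_Ioi] with x hx
  refine le_trans ?_ (rpow_mul_rpow_le_E₁ hp hq hr u v hw' x)
  rw [← mul_assoc]
  refine mul_le_mul_left ?_ _
  have h1 : intIoo w' 0 t * intIoo u t x ^ (q / r) ≤ accum q r u w' x := by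
    rw [intIoo, ← lintegral_mul_const _ hw']
    refine le_trans (setLIntegral_mono' measurableSet_Ioo fun s hs => ?_)
      (lintegral_mono_set (Ioo_subset_Ioo_right (le_of_lt hx)))
    exact mul_le_mul_right (ENNReal.rpow_le_rpow (intIoo_anti_left u x hs.2.le)
      (by positivity)) _
  have h2 := ENNReal.rpow_le_rpow h1 (one_div_nonneg.2 hq.le)
  rwa [ENNReal.mul_rpow_of_nonneg _ _ (by positivity), ← ENNReal.rpow_mul,
    show q / r * (1 / q) = 1 / r by field_simp] at h2

lemma E₅_eq {p q r : ℝ} (hq : 0 < q) (hqp : q < p) (hr : 0 < r) (hrp : r < p)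
    (u v w : ℝ → ℝ≥0∞) :
    E₅ p q r u v w = weightInt p q w (intConst p r u v) ^ ((p - q) / (p * q)) := by
  have : 0 < p - q := by linarith
  have : 0 < p - r := by linarith
  have : 0 < p := by linarith
  unfold E₅ weightInt intConst
  simp_rw [← ENNReal.rpow_mul]
  rw [show (p - r) / (p * r) * (p * q / (p - q)) = q * (p - r) / (r * (p - q)) by field_simp]

/-- The case `q < p` for weights in the almost everywhere sense, where `S u v` is comparable to the
inner Hardy constant and does not depend on the choice of representatives. -/
theorem bestConst_equiv_of_lt {p q r : ℝ} (hp : 1 < p) (hq : 0 < q) (hqp : q < p) (hr : 0 < r)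
    (K : ℝ≥0) (S : (ℝ → ℝ≥0∞) → (ℝ → ℝ≥0∞) → ℝ → ℝ≥0∞)
    (hScongr : ∀ u u' v v' : ℝ → ℝ≥0∞, u =ᵐ[volume.restrict (Ioi 0)] u' →
      v =ᵐ[volume.restrict (Ioi 0)] v' → ∀ t, 0 < t → S u v t = S u' v' t)
    (hS : ∀ u v, Measurable u → (∀ x, 0 < u x) → Measurable v → (∀ x, 0 < v x) →
      IsHardyConst p r u v (S u v) K) :
    ∃ L : ℝ≥0, 0 < L ∧ ∀ u v w, IsWeight u → IsWeight v → IsWeight w →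
      (Holds p q r u v w ↔
        weightInt p q w (S u v) ^ ((p - q) / (p * q)) + E₃ p q r u v w < ∞) ∧
      bestConst p q r u v w ≤
        L * (weightInt p q w (S u v) ^ ((p - q) / (p * q)) + E₃ p q r u v w) ∧
      weightInt p q w (S u v) ^ ((p - q) / (p * q)) + E₃ p q r u v w ≤
        L * bestConst p q r u v w := by
  obtain ⟨L, hL, H⟩ := exists_iterBound_iff_of_lt p q r hp hq hqp hr K
  refine ⟨L, hL, fun u v w hu hv hw => ?_⟩
  obtain ⟨u', hu', hu0, hue⟩ := hu.exists_measurable_pos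
  obtain ⟨v', hv', hv0, hve⟩ := hv.exists_measurable_pos
  obtain ⟨w', hw', hw0, hwe⟩ := hw.exists_measurable_pos
  have hH := H u' v' w' _ hu' hu0 hv' hv0 hw' hw0 (hS u' v' hu' hu0 hv' hv0)
  rw [← weightInt_congr hwe (hScongr u u' v v' hue hve) p q,
    ← accumInt_congr hue hve hwe p q r] at hH
  simp_rw [← holdsWith_iff_iterBound hq hue hve hwe] at hH
  exact bestConst_equiv hL hH.1 hH.2

/-- The case `p ≤ q` for weights in the almost everywhere sense, where `S u v` is comparable to the
inner Hardy constant and does not depend on the choice of representatives. -/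
theorem bestConst_equiv_of_le {p q r : ℝ} (hp : 1 < p) (hpq : p ≤ q) (hr : 0 < r)
    (K : ℝ≥0) (S : (ℝ → ℝ≥0∞) → (ℝ → ℝ≥0∞) → ℝ → ℝ≥0∞)
    (hScongr : ∀ u u' v v' : ℝ → ℝ≥0∞, u =ᵐ[volume.restrict (Ioi 0)] u' →
      v =ᵐ[volume.restrict (Ioi 0)] v' → ∀ t, 0 < t → S u v t = S u' v' t)
    (hS : ∀ u v, Measurable u → (∀ x, 0 < u x) → Measurable v → (∀ x, 0 < v x) →
      IsHardyConst p r u v (S u v) K) :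
    ∃ L : ℝ≥0, 0 < L ∧ ∀ u v w, IsWeight u → IsWeight v → IsWeight w →
      (Holds p q r u v w ↔ E₁ p q r u v w + weightSup q w (S u v) < ∞) ∧
      bestConst p q r u v w ≤ L * (E₁ p q r u v w + weightSup q w (S u v)) ∧
      E₁ p q r u v w + weightSup q w (S u v) ≤ L * bestConst p q r u v w := by
  obtain ⟨L, hL, H⟩ := exists_iterBound_iff_of_le p q r hp hpq hr K
  refine ⟨L, hL, fun u v w hu hv hw => ?_⟩
  obtain ⟨u', hu', hu0, hue⟩ := hu.exists_measurable_pos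
  obtain ⟨v', hv', hv0, hve⟩ := hv.exists_measurable_pos
  obtain ⟨w', hw', hw0, hwe⟩ := hw.exists_measurable_pos
  have hH := H u' v' w' _ hu' hu0 hv' hv0 hw' hw0 (hS u' v' hu' hu0 hv' hv0)
  rw [← weightSup_congr hwe (hScongr u u' v v' hue hve) q,
    ← E₁_congr hue hve hwe p q r] at hH
  simp_rw [← holdsWith_iff_iterBound (by linarith : 0 < q) hue hve hwe] at hH
  exact bestConst_equiv hL hH.1 hH.2

end IterCopson

theorem mainTheorem10 (p q r : ℝ) (hp : 1 < p) (hq : 0 < q) (hr : 0 < r) :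
    -- (a)
    (p ≤ min q r →
      ∃ K : ℝ≥0, 0 < K ∧ ∀ u v w : ℝ → ℝ≥0∞,
        IterCopson.IsWeight u → IterCopson.IsWeight v → IterCopson.IsWeight w →
        (IterCopson.Holds p q r u v w ↔ IterCopson.E₁ p q r u v w < ∞) ∧
        IterCopson.bestConst p q r u v w ≤ K * IterCopson.E₁ p q r u v w ∧
        IterCopson.E₁ p q r u v w ≤ K * IterCopson.bestConst p q r u v w) ∧
    -- (b)
    (q < p → p ≤ r →
      ∃ K : ℝ≥0, 0 < K ∧ ∀ u v w : ℝ → ℝ≥0∞,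
        IterCopson.IsWeight u → IterCopson.IsWeight v → IterCopson.IsWeight w →
        (IterCopson.Holds p q r u v w ↔
          IterCopson.E₂ p q r u v w < ∞ ∧ IterCopson.E₃ p q r u v w < ∞) ∧
        IterCopson.bestConst p q r u v w ≤
          K * (IterCopson.E₂ p q r u v w + IterCopson.E₃ p q r u v w) ∧
        IterCopson.E₂ p q r u v w + IterCopson.E₃ p q r u v w ≤
          K * IterCopson.bestConst p q r u v w) ∧
    -- (c)
    (r < p → p ≤ q →
      ∃ K : ℝ≥0, 0 < K ∧ ∀ u v w : ℝ → ℝ≥0∞,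
        IterCopson.IsWeight u → IterCopson.IsWeight v → IterCopson.IsWeight w →
        (IterCopson.Holds p q r u v w ↔
          IterCopson.E₁ p q r u v w < ∞ ∧ IterCopson.E₄ p q r u v w < ∞) ∧
        IterCopson.bestConst p q r u v w ≤
          K * (IterCopson.E₁ p q r u v w + IterCopson.E₄ p q r u v w) ∧
        IterCopson.E₁ p q r u v w + IterCopson.E₄ p q r u v w ≤
          K * IterCopson.bestConst p q r u v w) ∧
    -- (d)
    (max q r < p →
      ∃ K : ℝ≥0, 0 < K ∧ ∀ u v w : ℝ → ℝ≥0∞,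
        IterCopson.IsWeight u → IterCopson.IsWeight v → IterCopson.IsWeight w →
        (IterCopson.Holds p q r u v w ↔
          IterCopson.E₃ p q r u v w < ∞ ∧ IterCopson.E₅ p q r u v w < ∞) ∧
        IterCopson.bestConst p q r u v w ≤
          K * (IterCopson.E₃ p q r u v w + IterCopson.E₅ p q r u v w) ∧
        IterCopson.E₃ p q r u v w + IterCopson.E₅ p q r u v w ≤
          K * IterCopson.bestConst p q r u v w) := by
  refine ⟨fun hpqr => ?_, fun hqp hpr => ?_, fun hrp hpq => ?_, fun hqrp => ?_⟩
  · obtain ⟨L, hL, H⟩ := IterCopson.bestConst_equiv_of_le hp (hpqr.trans (min_le_left _ _)) hr 8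
      (IterCopson.supConst p r)
      (fun u u' v v' hu hv t ht => IterCopson.supConst_congr hu hv p r ht.le)
      (fun u v hu _ hv hv0 => IterCopson.isHardyConst_supConst hp hr
        (hpqr.trans (min_le_right _ _)) hu hv hv0)
    refine ⟨2 * L, by positivity, fun u v w hu hv hw => ?_⟩
    obtain ⟨h1, h2, h3⟩ := H u v w hu hv hw
    have hle := IterCopson.weightSup_supConst_le (u := u) (v := v) hp hq hr hw
    have h2E : IterCopson.E₁ p q r u v w + IterCopson.weightSup q w (IterCopson.supConst p r u v) ≤
        2 * IterCopson.E₁ p q r u v w := by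
      rw [two_mul]
      exact add_le_add le_rfl hle
    refine ⟨h1.trans ⟨fun h => lt_of_le_of_lt le_self_add h, fun h => ?_⟩, ?_, ?_⟩
    · exact h2E.trans_lt (ENNReal.mul_lt_top (by norm_num) h)
    · refine h2.trans ((mul_le_mul_right h2E _).trans (le_of_eq ?_))
      push_cast
      ring
    · refine le_self_add.trans (h3.trans (mul_le_mul_left ?_ _))
      push_cast
      exact le_mul_of_one_le_left zero_le (by norm_num)
  · obtain ⟨L, hL, H⟩ := IterCopson.bestConst_equiv_of_lt hp hq hqp hr 8
      (IterCopson.supConst p r)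
      (fun u u' v v' hu hv t ht => IterCopson.supConst_congr hu hv p r ht.le)
      (fun u v hu _ hv hv0 => IterCopson.isHardyConst_supConst hp hr hpr hu hv hv0)
    refine ⟨L, hL, fun u v w hu hv hw => ?_⟩
    rw [← ENNReal.add_lt_top]
    exact H u v w hu hv hw
  · obtain ⟨K, hK⟩ := IterCopson.exists_isHardyConst_intConst hp hr hrp
    obtain ⟨L, hL, H⟩ := IterCopson.bestConst_equiv_of_le hp hpq hr K (IterCopson.intConst p r)
      (fun u u' v v' hu hv t ht => IterCopson.intConst_congr hu hv p r ht.le) hK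
    refine ⟨L, hL, fun u v w hu hv hw => ?_⟩
    rw [← ENNReal.add_lt_top]
    exact H u v w hu hv hw
  · have hqp := (le_max_left _ _).trans_lt hqrp
    have hrp := (le_max_right _ _).trans_lt hqrp
    obtain ⟨K, hK⟩ := IterCopson.exists_isHardyConst_intConst hp hr hrp
    obtain ⟨L, hL, H⟩ := IterCopson.bestConst_equiv_of_lt hp hq hqp hr K
      (IterCopson.intConst p r)
      (fun u u' v v' hu hv t ht => IterCopson.intConst_congr hu hv p r ht.le) hK
    refine ⟨L, hL, fun u v w hu hv hw => ?_⟩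
    rw [← ENNReal.add_lt_top, IterCopson.E₅_eq hq hqp hr hrp, add_comm]
    exact H u v w hu hv hw
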